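/- **Setting.** Let $U=[0,1]^3$ with periodic boundary conditions, $|\cdot|$ the Euclidean distance on $U$, and $0<T<\infty$. Let $f_0$ on $U\times\mathbb R^3$ and $g_0$ on $\mathbb R^3$ be probability densities with $\int f_0(x,v)(1+|v|^2)\,dx\,dv<\infty$, $\int g_0(v)(1+|v|^2)\,dv<\infty$ and $\operatorname{ess\,sup}_v g_0(v)(1+|v|^{3+\eta})<\infty$ for some $\eta>0$. Let $V,M:(0,\infty)\to[0,\infty)$ be non-increasing, tend to $\infty$ at $0$, and satisfy $\varepsilon V(\varepsilon)^3\le\frac18$ and $M(\varepsilon)\le\varepsilon^{-1/2}$ for $0<\varepsilon<1$. **Trees.** A collision tree is $\Phi=((x_0,v_0),(t_1,\nu_1,v_1),\dots,(t_n,\nu_n,v_n))$ with $n=n(\Phi)\ge 0$, $(x_0,v_0)\in U\times\mathbb R^3$, $0<t_1<\dots<t_n\le T$, $\nu_j\in\mathbb S^2$, $v_j\in\mathbb R^3$; $\tau=t_n$ ($\tau=0$ if $n=0$). It determines the trajectory $(x(s),v(s))$ of the tagged particle: $x(0)=x_0$, $v(0)=v_0$, $\dot x=v$, with $v$ constant except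 that $v(t_j)=v(t_j^-)-\big(\nu_j\cdot(v(t_j^-)-v_j)\big)\nu_j$. For a diameter $\varepsilon\ge0$, let $x_j^{\varepsilon}=x(t_j)+\varepsilon\nu_j-t_jv_j$ be the initial position of the $j$-th background particle. For $n\ge1$, $\bar\Phi$ is $\Phi$ without its last collision $(\tau,\nu,v')=(t_n,\nu_n,v_n)$. Trees carry Lebesgue measure $\lambda$ (surface measure in each $\nu_j$). **Good trees.** $\mathcal G(\varepsilon)$ is the set of trees with $n(\Phi)\le M(\varepsilon)$; $|v_j|\le V(\varepsilon)$ for all $j$ and $|v(s)|\le V(\varepsilon)$ for all $s\in[0,T]$; $|x(s)-(x_j^{\varepsilon'}+sv_j)|>\varepsilon'$ for all $0\le\varepsilon'\le\varepsilon$, all $j$ and all $0\le s<t_j$; $|x_0-x_j^{\varepsilon}|>\varepsilon$ for all $j$; and $\nu_j\cdot(v(t_j^-)-v_j)>0$ for all $j$. **Idealized distribution.** Put $\Lambda(v)=\int_{\mathbb S^2}\int_{\mathbb R^3}g_0(\bar v)[(v-\bar v)\cdot\nu]_+\,d\bar v\,d\nu$. Define $P_t(\Phi)=e^{-t\Lambda(v_0)}f_0(x_0,v_0)$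 if $n(\Phi)=0$, and otherwise $$P_t(\Phi)=\mathbf 1_{t\ge\tau}\,e^{-(t-\tau)\Lambda(v(\tau))}\,P_\tau(\bar\Phi)\,g_0(v')\,[(v(\tau^-)-v')\cdot\nu]_+ .$$ **Empirical distribution.** Let $N\in\mathbb N$ and $N\varepsilon^2=1$. The tagged particle starts with density $f_0$; independently, $N$ independent background particles start uniformly distributed in $U$ with velocity density $g_0$, and move freely forever. The tagged particle moves freely except that, when its centre reaches distance $\varepsilon$ from the centre of a background particle with velocity $u$, its velocity $v$ becomes $v-(\nu\cdot(v-u))\nu$, where $\varepsilon\nu$ is the vector from the centre of the tagged particle to that of the background particle. $\hat P^\varepsilon_t$ is the law, restricted to initial data without overlap of the tagged particle with a background particle, of the tree formed by the initial data of the tagged particle and all its collisions up to time $t$; $\hat P^\varepsilon_t(\Phi)$ denotes its density with respect to $\lambda$. **Error term.** Let $\zeta(\varepsilon)=(1-\tfrac43\pi\varepsilon^3)^N$; let $\eta^\varepsilon_t(\Phi)=\int_{U\times\mathbb R^3}g_0(\bar v)\big(1-\mathbf 1^\varepsilon_t[\Phi](\bar x,\bar v)\big)\,d\bar x\,d\bar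 v$, where $\mathbf 1^\varepsilon_t[\Phi](\bar x,\bar v)=1$ if $|x(s)-(\bar x+s\bar v)|>\varepsilon$ for all $s\in(0,t)$, and $0$ otherwise; let $C(\Phi)=2\sup_{s\in[0,T]}\Lambda(v(s))$. Put $\rho^{\varepsilon,0}_t(\Phi)=\eta^\varepsilon_t(\Phi)\,C(\Phi)\,t$, $\rho^{\varepsilon,k}_t(\Phi)=(1-\varepsilon)\rho^{\varepsilon,k-1}_t(\Phi)+\rho^{\varepsilon,0}_t(\Phi)+\varepsilon$ for $k\ge1$, and $\hat\rho^\varepsilon_t(\Phi)=\rho^{\varepsilon,n(\Phi)}_t(\Phi)$. **Proposition.** There is $\varepsilon_0>0$, depending only on $T,f_0,g_0,V,M$, such that for all $N\in\mathbb N$ and $0<\varepsilon<\varepsilon_0$ with $N\varepsilon^2=1$ and all $t\in[0,T]$, for $\lambda$-almost every $\Phi\in\mathcal G(\varepsilon)$ such that the tagged particle does not meet a background particle of $\Phi$ again up to time $t$ (that is, $|x(s)-(x_j^\varepsilon+sv_j)|>\varepsilon$ for all $j$ and all $t_j<s\le t$), $$\hat P^\varepsilon_t(\Phi)-\zeta(\varepsilon)P_t(\Phi)\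 \ge\ -\hat\rho^\varepsilon_t(\Phi)\,\zeta(\varepsilon)P_t(\Phi).$$ -/

import Mathlib

open MeasureTheory Set Filter Topology

noncomputable section

namespace RayleighGas

/-! Geometry: the unit cube with periodic boundary conditions, velocities, impact directions. -/

/-- The position space `[0,1]^3` with periodic boundary conditions. -/
abbrev Torus := Fin 3 → UnitAddCircle

/-- The velocity space, with the Euclidean norm. -/
abbrev Vel := EuclideanSpace ℝ (Fin 3)

/-- The unit sphere of `Vel`. -/
abbrev Direction := Metric.sphere (0 : Vel) 1

/-- Surface measure on the unit sphere (total mass `4π`). -/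
def sphereMeasure : Measure Direction := (volume : Measure Vel).toSphere

/-- The projection of `ℝ^3` onto the torus. -/
def toTorus (y : Vel) : Torus := fun i => (y i : UnitAddCircle)

/-- The Euclidean distance on the flat torus (the norm of an element of `UnitAddCircle` is its
distance to the nearest integer). -/
def torusDist (x y : Torus) : ℝ := √(∑ i, ‖x i - y i‖ ^ 2)

/-! Collision trees. -/

/-- A marker `(t_j, ν_j, v_j)`: collision time, collision parameter (pointing from the tagged
particle to the background particle), velocity of the background particle. -/
abbrev Marker := ℝ × Direction × Vel

/-- The number of collisions, the initial data `(x₀, v₀)` of the tagged particle, and the list of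
markers. -/
abbrev CollisionTree := Σ n : ℕ, (Torus × Vel) × (Fin n → Marker)

/-- Lebesgue measure on the space of trees. -/
def treeMeasure : Measure CollisionTree :=
  Measure.sum fun n : ℕ =>
    Measure.map (Sigma.mk n)
      ((volume : Measure (Torus × Vel)).prod
        (Measure.pi fun _ : Fin n =>
          (volume : Measure ℝ).prod (sphereMeasure.prod (volume : Measure Vel))))

/-- `n(Φ)`. -/
abbrev numColl (Φ : CollisionTree) : ℕ := Φ.1

/-- Initial position `x₀` of the tagged particle. -/
def rootPos (Φ : CollisionTree) : Torus := Φ.2.1.1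

/-- Initial velocity `v₀` of the tagged particle. -/
def rootVel (Φ : CollisionTree) : Vel := Φ.2.1.2

/-- The collision time `t_j`. -/
def collTime (Φ : CollisionTree) (j : Fin (numColl Φ)) : ℝ := (Φ.2.2 j).1

/-- The collision parameter `ν_j`. -/
def collDir (Φ : CollisionTree) (j : Fin (numColl Φ)) : Vel := (Φ.2.2 j).2.1

/-- The velocity `v_j` of the background particle of the `j`-th collision. -/
def collVel (Φ : CollisionTree) (j : Fin (numColl Φ)) : Vel := (Φ.2.2 j).2.2

/-- The collision times lie in `(0, T]` and are listed in increasing order. -/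
def IsTree (T : ℝ) (Φ : CollisionTree) : Prop :=
  (∀ j, 0 < collTime Φ j ∧ collTime Φ j ≤ T) ∧ StrictMono (collTime Φ)

/-- The velocity of the tagged particle after colliding, with collision parameter `ν`, with a
background particle of velocity `u`, if its velocity before was `v`. -/
def collide (ν u v : Vel) : Vel := v - (inner ℝ ν (v - u)) • ν

/-- The velocity of the tagged particle after the first `k` collisions of the tree. -/
def velAfter (Φ : CollisionTree) : ℕ → Vel
  | 0 => rootVel Φ
  | k + 1 =>
    if h : k < numColl Φ then collide (collDir Φ ⟨k, h⟩) (collVel Φ ⟨k, h⟩) (velAfter Φ k)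
    else velAfter Φ k

/-- The velocity `v(s)` of the tagged particle (post-collisional at collision times). -/
def vel (Φ : CollisionTree) (s : ℝ) : Vel :=
  velAfter Φ (Finset.univ.filter fun j => collTime Φ j ≤ s).card

/-- The velocity `v(s⁻)` of the tagged particle. -/
def velBefore (Φ : CollisionTree) (s : ℝ) : Vel :=
  velAfter Φ (Finset.univ.filter fun j => collTime Φ j < s).card

/-- The position `x(s) = x₀ + ∫₀ˢ v(r) dr` of the tagged particle, `s ≥ 0`: each collision `j`
adds its velocity jump times the time `(s - t_j)₊` elapsed since. -/
def pos (Φ : CollisionTree) (s : ℝ) : Torus :=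
  rootPos Φ + toTorus (s • rootVel Φ +
    ∑ j : Fin (numColl Φ), max (s - collTime Φ j) 0 • (velAfter Φ ((j : ℕ) + 1) - velAfter Φ (j : ℕ)))

/-- The initial position `x_j` of the background particle of the `j`-th collision, if the
particles have diameter `ε`. -/
def partnerStart (ε : ℝ) (Φ : CollisionTree) (j : Fin (numColl Φ)) : Torus :=
  pos Φ (collTime Φ j) + toTorus (ε • collDir Φ j - collTime Φ j • collVel Φ j)

/-- The position `x_j + s v_j` of that particle at time `s`. -/
def partnerPos (ε : ℝ) (Φ : CollisionTree) (j : Fin (numColl Φ)) (s : ℝ) : Torus :=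
  partnerStart ε Φ j + toTorus (s • collVel Φ j)

/-! Good trees. -/

/-- For every diameter `ε' ≤ ε`, the tagged particle does not meet the background particle of the
`j`-th collision before time `t_j`. -/
def RecollisionFree (ε : ℝ) (Φ : CollisionTree) : Prop :=
  ∀ ε' : ℝ, 0 ≤ ε' → ε' ≤ ε → ∀ j, ∀ s : ℝ, 0 ≤ s → s < collTime Φ j →
    ε' < torusDist (pos Φ s) (partnerPos ε' Φ j s)

/-- The tagged particle does not initially overlap a background particle of the tree. -/
def NoInitialOverlap (ε : ℝ) (Φ : CollisionTree) : Prop :=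
  ∀ j, ε < torusDist (rootPos Φ) (partnerStart ε Φ j)

/-- All collisions are non-grazing. -/
def NonGrazing (Φ : CollisionTree) : Prop :=
  ∀ j, 0 < inner ℝ (collDir Φ j) (velBefore Φ (collTime Φ j) - collVel Φ j)

/-- The set `𝒢(ε)` of good trees; the second and third conditions say `𝒱(Φ) ≤ V(ε)`. -/
def goodTrees (T : ℝ) (V M : ℝ → ℝ) (ε : ℝ) : Set CollisionTree :=
  {Φ | IsTree T Φ ∧ (numColl Φ : ℝ) ≤ M ε ∧
    (∀ j, ‖collVel Φ j‖ ≤ V ε) ∧ (∀ s ∈ Icc 0 T, ‖vel Φ s‖ ≤ V ε) ∧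
    RecollisionFree ε Φ ∧ NoInitialOverlap ε Φ ∧ NonGrazing Φ}

/-- Up to time `t`, the tagged particle does not meet a background particle of the tree again
after having collided with it. -/
def NoLaterContact (ε t : ℝ) (Φ : CollisionTree) : Prop :=
  ∀ j, ∀ s : ℝ, collTime Φ j < s → s ≤ t → ε < torusDist (pos Φ s) (partnerPos ε Φ j s)

/-- The standing assumptions on the cut-off functions `V` and `M`. -/
structure IsCutoff (V M : ℝ → ℝ) : Prop where
  V_nonneg : ∀ ε, 0 < ε → 0 ≤ V ε
  M_nonneg : ∀ ε, 0 < ε → 0 ≤ M ε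
  V_anti : AntitoneOn V (Ioi 0)
  M_anti : AntitoneOn M (Ioi 0)
  V_tendsto : Tendsto V (𝓝[>] 0) atTop
  M_tendsto : Tendsto M (𝓝[>] 0) atTop
  V_le : ∀ ε, 0 < ε → ε < 1 → ε * V ε ^ 3 ≤ 1 / 8
  M_le : ∀ ε, 0 < ε → ε < 1 → M ε ≤ 1 / √ε

/-- Admissible probability densities. The last condition with `η = 1` is the bound on
`g₀(v)(1 + |v|^4)`; the weaker bounds with `0 < η < 1` are allowed as well. -/
structure Admissible (f₀ : Torus × Vel → ℝ) (g₀ : Vel → ℝ) : Prop where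
  f_meas : Measurable f₀
  f_nonneg : ∀ p, 0 ≤ f₀ p
  f_integral : ∫ p, f₀ p = 1
  f_moment : Integrable fun p : Torus × Vel => f₀ p * (1 + ‖p.2‖ ^ 2)
  g_meas : Measurable g₀
  g_nonneg : ∀ v, 0 ≤ g₀ v
  g_integral : ∫ v, g₀ v = 1
  g_moment : Integrable fun v : Vel => g₀ v * (1 + ‖v‖ ^ 2)
  g_bound : ∃ η : ℝ, 0 < η ∧ ∃ K : ℝ, ∀ᵐ v : Vel, g₀ v * (1 + ‖v‖ ^ (3 + η)) ≤ K

/-! The idealized distribution. -/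

/-- The collision rate `∫_{S²} ∫_{ℝ³} g₀(u) [(v - u)·ν]₊ du dν` at velocity `v`. -/
def rate (g₀ : Vel → ℝ) (v : Vel) : ℝ :=
  ∫ ν : Direction, (∫ u : Vel, g₀ u * max (inner ℝ (v - u) (ν : Vel)) 0) ∂sphereMeasure

/-- The density `P_t(Φ)` of the idealized distribution, recursively in the number of collisions:
the tree without its final collision has the markers `Fin.init c`. -/
def idealAux (f₀ : Torus × Vel → ℝ) (g₀ : Vel → ℝ) (r : Torus × Vel) :
    (n : ℕ) → (Fin n → Marker) → ℝ → ℝ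
  | 0, _, t => Real.exp (-(t * rate g₀ r.2)) * f₀ r
  | n + 1, c, t =>
    let τ : ℝ := (c (Fin.last n)).1
    let ν : Vel := (c (Fin.last n)).2.1
    let v' : Vel := (c (Fin.last n)).2.2
    let Φ : CollisionTree := ⟨n + 1, (r, c)⟩
    if τ ≤ t then
      Real.exp (-((t - τ) * rate g₀ (vel Φ τ))) * idealAux f₀ g₀ r n (Fin.init c) τ *
        g₀ v' * max (inner ℝ (velBefore Φ τ - v') ν) 0
    else 0

/-- The density `P_t(Φ)` as a function on trees. -/
def idealDensity (f₀ : Torus × Vel → ℝ) (g₀ : Vel → ℝ) (t : ℝ) (Φ : CollisionTree) : ℝ :=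
  idealAux f₀ g₀ Φ.2.1 Φ.1 Φ.2.2 t

/-! The particle dynamics and the empirical distribution. -/

/-- Initial data of the tagged particle and of the `N` background particles. -/
abbrev Config (N : ℕ) := (Torus × Vel) × (Fin N → Torus × Vel)

/-- The law of the initial data: all particles are independent, the tagged particle has density
`f₀`, the background particles are uniform in space with density `g₀` in velocity. -/
def configLaw (f₀ : Torus × Vel → ℝ) (g₀ : Vel → ℝ) (N : ℕ) : Measure (Config N) :=
  ((volume : Measure (Torus × Vel)).withDensity fun p => ENNReal.ofReal (f₀ p)).prod
    (Measure.pi fun _ : Fin N =>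
      (volume : Measure (Torus × Vel)).withDensity fun p => ENNReal.ofReal (g₀ p.2))

/-- The position at time `s` of the `i`-th background particle, which moves freely. -/
def bgPos {N : ℕ} (z : Config N) (i : Fin N) (s : ℝ) : Torus :=
  (z.2 i).1 + toTorus (s • (z.2 i).2)

/-- `Φ` is the history of collisions of the tagged particle in the time interval `[0, t]` in the
hard-sphere dynamics with diameter `ε` started from `z`: there is no initial overlap, the `j`-th
collision of `Φ` takes place with the background particle `p j`, whose centre is then at
`x(t_j) + ε ν_j`, and the tagged particle, which moves along the trajectory determined by `Φ`,
stays at distance more than `ε` from all background particles except at these collisions. In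
particular all collisions are binary and only finitely many occur. -/
def IsHistory {N : ℕ} (ε t : ℝ) (z : Config N) (Φ : CollisionTree) : Prop :=
  Φ.2.1 = z.1 ∧ IsTree t Φ ∧ (∀ i, ε < torusDist z.1.1 (z.2 i).1) ∧
    ∃ p : Fin (numColl Φ) → Fin N,
      (∀ j, (z.2 (p j)).2 = collVel Φ j ∧
        bgPos z (p j) (collTime Φ j) = pos Φ (collTime Φ j) + toTorus (ε • collDir Φ j)) ∧
      ∀ s ∈ Icc 0 t, ∀ i, torusDist (pos Φ s) (bgPos z i s) ≤ ε → ∃ j, p j = i ∧ collTime Φ j = s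

open Classical in
/-- The history of collisions up to time `t`, where there is one (it is unique if `ε < 1/2`);
a dummy value otherwise. -/
def history {N : ℕ} (ε t : ℝ) (z : Config N) : CollisionTree :=
  if h : ∃ Φ, IsHistory ε t z Φ then h.choose else ⟨0, (z.1, Fin.elim0)⟩

/-- The empirical distribution: the law of the history of collisions up to time `t`. Initial data
with an overlap and the null set where the dynamics is not well defined are discarded, so it has
mass at most one. -/
def empiricalLaw (f₀ : Torus × Vel → ℝ) (g₀ : Vel → ℝ) (N : ℕ) (ε t : ℝ) :
    Measure CollisionTree :=
  Measure.map (history ε t)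
    ((configLaw f₀ g₀ N).restrict {z | ∃ Φ, IsHistory ε t z Φ})

/-- The density `P̂_t^ε(Φ)` of the empirical distribution with respect to the Lebesgue measure on
trees. -/
def empiricalDensity (f₀ : Torus × Vel → ℝ) (g₀ : Vel → ℝ) (N : ℕ) (ε t : ℝ)
    (Φ : CollisionTree) : ℝ :=
  ((empiricalLaw f₀ g₀ N ε t).rnDeriv treeMeasure Φ).toReal

/-! The error term. -/

/-- `ζ(ε) = (1 - (4/3) π ε³)^N`. -/
def zeta (N : ℕ) (ε : ℝ) : ℝ := (1 - 4 / 3 * Real.pi * ε ^ 3) ^ N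

/-- The set of initial data for which a background particle does not meet the tagged particle of
the tree during `(0, t)`. -/
def avoidSet (ε t : ℝ) (Φ : CollisionTree) : Set (Torus × Vel) :=
  {p | ∀ s ∈ Ioo 0 t, ε < torusDist (pos Φ s) (p.1 + toTorus (s • p.2))}

/-- `η_t^ε(Φ)`. -/
def etaErr (g₀ : Vel → ℝ) (ε t : ℝ) (Φ : CollisionTree) : ℝ :=
  ∫ p : Torus × Vel, g₀ p.2 * (1 - (avoidSet ε t Φ).indicator (fun _ => (1 : ℝ)) p)

/-- `C(Φ)`, twice the maximal collision rate along the trajectory. -/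
def maxRate (g₀ : Vel → ℝ) (T : ℝ) (Φ : CollisionTree) : ℝ :=
  2 * ⨆ s : Icc (0 : ℝ) T, rate g₀ (vel Φ s)

/-- `ρ_t^{ε,k}(Φ)`. -/
def rho (g₀ : Vel → ℝ) (T ε t : ℝ) (Φ : CollisionTree) : ℕ → ℝ
  | 0 => etaErr g₀ ε t Φ * maxRate g₀ T Φ * t
  | k + 1 =>
    (1 - ε) * rho g₀ T ε t Φ k + etaErr g₀ ε t Φ * maxRate g₀ T Φ * t + ε

/-- `ρ̂_t^ε(Φ)`. -/
def rhoHat (g₀ : Vel → ℝ) (T ε t : ℝ) (Φ : CollisionTree) : ℝ :=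
  rho g₀ T ε t Φ (numColl Φ)

end RayleighGas

end

/-!
The history `Φ` of the tagged particle and the labels of the particles it collides with determine
the initial data of these particles; the Jacobian of this map is `∏ ε² [(v(t_j⁻) - v_j)·ν_j]₊`.
Conversely, if `Φ` is good and the remaining `N - n` particles do not meet the trajectory, then `Φ`
is the history. Summing over the `N! / (N - n)!` labellings gives
`P̂_t(Φ) ≥ N! / (N - n)! ε^{2n} f₀ ∏ g₀(v_j) [(v(t_j⁻) - v_j)·ν_j]₊ (1 - b)^{N - n}`,
where `b` is the probability that a background particle meets the trajectory before time `t`.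
The volume swept by the sphere of radius `ε` gives `b ≤ 4/3 π ε³ + ε² L`, where `L` is the integral
of the collision rate along the trajectory, so `N ε² = 1` yields
`(1 - b)^N ≥ ζ(ε) e^{-L} (1 - 2 b L)`, and `P_t(Φ) = e^{-L} f₀ ∏ g₀(v_j) [(v(t_j⁻) - v_j)·ν_j]₊`.
-/

namespace RayleighGas

section FundamentalDomain

variable {G H : Type*} [AddGroup G] [AddGroup H] [MeasurableSpace G] [MeasurableSpace H]
  [MeasurableAdd G] {μ : Measure G} [μ.IsAddLeftInvariant] {ν : Measure H} {π : G →+ H}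
  [Countable π.ker] {D : Set G}

theorem measure_inter_preimage_le_of_injOn (hD : IsAddFundamentalDomain π.ker D μ)
    (hDm : MeasurableSet D) (hπ : MeasurePreserving π (μ.restrict D) ν) (hπm : Measurable π)
    {Q : Set G} (hQ : MeasurableSet Q) (hinj : InjOn π Q) {B : Set H} (hB : MeasurableSet B) :
    μ (Q ∩ π ⁻¹' B) ≤ ν B := by
  have hπ_vadd (k : π.ker) (x : G) : π (k +ᵥ x) = π x := by
    simp [AddSubgroup.vadd_def, AddMonoidHom.mem_ker.1 k.2]
  rw [hD.measure_eq_tsum, ← hπ.measure_preimage hB.nullMeasurableSet,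
    Measure.restrict_apply (hπm hB), ← measure_iUnion]
  · refine measure_mono (iUnion_subset fun k => inter_subset_inter_left _ ?_)
    rintro _ ⟨y, hy, rfl⟩
    simpa only [mem_preimage, hπ_vadd] using hy.2
  · refine fun k l hkl => Set.disjoint_left.2 ?_
    rintro _ ⟨⟨y, hy, rfl⟩, -⟩ ⟨⟨y', hy', hyy'⟩, -⟩
    have hπy : π y' = π y :=
      (hπ_vadd l y').symm.trans ((congrArg π hyy').trans (hπ_vadd k y))
    obtain rfl : y' = y := hinj hy'.1 hy.1 hπy
    exact hkl (Subtype.ext (add_right_cancel hyy'.symm))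
  · exact fun k => ((hQ.inter (hπm hB)).const_vadd k).inter hDm

theorem measure_le_of_subset_image (hD : IsAddFundamentalDomain π.ker D μ)
    (hπ : MeasurePreserving π (μ.restrict D) ν) (hπm : Measurable π) {A : Set G} {B : Set H}
    (hB : MeasurableSet B) (hBA : B ⊆ π '' A) : ν B ≤ μ A := by
  rw [hD.measure_eq_tsum, ← hπ.measure_preimage hB.nullMeasurableSet,
    Measure.restrict_apply (hπm hB)]
  refine (measure_mono ?_).trans (measure_iUnion_le _)
  rintro y ⟨hyB, hyD⟩
  obtain ⟨a, ha, hay⟩ := hBA hyB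
  have hker : y - a ∈ π.ker := by rw [AddMonoidHom.mem_ker, map_sub, hay, sub_self]
  exact mem_iUnion.2 ⟨⟨y - a, hker⟩, ⟨a, ha, sub_add_cancel y a⟩, hyD⟩

end FundamentalDomain

theorem toTorus_zero : toTorus 0 = 0 := rfl

theorem toTorus_add (a b : Vel) : toTorus (a + b) = toTorus a + toTorus b := rfl

/-- The projection `toTorus` as a group homomorphism. -/
def toTorusHom : Vel →+ Torus where
  toFun := toTorus
  map_zero' := toTorus_zero
  map_add' := toTorus_add

theorem toTorus_neg (a : Vel) : toTorus (-a) = -toTorus a := map_neg toTorusHom a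

theorem toTorus_sub (a b : Vel) : toTorus (a - b) = toTorus a - toTorus b := map_sub toTorusHom a b

@[fun_prop]
theorem continuous_toTorus : Continuous toTorus :=
  continuous_pi fun i => (AddCircle.continuous_mk' (1 : ℝ)).comp (by fun_prop)

@[fun_prop]
theorem measurable_toTorus : Measurable toTorus := continuous_toTorus.measurable

theorem toTorus_injOn_closedBall {r : ℝ} (hr : r < 1 / 2) :
    InjOn toTorus (Metric.closedBall 0 r) := by
  have coord_mem {y : Vel} (hy : y ∈ Metric.closedBall 0 r) (i : Fin 3) :
      y i ∈ Ico (-(1 / 2) : ℝ) (-(1 / 2) + 1) := by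
    have := abs_le.1 ((PiLp.norm_apply_le y i).trans (mem_closedBall_zero_iff.1 hy))
    constructor <;> linarith [this.1, this.2]
  intro a ha b hb hab
  ext i
  exact (AddCircle.coe_eq_coe_iff_of_mem_Ico (coord_mem ha i) (coord_mem hb i)).1 (congrFun hab i)

@[fun_prop]
theorem continuous_torusDist {X : Type*} [TopologicalSpace X] {f g : X → Torus}
    (hf : Continuous f) (hg : Continuous g) : Continuous fun x => torusDist (f x) (g x) := by
  unfold torusDist
  fun_prop

theorem torusDist_comm (x y : Torus) : torusDist x y = torusDist y x := by
  simp only [torusDist, norm_sub_rev]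

theorem torusDist_congr {x y x' y' : Torus} (h : x - y = x' - y') :
    torusDist x y = torusDist x' y' := by
  simp only [torusDist, ← Pi.sub_apply, h]

theorem exists_norm_eq_torusDist (x y : Torus) :
    ∃ z : Vel, ‖z‖ = torusDist x y ∧ x - y = toTorus z := by
  have exists_coord (i : Fin 3) : ∃ a : ℝ, |a| = ‖x i - y i‖ ∧ (a : UnitAddCircle) = x i - y i := by
    obtain ⟨a, ha⟩ := QuotientAddGroup.mk_surjective (x i - y i)
    have ha : (a : UnitAddCircle) = x i - y i := ha
    have round_eq_zero : ((round a : ℝ) : UnitAddCircle) = 0 :=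
      (AddCircle.coe_eq_zero_iff 1).2 ⟨round a, by simp⟩
    exact ⟨a - round a, by rw [← ha, UnitAddCircle.norm_eq],
      by rw [← ha, AddCircle.coe_sub, round_eq_zero, sub_zero]⟩
  choose a ha hxa using exists_coord
  refine ⟨WithLp.toLp 2 a, ?_, funext fun i => (hxa i).symm⟩
  simp only [EuclideanSpace.norm_eq, Real.norm_eq_abs, ha, torusDist]

theorem torusDist_le_norm {x y : Torus} {z : Vel} (h : x - y = toTorus z) :
    torusDist x y ≤ ‖z‖ := by
  rw [EuclideanSpace.norm_eq, torusDist]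
  refine Real.sqrt_le_sqrt (Finset.sum_le_sum fun i _ => ?_)
  rw [← Pi.sub_apply, h, toTorus, UnitAddCircle.norm_eq]
  gcongr
  exact (round_le (z i) 0).trans (by simp)

/-- The half-open unit cube, a fundamental domain of the torus. -/
def unitCell : Set Vel := {y | ∀ i, y i ∈ Ioc (0 : ℝ) 1}

theorem unitCell_eq_preimage : unitCell = (MeasurableEquiv.toLp 2 (Fin 3 → ℝ)).symm ⁻¹'
    (univ.pi fun _ => Ioc (0 : ℝ) (0 + 1)) := by
  ext y
  simp [unitCell]

theorem measurableSet_unitCell : MeasurableSet unitCell := by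
  rw [unitCell_eq_preimage]
  exact (MeasurableEquiv.measurable _) (MeasurableSet.univ_pi fun _ => measurableSet_Ioc)

theorem mem_ker_toTorusHom {y : Vel} :
    y ∈ toTorusHom.ker ↔ ∃ k : Fin 3 → ℤ, y = WithLp.toLp 2 fun i => (k i : ℝ) := by
  have coord_iff (i : Fin 3) : (y i : UnitAddCircle) = 0 ↔ ∃ m : ℤ, y i = m := by
    simpa [eq_comm] using AddCircle.coe_eq_zero_iff (1 : ℝ) (x := y i)
  rw [AddMonoidHom.mem_ker, funext_iff]
  refine (forall_congr' coord_iff).trans (Classical.skolem.trans (exists_congr fun k => ?_))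
  exact ⟨fun h => PiLp.ext h, fun h i => by rw [h]⟩

instance : Countable toTorusHom.ker := by
  refine ((countable_range fun k : Fin 3 → ℤ =>
    (WithLp.toLp 2 fun i => (k i : ℝ) : Vel)).mono fun y hy => ?_).to_subtype
  obtain ⟨k, hk⟩ := mem_ker_toTorusHom.1 hy
  exact ⟨k, hk.symm⟩

theorem isAddFundamentalDomain_unitCell :
    IsAddFundamentalDomain toTorusHom.ker unitCell (volume : Measure Vel) := by
  refine .mk' measurableSet_unitCell.nullMeasurableSet fun y => ?_
  choose k hk hk_unique using fun i => existsUnique_add_zsmul_mem_Ioc one_pos (y i) 0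
  have vadd_apply (g : toTorusHom.ker) (l : Fin 3 → ℤ)
      (hg : (g : Vel) = WithLp.toLp 2 fun i => (l i : ℝ)) (i : Fin 3) :
      (g +ᵥ y) i = y i + l i • (1 : ℝ) := by
    simp [AddSubgroup.vadd_def, hg, add_comm]
  refine ⟨⟨WithLp.toLp 2 fun i => (k i : ℝ), mem_ker_toTorusHom.2 ⟨k, rfl⟩⟩, fun i => ?_,
    fun g hg => ?_⟩
  · rw [vadd_apply _ k rfl]
    simpa using hk i
  · obtain ⟨l, hl⟩ := mem_ker_toTorusHom.1 g.2
    have hlk : l = k := funext fun i => hk_unique i (l i) (by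
      have := hg i
      rw [vadd_apply g l hl] at this
      simpa using this)
    exact Subtype.ext (by rw [hl, hlk])

theorem measurePreserving_toTorus :
    MeasurePreserving toTorusHom (volume.restrict unitCell) (volume : Measure Torus) := by
  have coordwise : MeasurePreserving (fun (y : Fin 3 → ℝ) (i : Fin 3) => (y i : UnitAddCircle))
      (volume.restrict (univ.pi fun _ => Ioc (0 : ℝ) (0 + 1))) volume := by
    rw [volume_pi, Measure.restrict_pi_pi]
    exact measurePreserving_pi _ _ fun _ => UnitAddCircle.measurePreserving_mk 0
  rw [unitCell_eq_preimage]
  exact coordwise.comp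
    ((EuclideanSpace.volume_preserving_symm_measurableEquiv_toLp (Fin 3)).restrict_preimage
      (MeasurableSet.univ_pi fun _ => measurableSet_Ioc))

theorem volume_inter_preimage_toTorus_le {Q : Set Vel} (hQ : MeasurableSet Q)
    (hinj : InjOn toTorus Q) {B : Set Torus} (hB : MeasurableSet B) :
    volume (Q ∩ toTorus ⁻¹' B) ≤ volume B :=
  measure_inter_preimage_le_of_injOn isAddFundamentalDomain_unitCell measurableSet_unitCell
    measurePreserving_toTorus measurable_toTorus hQ hinj hB

theorem volume_torus_le {A : Set Vel} {B : Set Torus} (hB : MeasurableSet B)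
    (h : B ⊆ toTorus '' A) : volume B ≤ volume A :=
  measure_le_of_subset_image isAddFundamentalDomain_unitCell measurePreserving_toTorus
    measurable_toTorus hB h

section Flux

variable {E : Type*} [NormedAddCommGroup E]

theorem lintegral_comp_smul_addHaar [NormedSpace ℝ E] [FiniteDimensional ℝ E]
    [MeasurableSpace E] [BorelSpace E] (μ : Measure E) [μ.IsAddHaarMeasure]
    {f : E → ENNReal} (hf : Measurable f) {c : ℝ} (hc : 0 < c) :
    ∫⁻ y, f (c • y) ∂μ = ENNReal.ofReal ((c ^ Module.finrank ℝ E)⁻¹) * ∫⁻ y, f y ∂μ := by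
  rw [← lintegral_map hf (measurable_const_smul c), Measure.map_addHaar_smul μ hc.ne',
    lintegral_smul_measure, abs_of_pos (by positivity), smul_eq_mul]

theorem lintegral_polar [NormedSpace ℝ E] [FiniteDimensional ℝ E] [Nontrivial E]
    [MeasurableSpace E] [BorelSpace E] (μ : Measure E) [μ.IsAddHaarMeasure]
    {G : E → ENNReal} (hG : Measurable G) :
    ∫⁻ x, G x ∂μ = ∫⁻ r in Ioi (0 : ℝ), ENNReal.ofReal (r ^ (Module.finrank ℝ E - 1)) *
      ∫⁻ ν, G (r • (ν : E)) ∂μ.toSphere := by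
  have hpolar := μ.measurePreserving_homeomorphUnitSphereProd.lintegral_comp_emb
    (Homeomorph.measurableEmbedding _)
    (fun p => G (((homeomorphUnitSphereProd E).symm p : ({0}ᶜ : Set E)) : E))
  simp only [Homeomorph.symm_apply_apply] at hpolar
  have hG_symm : Measurable fun p =>
      G (((homeomorphUnitSphereProd E).symm p : ({0}ᶜ : Set E)) : E) :=
    hG.comp (measurable_subtype_coe.comp (homeomorphUnitSphereProd E).symm.measurable)
  calc ∫⁻ x, G x ∂μ = ∫⁻ x in {0}ᶜ, G x ∂μ := by rw [restrict_compl_singleton]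
    _ = ∫⁻ r, (∫⁻ ν, G ((r : ℝ) • (ν : E)) ∂μ.toSphere)
          ∂Measure.volumeIoiPow (Module.finrank ℝ E - 1) := by
      rw [← lintegral_subtype_comap (measurableSet_singleton _).compl, hpolar,
        lintegral_prod_symm _ hG_symm.aemeasurable]
      simp
    _ = _ := by
      rw [Measure.volumeIoiPow, lintegral_withDensity_eq_lintegral_mul _ (by fun_prop)
        (Measurable.lintegral_prod_right' (f := fun p : Ioi (0 : ℝ) × Metric.sphere (0 : E) 1 =>
          G ((p.1 : ℝ) • (p.2 : E))) (by fun_prop))]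
      exact lintegral_subtype_comap measurableSet_Ioi (fun r : ℝ =>
        ENNReal.ofReal (r ^ (Module.finrank ℝ E - 1)) * ∫⁻ ν, G (r • (ν : E)) ∂μ.toSphere)

variable [InnerProductSpace ℝ E]

/-- The distance of `y` to the line spanned by `w`, for `w ≠ 0`. -/
noncomputable def lineDist (w y : E) : ℝ := ‖y - (inner ℝ y w / ‖w‖ ^ 2) • w‖

theorem lineDist_nonneg (w y : E) : 0 ≤ lineDist w y := norm_nonneg _

@[fun_prop]
theorem continuous_lineDist (w : E) : Continuous (lineDist w) := by
  unfold lineDist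
  fun_prop

theorem lineDist_smul (w y : E) {c : ℝ} (hc : 0 ≤ c) : lineDist w (c • y) = c * lineDist w y := by
  unfold lineDist
  rw [real_inner_smul_left, ← norm_smul_of_nonneg hc, smul_sub, smul_smul, mul_div_assoc]

theorem inner_sub_smul {w : E} (hw : w ≠ 0) (y : E) (t : ℝ) :
    inner ℝ (y - t • w) w = (inner ℝ y w / ‖w‖ ^ 2 - t) * ‖w‖ ^ 2 := by
  have : ‖w‖ ≠ 0 := norm_ne_zero_iff.2 hw
  rw [inner_sub_left, real_inner_smul_left, real_inner_self_eq_norm_sq]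
  field_simp

theorem norm_sub_smul_sq {w : E} (hw : w ≠ 0) (y : E) (t : ℝ) :
    ‖y - t • w‖ ^ 2 = lineDist w y ^ 2 + ((inner ℝ y w / ‖w‖ ^ 2 - t) * ‖w‖) ^ 2 := by
  set τ := inner ℝ y w / ‖w‖ ^ 2 with hτ
  have orthogonal : inner ℝ (y - τ • w) ((τ - t) • w) = 0 := by
    rw [inner_smul_right, inner_sub_smul hw, ← hτ, sub_self, zero_mul, mul_zero]
  calc ‖y - t • w‖ ^ 2 = ‖(y - τ • w) + (τ - t) • w‖ ^ 2 := by congr 2; module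
    _ = lineDist w y ^ 2 + ((τ - t) * ‖w‖) ^ 2 := by
      rw [norm_add_sq_real, orthogonal, norm_smul, Real.norm_eq_abs, mul_pow, sq_abs, ← mul_pow,
        mul_zero, add_zero, lineDist]

theorem lineDist_le_norm_sub_smul {w : E} (hw : w ≠ 0) (y : E) (t : ℝ) :
    lineDist w y ≤ ‖y - t • w‖ :=
  le_of_sq_le_sq (norm_sub_smul_sq hw y t ▸ le_add_of_nonneg_right (sq_nonneg _)) (norm_nonneg _)

theorem image_norm_sub_smul {w : E} (hw : w ≠ 0) (y : E) :
    (fun t : ℝ => ‖y - t • w‖) '' Iio (inner ℝ y w / ‖w‖ ^ 2) = Ioi (lineDist w y) := by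
  have hwp : 0 < ‖w‖ := norm_pos_iff.2 hw
  have hd := lineDist_nonneg w y
  ext r
  constructor
  · rintro ⟨t, ht, rfl⟩
    have : 0 < (inner ℝ y w / ‖w‖ ^ 2 - t) * ‖w‖ := mul_pos (sub_pos.2 ht) hwp
    refine lt_of_pow_lt_pow_left₀ 2 (norm_nonneg _) ?_
    rw [norm_sub_smul_sq hw]
    exact lt_add_of_pos_right _ (pow_pos this 2)
  · intro hr
    have hrd : 0 < r ^ 2 - lineDist w y ^ 2 := sub_pos.2 (pow_lt_pow_left₀ hr hd two_ne_zero)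
    have hs := Real.sqrt_pos.2 hrd
    refine ⟨inner ℝ y w / ‖w‖ ^ 2 - √(r ^ 2 - lineDist w y ^ 2) / ‖w‖,
      sub_lt_self _ (div_pos hs hwp), ?_⟩
    refine (pow_left_inj₀ (norm_nonneg _) (hd.trans (le_of_lt hr)) two_ne_zero).1 ?_
    rw [norm_sub_smul_sq hw, sub_sub_cancel, div_mul_cancel₀ _ hwp.ne', Real.sq_sqrt hrd.le]
    ring

theorem injOn_norm_sub_smul {w : E} (hw : w ≠ 0) (y : E) :
    InjOn (fun t : ℝ => ‖y - t • w‖) (Iio (inner ℝ y w / ‖w‖ ^ 2)) := by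
  have hwp : 0 < ‖w‖ := norm_pos_iff.2 hw
  intro t ht s hs hts
  have hsq : ((inner ℝ y w / ‖w‖ ^ 2 - t) * ‖w‖) ^ 2 = ((inner ℝ y w / ‖w‖ ^ 2 - s) * ‖w‖) ^ 2 :=
    add_left_cancel (a := lineDist w y ^ 2) (by
      rw [← norm_sub_smul_sq hw, ← norm_sub_smul_sq hw]
      exact congrArg (· ^ 2) hts)
  have := (pow_left_inj₀ (mul_pos (sub_pos.2 ht) hwp).le (mul_pos (sub_pos.2 hs) hwp).le
    two_ne_zero).1 hsq
  linarith [mul_right_cancel₀ hwp.ne' this]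

theorem hasDerivAt_norm_sub_smul {w y : E} {t : ℝ} (h : y - t • w ≠ 0) :
    HasDerivAt (fun t : ℝ => ‖y - t • w‖) (-(inner ℝ (y - t • w) w / ‖y - t • w‖)) t := by
  have hline : HasDerivAt (fun t : ℝ => y - t • w) (-w) t := by
    simpa using ((hasDerivAt_id t).smul_const w).const_sub y
  have hnorm := hline.norm_sq.sqrt (by simpa using h)
  simp only [Real.sqrt_sq (norm_nonneg _)] at hnorm
  refine hnorm.congr_deriv ?_
  rw [inner_neg_right]
  field_simp

theorem lintegral_approach {w : E} (hw : w ≠ 0) (y : E) (F : ℝ → ENNReal) :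
    ∫⁻ t : ℝ, ENNReal.ofReal (max (inner ℝ (y - t • w) w) 0 / ‖y - t • w‖) * F ‖y - t • w‖
      = ∫⁻ r in Ioi (lineDist w y), F r := by
  set τ := inner ℝ y w / ‖w‖ ^ 2
  have inner_eq (t : ℝ) : inner ℝ (y - t • w) w = (τ - t) * ‖w‖ ^ 2 := inner_sub_smul hw y t
  have hw2 : 0 < ‖w‖ ^ 2 := pow_pos (norm_pos_iff.2 hw) 2
  have ne_zero (t) (ht : t ∈ Iio τ) : y - t • w ≠ 0 := fun h => by
    have := inner_eq t
    rw [h, inner_zero_left] at this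
    exact (mul_pos (sub_pos.2 ht) hw2).ne this
  rw [← image_norm_sub_smul hw y, lintegral_image_eq_lintegral_abs_deriv_mul measurableSet_Iio
      (fun t ht => (hasDerivAt_norm_sub_smul (ne_zero t ht)).hasDerivWithinAt)
      (injOn_norm_sub_smul hw y), ← lintegral_indicator measurableSet_Iio]
  refine lintegral_congr fun t => ?_
  by_cases ht : t ∈ Iio τ
  · have : 0 ≤ inner ℝ (y - t • w) w :=
      inner_eq t ▸ mul_nonneg (sub_nonneg.2 (le_of_lt ht)) hw2.le
    rw [indicator_of_mem ht, max_eq_left this, abs_neg, abs_of_nonneg (by positivity)]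
  · have : inner ℝ (y - t • w) w ≤ 0 :=
      inner_eq t ▸ mul_nonpos_of_nonpos_of_nonneg (sub_nonpos.2 (not_lt.1 ht)) hw2.le
    rw [indicator_of_notMem ht, max_eq_right this, zero_div, ENNReal.ofReal_zero, zero_mul]

theorem mem_Icc_of_norm_lt_of_lt_norm {w ν : E} (hν : ‖ν‖ = 1) (hνw : 0 < inner ℝ ν w)
    {ε δ s t : ℝ} (hε : 0 < ε) (hs : s ∈ Icc 0 δ) (hlt : ‖t • w + ε • ν - s • w‖ < ε)
    (hgt : ε < ‖t • w + ε • ν‖) : t ∈ Icc 0 δ := by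
  have norm_sq (a : ℝ) :
      ‖a • w + ε • ν‖ ^ 2 = a * (a * ‖w‖ ^ 2 + 2 * ε * inner ℝ ν w) + ε ^ 2 := by
    rw [norm_add_sq_real, norm_smul, norm_smul, real_inner_smul_left, inner_smul_right, hν,
      real_inner_comm, mul_pow, Real.norm_eq_abs, sq_abs, mul_one, Real.norm_eq_abs, sq_abs]
    ring
  have hb : 0 < 2 * ε * inner ℝ ν w := by positivity
  rw [show t • w + ε • ν - s • w = (t - s) • w + ε • ν by module] at hlt
  have inside : (t - s) * ((t - s) * ‖w‖ ^ 2 + 2 * ε * inner ℝ ν w) < 0 := by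
    have := pow_lt_pow_left₀ hlt (norm_nonneg _) two_ne_zero
    rw [norm_sq] at this
    linarith
  have outside : 0 < t * (t * ‖w‖ ^ 2 + 2 * ε * inner ℝ ν w) := by
    have := pow_lt_pow_left₀ hgt hε.le two_ne_zero
    rw [norm_sq] at this
    linarith
  have hts : t - s < 0 := by
    by_contra! hcon
    have : 0 ≤ (t - s) * ((t - s) * ‖w‖ ^ 2 + 2 * ε * inner ℝ ν w) := by positivity
    linarith
  have hpos : 0 < t * ‖w‖ ^ 2 + 2 * ε * inner ℝ ν w := by
    have := pos_of_mul_neg_right inside hts.le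
    have := mul_nonneg hs.1 (sq_nonneg ‖w‖)
    linarith
  exact ⟨(pos_of_mul_pos_left outside hpos.le).le, by linarith [hs.2]⟩

/-- The flux of a beam of velocity `w` and density one through the unit sphere. -/
noncomputable def flux [MeasurableSpace E] (μ : Measure E) (w : E) : ENNReal :=
  ∫⁻ ν, ENNReal.ofReal (max (inner ℝ (ν : E) w) 0) ∂μ.toSphere

theorem flux_le [MeasurableSpace E] (μ : Measure E) (w : E) :
    flux μ w ≤ ENNReal.ofReal ‖w‖ * μ.toSphere univ := by
  rw [← lintegral_const]
  refine lintegral_mono fun ν => ENNReal.ofReal_le_ofReal (max_le ?_ (norm_nonneg _))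
  simpa using real_inner_le_norm (ν : E) w

variable [FiniteDimensional ℝ E] [MeasurableSpace E] [BorelSpace E] (μ : Measure E)

/-- The flux of a beam of velocity `w` and density `f` through the sphere of radius `r`, integrated
over time and divided by `r ^ (d - 1)`. -/
noncomputable def sphereFlux (w : E) (r : ℝ) (f : E → ENNReal) : ENNReal :=
  ∫⁻ ν, (∫⁻ t : ℝ, ENNReal.ofReal (max (inner ℝ (ν : E) w) 0) * f (t • w + r • (ν : E)))
    ∂μ.toSphere

theorem sphereFlux_comp_smul (w : E) {ε r : ℝ} (hε : 0 < ε) (hr : 0 < r) {f : E → ENNReal}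
    (hf : Measurable f) :
    sphereFlux μ w r (fun y => f ((ε / r) • y)) = ENNReal.ofReal (r / ε) * sphereFlux μ w ε f := by
  have hfm : Measurable fun p : Metric.sphere (0 : E) 1 × ℝ =>
      ENNReal.ofReal (max (inner ℝ (p.1 : E) w) 0) * f (p.2 • w + ε • (p.1 : E)) := by fun_prop
  rw [sphereFlux, sphereFlux, ← lintegral_const_mul _ hfm.lintegral_prod_right']
  refine lintegral_congr fun ν => ?_
  have scaled := lintegral_comp_smul_addHaar (volume : Measure ℝ)
    (f := fun t => ENNReal.ofReal (max (inner ℝ (ν : E) w) 0) * f (t • w + ε • (ν : E)))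
    (by fun_prop) (c := ε / r) (by positivity)
  rw [Module.finrank_self, pow_one, inv_div] at scaled
  simp only [← scaled]
  refine lintegral_congr fun t => ?_
  rw [smul_add, smul_smul, smul_smul, div_mul_cancel₀ _ hr.ne', smul_eq_mul]

theorem sphereFlux_const_mul (w : E) (r : ℝ) (c : ENNReal) {f : E → ENNReal}
    (hf : Measurable f) :
    sphereFlux μ w r (fun y => c * f y) = c * sphereFlux μ w r f := by
  have hfm : Measurable fun p : Metric.sphere (0 : E) 1 × ℝ =>
      ENNReal.ofReal (max (inner ℝ (p.1 : E) w) 0) * f (p.2 • w + r • (p.1 : E)) := by fun_prop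
  simp_rw [sphereFlux, mul_left_comm _ c]
  rw [← lintegral_const_mul _ hfm.lintegral_prod_right']
  exact lintegral_congr fun ν => lintegral_const_mul _ (by fun_prop)

variable [μ.IsAddHaarMeasure]

theorem lintegral_sphereFlux {w : E} (hw : w ≠ 0) {F : ℝ → E → ENNReal}
    (hF : Measurable (Function.uncurry F)) :
    ∫⁻ r in Ioi (0 : ℝ), ENNReal.ofReal (r ^ (Module.finrank ℝ E - 1)) * sphereFlux μ w r (F r)
      = ∫⁻ y, (∫⁻ r in Ioi (lineDist w y), F r y) ∂μ := by
  have : Nontrivial E := ⟨w, 0, hw⟩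
  set K : E → ℝ → ENNReal := fun x t =>
    ENNReal.ofReal (max (inner ℝ x w) 0 / ‖x‖) * F ‖x‖ (t • w + x) with hK
  have hKm : Measurable (Function.uncurry K) :=
    Measurable.mul (by fun_prop) (hF.comp (by fun_prop : Measurable fun p : E × ℝ =>
      (‖p.1‖, p.2 • w + p.1)))
  calc _ = ∫⁻ x, (∫⁻ t, K x t) ∂μ := by
        rw [lintegral_polar μ (G := fun x => ∫⁻ t, K x t) hKm.lintegral_prod_right']
        refine setLIntegral_congr_fun measurableSet_Ioi fun r (hr : 0 < r) => ?_
        have norm_smul_direction (ν : Metric.sphere (0 : E) 1) : ‖r • (ν : E)‖ = r := by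
          rw [norm_smul_of_nonneg hr.le, norm_eq_of_mem_sphere, mul_one]
        have max_inner_div (ν : E) : max (inner ℝ (r • ν) w) 0 / r = max (inner ℝ ν w) 0 := by
          rw [real_inner_smul_left, ← mul_zero r, ← mul_max_of_nonneg _ _ hr.le, mul_zero,
            mul_div_cancel_left₀ _ hr.ne']
        simp only [sphereFlux, hK, norm_smul_direction, max_inner_div]
    _ = ∫⁻ t, (∫⁻ x, K x t ∂μ) := lintegral_lintegral_swap hKm.aemeasurable
    _ = ∫⁻ t, (∫⁻ y, K (y - t • w) t ∂μ) :=
      lintegral_congr fun t => (lintegral_sub_right_eq_self (fun x => K x t) (t • w)).symm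
    _ = ∫⁻ y, (∫⁻ t, K (y - t • w) t) ∂μ :=
      lintegral_lintegral_swap (f := fun t y => K (y - t • w) t) (hKm.comp (f := fun p : ℝ × E =>
        (p.2 - p.1 • w, p.1)) (by fun_prop)).aemeasurable
    _ = _ := by
      refine lintegral_congr fun y => ?_
      simp only [hK, add_sub_cancel]
      exact lintegral_approach hw y fun r => F r y

theorem lintegral_Ioi_lineDist_comp_smul (w : E) {ε : ℝ} (hε : 0 < ε) {χ : ℝ → ENNReal}
    (hχ : Measurable χ) {f : E → ENNReal} (hf : Measurable f) :
    ∫⁻ y, (∫⁻ r in Ioi (lineDist w y), χ r * f ((ε / r) • y)) ∂μ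
      = ENNReal.ofReal (ε ^ Module.finrank ℝ E)⁻¹ * (∫⁻ y in {y | lineDist w y < ε}, f y ∂μ) *
        ∫⁻ r in Ioi (0 : ℝ), χ r * ENNReal.ofReal (r ^ Module.finrank ℝ E) := by
  set tube := {y : E | lineDist w y < ε} with htube
  have htube_meas : MeasurableSet tube :=
    measurableSet_lt (continuous_lineDist w).measurable measurable_const
  have mem_tube_iff (y : E) {r : ℝ} (hr : 0 < r) : (ε / r) • y ∈ tube ↔ lineDist w y < r := by
    rw [htube, mem_ofPred_eq, lineDist_smul _ _ (by positivity), div_mul_eq_mul_div,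
      div_lt_iff₀ hr, mul_lt_mul_iff_of_pos_left hε]
  have hg : Measurable (tube.indicator f) := hf.indicator htube_meas
  calc _ = ∫⁻ y, (∫⁻ r in Ioi (0 : ℝ), χ r * tube.indicator f ((ε / r) • y)) ∂μ := by
        refine lintegral_congr fun y => ?_
        rw [← lintegral_indicator measurableSet_Ioi, ← lintegral_indicator measurableSet_Ioi]
        refine lintegral_congr fun r => ?_
        rcases lt_or_ge 0 r with hr | hr
        · by_cases hy : lineDist w y < r <;> simp [indicator, hr, hy, mem_tube_iff y hr]
        · simp [indicator, hr.not_gt, (hr.trans (lineDist_nonneg w y)).not_gt]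
    _ = ∫⁻ r in Ioi (0 : ℝ), (∫⁻ y, χ r * tube.indicator f ((ε / r) • y) ∂μ) :=
      lintegral_lintegral_swap (Measurable.aemeasurable (by fun_prop))
    _ = ∫⁻ r in Ioi (0 : ℝ), ENNReal.ofReal (ε ^ Module.finrank ℝ E)⁻¹ *
          (∫⁻ y in tube, f y ∂μ) * (χ r * ENNReal.ofReal (r ^ Module.finrank ℝ E)) := by
      refine setLIntegral_congr_fun measurableSet_Ioi fun r (hr : 0 < r) => ?_
      rw [lintegral_const_mul _ (by fun_prop), lintegral_comp_smul_addHaar _ hg (by positivity),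
        lintegral_indicator htube_meas, div_pow, inv_div, div_eq_inv_mul,
        ENNReal.ofReal_mul (by positivity)]
      ring
    _ = _ := lintegral_const_mul _ (by fun_prop)

theorem exists_lintegral_Ioi_mul_pow_eq_one (n : ℕ) : ∃ χ : ℝ → ENNReal, Measurable χ ∧
    ∫⁻ r in Ioi (0 : ℝ), χ r * ENNReal.ofReal (r ^ n) = 1 := by
  refine ⟨(Ioo (0 : ℝ) 1).indicator fun r => (ENNReal.ofReal (r ^ n))⁻¹,
    Measurable.indicator (by fun_prop) measurableSet_Ioo, ?_⟩
  calc _ = ∫⁻ r in Ioi (0 : ℝ), (Ioo (0 : ℝ) 1).indicator 1 r := by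
        refine setLIntegral_congr_fun measurableSet_Ioi fun r (hr : 0 < r) => ?_
        by_cases hr1 : r ∈ Ioo (0 : ℝ) 1
        · simp only [indicator_of_mem hr1, Pi.one_apply]
          exact ENNReal.inv_mul_cancel (by simpa using pow_pos hr _) ENNReal.ofReal_ne_top
        · simp only [indicator_of_notMem hr1, zero_mul]
    _ = 1 := by
        rw [lintegral_indicator_one measurableSet_Ioo, Measure.restrict_apply measurableSet_Ioo,
          inter_eq_left.2 Ioo_subset_Ioi_self, Real.volume_Ioo]
        simp

theorem lintegral_flux {w : E} (hw : w ≠ 0) {ε : ℝ} (hε : 0 < ε) {f : E → ENNReal}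
    (hf : Measurable f) :
    ENNReal.ofReal (ε ^ (Module.finrank ℝ E - 1)) * sphereFlux μ w ε f
      = ∫⁻ y in {y | lineDist w y < ε}, f y ∂μ := by
  have : Nontrivial E := ⟨w, 0, hw⟩
  obtain ⟨k, hk⟩ : ∃ k, Module.finrank ℝ E = k + 1 :=
    Nat.exists_eq_succ_of_ne_zero Module.finrank_pos.ne'
  -- By scaling, all radii contribute equally to the averaged identity below.
  obtain ⟨χ, hχ, weight_eq_one⟩ := exists_lintegral_Ioi_mul_pow_eq_one (k + 1)
  have averaged := lintegral_sphereFlux μ hw (F := fun r y => χ r * f ((ε / r) • y))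
    (by simp only [Function.uncurry_def]; fun_prop)
  have flux_at_radius {r : ℝ} (hr : 0 < r) : ENNReal.ofReal (r ^ k) *
      sphereFlux μ w r (fun y => χ r * f ((ε / r) • y)) =
      ENNReal.ofReal ε⁻¹ * sphereFlux μ w ε f * (χ r * ENNReal.ofReal (r ^ (k + 1))) := by
    rw [sphereFlux_const_mul μ w r _ (by fun_prop), sphereFlux_comp_smul μ w hε hr hf, pow_succ,
      ENNReal.ofReal_mul (by positivity), div_eq_mul_inv, ENNReal.ofReal_mul hr.le]
    ring
  rw [lintegral_Ioi_lineDist_comp_smul μ w hε hχ hf, hk, weight_eq_one, mul_one, Nat.add_sub_cancel,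
    setLIntegral_congr_fun measurableSet_Ioi fun r hr => flux_at_radius hr,
    lintegral_const_mul _ (by fun_prop), weight_eq_one, mul_one] at averaged
  calc _ = ENNReal.ofReal (ε ^ (k + 1)) * (ENNReal.ofReal ε⁻¹ * sphereFlux μ w ε f) := by
        rw [hk, Nat.add_sub_cancel, ← mul_assoc, ← ENNReal.ofReal_mul (by positivity), pow_succ,
          mul_inv_cancel_right₀ hε.ne']
    _ = _ := by
        rw [averaged, ← mul_assoc, ← ENNReal.ofReal_mul (by positivity),
          mul_inv_cancel₀ (by positivity), ENNReal.ofReal_one, one_mul]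

theorem flux_ne_top (w : E) : flux μ w ≠ ⊤ :=
  ne_top_of_le_ne_top (ENNReal.mul_ne_top ENNReal.ofReal_ne_top (measure_ne_top _ _)) (flux_le μ w)

theorem volume_tube_diff_le {w : E} (hw : w ≠ 0) {ε δ : ℝ} (hε : 0 < ε) :
    μ ({y : E | ∃ s ∈ Icc 0 δ, ‖y - s • w‖ < ε} \ Metric.closedBall 0 ε)
      ≤ ENNReal.ofReal (ε ^ (Module.finrank ℝ E - 1)) * (ENNReal.ofReal δ * flux μ w) := by
  set A := {y : E | ∃ s ∈ Icc 0 δ, ‖y - s • w‖ < ε} \ Metric.closedBall 0 ε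
  have hA_meas : MeasurableSet A := by
    refine (IsOpen.measurableSet ?_).diff measurableSet_closedBall
    simp only [ofPred_exists, ofPred_and]
    exact isOpen_iUnion fun s => isOpen_const.inter (isOpen_lt (by fun_prop) continuous_const)
  have hA_lineDist : A ⊆ {y | lineDist w y < ε} := by
    rintro y ⟨⟨s, -, hs⟩, -⟩
    exact (lineDist_le_norm_sub_smul hw y s).trans_lt hs
  have integrand_le (ν : Metric.sphere (0 : E) 1) (t : ℝ) :
      ENNReal.ofReal (max (inner ℝ (ν : E) w) 0) * A.indicator 1 (t • w + ε • (ν : E))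
        ≤ (Icc 0 δ).indicator (fun _ => ENNReal.ofReal (max (inner ℝ (ν : E) w) 0)) t := by
    rcases le_or_gt (inner ℝ (ν : E) w) 0 with hν | hν
    · simp [max_eq_right hν]
    by_cases hmem : t • w + ε • (ν : E) ∈ A
    · obtain ⟨⟨s, hs, hlt⟩, hnot⟩ := hmem
      rw [indicator_of_mem (mem_Icc_of_norm_lt_of_lt_norm (norm_eq_of_mem_sphere ν) hν hε hs hlt
        (by simpa using hnot))]
      exact mul_le_of_le_one_right' (indicator_le_self' (fun _ _ => zero_le) _)
    · simp [indicator_of_notMem hmem]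
  calc μ A = ∫⁻ y in {y | lineDist w y < ε}, A.indicator 1 y ∂μ := by
        rw [lintegral_indicator_one hA_meas, Measure.restrict_apply hA_meas,
          inter_eq_left.2 hA_lineDist]
    _ = ENNReal.ofReal (ε ^ (Module.finrank ℝ E - 1)) * sphereFlux μ w ε (A.indicator 1) :=
      (lintegral_flux μ hw hε (measurable_one.indicator hA_meas)).symm
    _ ≤ ENNReal.ofReal (ε ^ (Module.finrank ℝ E - 1)) * (ENNReal.ofReal δ * flux μ w) := by
      gcongr
      rw [flux, ← lintegral_const_mul _ (by fun_prop)]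
      refine lintegral_mono fun ν => (lintegral_mono (integrand_le ν)).trans_eq ?_
      rw [lintegral_indicator measurableSet_Icc, setLIntegral_const, Real.volume_Icc, sub_zero,
        mul_comm]

theorem volume_swept_le (w : E) {ε δ : ℝ} (hε : 0 < ε) :
    μ {y : E | ∃ s ∈ Icc 0 δ, ‖y - s • w‖ ≤ ε ∧ ε < ‖y‖}
      ≤ ENNReal.ofReal (ε ^ (Module.finrank ℝ E - 1)) * (ENNReal.ofReal δ * flux μ w) := by
  set S := {y : E | ∃ s ∈ Icc 0 δ, ‖y - s • w‖ ≤ ε ∧ ε < ‖y‖} with hS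
  rcases eq_or_ne w 0 with rfl | hw
  · have : S = ∅ := by
      refine eq_empty_of_forall_notMem fun y ⟨s, _, hle, hlt⟩ => hlt.not_ge ?_
      simpa using hle
    simp [this]
  obtain ⟨r, hr_anti, hr_gt, hr_tendsto⟩ := exists_seq_strictAnti_tendsto ε
  have S_eq : S = ⋃ n, S \ Metric.closedBall 0 (r n) := by
    refine (iUnion_subset fun n => sdiff_subset).antisymm' fun y hy => ?_
    obtain ⟨n, hn⟩ := (hr_tendsto.eventually_lt_const hy.choose_spec.2.2).exists
    exact mem_iUnion.2 ⟨n, hy, by simpa using hn⟩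
  have S_lim : Tendsto (fun n => μ (S \ Metric.closedBall 0 (r n))) atTop (𝓝 (μ S)) := by
    conv => enter [3]; rw [S_eq]
    exact tendsto_measure_iUnion_atTop fun m n hmn =>
      sdiff_subset_sdiff_right (Metric.closedBall_subset_closedBall (hr_anti.antitone hmn))
  have bound_lim : Tendsto (fun n => ENNReal.ofReal (r n ^ (Module.finrank ℝ E - 1)) *
      (ENNReal.ofReal δ * flux μ w)) atTop (𝓝 (ENNReal.ofReal (ε ^ (Module.finrank ℝ E - 1)) *
        (ENNReal.ofReal δ * flux μ w))) :=
    ENNReal.Tendsto.mul_const (ENNReal.tendsto_ofReal (hr_tendsto.pow _))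
      (Or.inr (ENNReal.mul_ne_top ENNReal.ofReal_ne_top (flux_ne_top μ w)))
  refine le_of_tendsto_of_tendsto' S_lim bound_lim fun n => ?_
  refine (measure_mono ?_).trans (volume_tube_diff_le μ hw (hε.trans (hr_gt n)))
  exact sdiff_subset_sdiff_left fun y ⟨s, hs, hle, _⟩ => ⟨s, hs, hle.trans_lt (hr_gt n)⟩

end Flux

instance : IsFiniteMeasure sphereMeasure :=
  inferInstanceAs (IsFiniteMeasure (volume : Measure Vel).toSphere)

theorem finrank_vel_sub_one : Module.finrank ℝ Vel - 1 = 2 := by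
  rw [finrank_euclideanSpace_fin]

theorem map_toTorus_restrict_le {Q : Set Vel} (hQ : MeasurableSet Q) (hinj : InjOn toTorus Q) :
    Measure.map toTorus (volume.restrict Q) ≤ volume := by
  refine Measure.le_iff.2 fun B hB => ?_
  rw [Measure.map_apply measurable_toTorus hB, Measure.restrict_apply (measurable_toTorus hB),
    inter_comm]
  exact volume_inter_preimage_toTorus_le hQ hinj hB

theorem lintegral_collision_le_lintegral_image {w : Vel} (hw : w ≠ 0) {ε : ℝ} (hε : 0 < ε)
    {R : Set (ℝ × Direction)} (hR : MeasurableSet R)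
    (hinj : InjOn (fun p : ℝ × Direction => p.1 • w + ε • (p.2 : Vel)) R)
    {f : Vel → ENNReal} (hf : Measurable f) :
    ∫⁻ p in R, ENNReal.ofReal (ε ^ 2 * max (inner ℝ (p.2 : Vel) w) 0) *
        f (p.1 • w + ε • (p.2 : Vel)) ∂((volume : Measure ℝ).prod sphereMeasure)
      ≤ ∫⁻ y in (fun p : ℝ × Direction => p.1 • w + ε • (p.2 : Vel)) '' R, f y := by
  set φ : ℝ × Direction → Vel := fun p => p.1 • w + ε • (p.2 : Vel)
  have hφ : Measurable φ := by fun_prop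
  have hQ : MeasurableSet (φ '' R) := hR.image_of_measurable_injOn hφ hinj
  set h := (φ '' R).indicator f with hh
  have hh_meas : Measurable h := hf.indicator hQ
  calc _ ≤ ∫⁻ p : ℝ × Direction, ENNReal.ofReal (ε ^ 2) *
            (ENNReal.ofReal (max (inner ℝ (p.2 : Vel) w) 0) * h (φ p))
            ∂((volume : Measure ℝ).prod sphereMeasure) := by
        rw [← lintegral_indicator hR]
        refine lintegral_mono fun p => ?_
        by_cases hp : p ∈ R
        · rw [indicator_of_mem hp, hh, indicator_of_mem (mem_image_of_mem φ hp),
            ENNReal.ofReal_mul (by positivity), mul_assoc]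
        · rw [indicator_of_notMem hp]
          exact zero_le
    _ = ENNReal.ofReal (ε ^ 2) * sphereFlux volume w ε h := by
        rw [lintegral_const_mul _ (by fun_prop),
          lintegral_prod_symm _ (Measurable.aemeasurable (by fun_prop))]
        rfl
    _ = ∫⁻ y in {y | lineDist w y < ε}, h y := by
        rw [← lintegral_flux volume hw hε hh_meas, finrank_vel_sub_one]
    _ ≤ ∫⁻ y, h y := setLIntegral_le_lintegral _ _
    _ = ∫⁻ y in φ '' R, f y := lintegral_indicator hQ _

theorem lintegral_collision_le {w : Vel} {ε : ℝ} (hε : 0 < ε) (a : Torus)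
    {R : Set (ℝ × Direction)} (hR : MeasurableSet R)
    (hinj : InjOn (fun p : ℝ × Direction => a + toTorus (p.1 • w + ε • (p.2 : Vel))) R)
    (hpos : ∀ p ∈ R, 0 < inner ℝ (p.2 : Vel) w) {q : Torus → ENNReal} (hq : Measurable q) :
    ∫⁻ p in R, ENNReal.ofReal (ε ^ 2 * max (inner ℝ (p.2 : Vel) w) 0) *
        q (a + toTorus (p.1 • w + ε • (p.2 : Vel))) ∂((volume : Measure ℝ).prod sphereMeasure)
      ≤ ∫⁻ x, q x := by
  rcases R.eq_empty_or_nonempty with rfl | ⟨p₀, hp₀⟩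
  · simp
  have hw : w ≠ 0 := by
    rintro rfl
    simpa using hpos p₀ hp₀
  set φ : ℝ × Direction → Vel := fun p => p.1 • w + ε • (p.2 : Vel)
  have hφ_inj : InjOn φ R := InjOn.of_comp (g := fun y => a + toTorus y) hinj
  have hQ : MeasurableSet (φ '' R) := hR.image_of_measurable_injOn (by fun_prop) hφ_inj
  have toTorus_inj : InjOn toTorus (φ '' R) :=
    InjOn.of_comp (g := fun x => a + x)
      (InjOn.image_of_comp (f := φ) (g := fun y => a + toTorus y) hinj)
  calc _ ≤ ∫⁻ y in φ '' R, q (a + toTorus y) :=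
        lintegral_collision_le_lintegral_image hw hε hR hφ_inj
          (f := fun y => q (a + toTorus y)) (hq.comp (measurable_toTorus.const_add a))
    _ = ∫⁻ x, q (a + x) ∂(Measure.map toTorus (volume.restrict (φ '' R))) :=
        (lintegral_map (hq.comp (measurable_const_add a)) measurable_toTorus).symm
    _ ≤ ∫⁻ x, q (a + x) := lintegral_mono' (map_toTorus_restrict_le hQ toTorus_inj) le_rfl
    _ = ∫⁻ x, q x := lintegral_add_left_eq_self _ a

/-- The tree with initial data `r` and markers `c`. -/
abbrev treeOf {n : ℕ} (r : Torus × Vel) (c : Fin n → Marker) : CollisionTree := ⟨n, (r, c)⟩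

/-- Two trees have the same initial data and the same first `k` markers. -/
structure AgreeUpTo (k : ℕ) (Φ Ψ : CollisionTree) : Prop where
  root : Φ.2.1 = Ψ.2.1
  le_left : k ≤ numColl Φ
  le_right : k ≤ numColl Ψ
  marker : ∀ i (h : i < numColl Φ) (h' : i < numColl Ψ), i < k → Φ.2.2 ⟨i, h⟩ = Ψ.2.2 ⟨i, h'⟩

theorem AgreeUpTo.symm {k : ℕ} {Φ Ψ : CollisionTree} (h : AgreeUpTo k Φ Ψ) : AgreeUpTo k Ψ Φ :=
  ⟨h.root.symm, h.le_right, h.le_left, fun i hΨ hΦ hik => (h.marker i hΦ hΨ hik).symm⟩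

theorem agreeUpTo_init {n : ℕ} (r : Torus × Vel) (c : Fin (n + 1) → Marker) :
    AgreeUpTo n (treeOf r c) (treeOf r (Fin.init c)) :=
  ⟨rfl, Nat.le_succ n, le_rfl, fun _ _ _ _ => rfl⟩

theorem velAfter_succ {Φ : CollisionTree} {k : ℕ} (h : k < numColl Φ) :
    velAfter Φ (k + 1) = collide (collDir Φ ⟨k, h⟩) (collVel Φ ⟨k, h⟩) (velAfter Φ k) := by
  rw [velAfter, dif_pos h]

theorem AgreeUpTo.velAfter_eq {k : ℕ} {Φ Ψ : CollisionTree} (h : AgreeUpTo k Φ Ψ) :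
    ∀ i ≤ k, velAfter Φ i = velAfter Ψ i
  | 0, _ => by rw [velAfter, velAfter, rootVel, rootVel, h.root]
  | i + 1, hi => by
    have hΦ : i < numColl Φ := hi.trans h.le_left
    have hΨ : i < numColl Ψ := hi.trans h.le_right
    rw [velAfter_succ hΦ, velAfter_succ hΨ, h.velAfter_eq i (by lia), collDir, collVel,
      h.marker i hΦ hΨ hi]
    rfl

/-- The `i`-th collision time, with the junk value `0` where there is no `i`-th collision. -/
noncomputable def timeN (Φ : CollisionTree) (i : ℕ) : ℝ :=
  if h : i < numColl Φ then collTime Φ ⟨i, h⟩ else 0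

theorem AgreeUpTo.timeN_eq {k : ℕ} {Φ Ψ : CollisionTree} (h : AgreeUpTo k Φ Ψ) {i : ℕ}
    (hi : i < k) : timeN Φ i = timeN Ψ i := by
  rw [timeN, timeN, dif_pos (hi.trans_le h.le_left), dif_pos (hi.trans_le h.le_right), collTime,
    h.marker i _ _ hi]
  rfl

theorem pos_eq_sum_range (Φ : CollisionTree) (s : ℝ) :
    pos Φ s = rootPos Φ + toTorus (s • rootVel Φ + ∑ i ∈ Finset.range (numColl Φ),
      max (s - timeN Φ i) 0 • (velAfter Φ (i + 1) - velAfter Φ i)) := by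
  rw [pos, ← Fin.sum_univ_eq_sum_range
    (fun i => max (s - timeN Φ i) 0 • (velAfter Φ (i + 1) - velAfter Φ i))]
  simp [timeN]

theorem pos_eq_sum_range_of_le {Φ : CollisionTree} {k : ℕ} (hk : k ≤ numColl Φ) {s : ℝ}
    (hs : ∀ j : Fin (numColl Φ), k ≤ j → s ≤ collTime Φ j) :
    pos Φ s = rootPos Φ + toTorus (s • rootVel Φ + ∑ i ∈ Finset.range k,
      max (s - timeN Φ i) 0 • (velAfter Φ (i + 1) - velAfter Φ i)) := by
  rw [pos_eq_sum_range]
  congr 3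
  refine (Finset.sum_subset (Finset.range_mono hk) fun i hi hik => ?_).symm
  have hi' : i < numColl Φ := Finset.mem_range.1 hi
  have hs_le := hs ⟨i, hi'⟩ (by simpa using hik)
  rw [timeN, dif_pos hi', max_eq_right (sub_nonpos.2 hs_le), zero_smul]

theorem AgreeUpTo.pos_eq {k : ℕ} {Φ Ψ : CollisionTree} (h : AgreeUpTo k Φ Ψ) {s : ℝ}
    (hΦ : ∀ j : Fin (numColl Φ), k ≤ j → s ≤ collTime Φ j)
    (hΨ : ∀ j : Fin (numColl Ψ), k ≤ j → s ≤ collTime Ψ j) : pos Φ s = pos Ψ s := by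
  rw [pos_eq_sum_range_of_le h.le_left hΦ, pos_eq_sum_range_of_le h.le_right hΨ, rootPos, rootPos,
    rootVel, rootVel, h.root]
  congr 3
  refine Finset.sum_congr rfl fun i hi => ?_
  have hi : i < k := Finset.mem_range.1 hi
  rw [h.velAfter_eq (i + 1) hi, h.velAfter_eq i hi.le, h.timeN_eq hi]

theorem pos_init {n : ℕ} (r : Torus × Vel) (c : Fin (n + 1) → Marker) {s : ℝ}
    (hs : s ≤ (c (Fin.last n)).1) : pos (treeOf r c) s = pos (treeOf r (Fin.init c)) s := by
  refine (agreeUpTo_init r c).pos_eq (fun j hj => ?_) (fun j hj => absurd j.2 (not_lt.2 hj))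
  obtain rfl : j = Fin.last n := Fin.ext (le_antisymm (Fin.is_le j) hj)
  exact hs

theorem pos_zero (Φ : CollisionTree) (h : ∀ j, 0 < collTime Φ j) : pos Φ 0 = rootPos Φ := by
  rw [pos_eq_sum_range_of_le (k := 0) (Nat.zero_le _) fun j _ => (h j).le]
  simp [toTorus_zero]

/-- The position at time `0` obtained by extending the last free flight of the tree backwards. -/
noncomputable def flightBase (Φ : CollisionTree) : Torus :=
  rootPos Φ - toTorus (∑ j : Fin (numColl Φ),
    collTime Φ j • (velAfter Φ ((j : ℕ) + 1) - velAfter Φ (j : ℕ)))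

theorem pos_eq_flightBase {Φ : CollisionTree} {s : ℝ} (h : ∀ j, collTime Φ j ≤ s) :
    pos Φ s = flightBase Φ + toTorus (s • velAfter Φ (numColl Φ)) := by
  have elapsed (j : Fin (numColl Φ)) : max (s - collTime Φ j) 0 = s - collTime Φ j :=
    max_eq_left (sub_nonneg.2 (h j))
  have sum_jumps : ∑ j : Fin (numColl Φ), (velAfter Φ ((j : ℕ) + 1) - velAfter Φ (j : ℕ))
      = velAfter Φ (numColl Φ) - rootVel Φ := by
    rw [Fin.sum_univ_eq_sum_range (fun i => velAfter Φ (i + 1) - velAfter Φ i),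
      Finset.sum_range_sub]
    rfl
  simp_rw [pos, flightBase, elapsed, sub_smul]
  rw [Finset.sum_sub_distrib, ← Finset.smul_sum, sum_jumps, sub_add_eq_add_sub, add_sub_assoc,
    ← toTorus_sub]
  congr 2
  module

theorem continuous_collide : Continuous fun p : Vel × Vel × Vel => collide p.1 p.2.1 p.2.2 := by
  unfold collide
  fun_prop

section Continuity

variable {X : Type*} [TopologicalSpace X] {n : ℕ} {Φ : X → (Torus × Vel) × (Fin n → Marker)}

theorem continuous_collTime (hΦ : Continuous Φ) (j : Fin n) :
    Continuous fun x => collTime ⟨n, Φ x⟩ j := by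
  change Continuous fun x => ((Φ x).2 j).1
  fun_prop

theorem continuous_collDir (hΦ : Continuous Φ) (j : Fin n) :
    Continuous fun x => collDir ⟨n, Φ x⟩ j := by
  change Continuous fun x => (((Φ x).2 j).2.1 : Vel)
  fun_prop

theorem continuous_collVel (hΦ : Continuous Φ) (j : Fin n) :
    Continuous fun x => collVel ⟨n, Φ x⟩ j := by
  change Continuous fun x => ((Φ x).2 j).2.2
  fun_prop

theorem continuous_velAfter (hΦ : Continuous Φ) (k : ℕ) :
    Continuous fun x => velAfter ⟨n, Φ x⟩ k := by
  induction k with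
  | zero => exact hΦ.fst.snd
  | succ k ih =>
    by_cases hk : k < n
    · simp only [velAfter, dif_pos hk]
      have hν := continuous_collDir hΦ ⟨k, hk⟩
      have hu := continuous_collVel hΦ ⟨k, hk⟩
      have hcollide := continuous_collide.comp (hν.prodMk (hu.prodMk ih))
      exact hcollide
    · simpa only [velAfter, dif_neg hk] using ih

theorem continuous_pos (hΦ : Continuous Φ) {s : X → ℝ} (hs : Continuous s) :
    Continuous fun x => pos ⟨n, Φ x⟩ (s x) := by
  have term_cont (j : Fin n) : Continuous fun x => max (s x - collTime ⟨n, Φ x⟩ j) 0 •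
      (velAfter ⟨n, Φ x⟩ (j + 1) - velAfter ⟨n, Φ x⟩ j) :=
    ((hs.sub (continuous_collTime hΦ j)).max continuous_const).smul
      ((continuous_velAfter hΦ _).sub (continuous_velAfter hΦ _))
  have displacement_cont :=
    (hs.smul hΦ.fst.snd).add (continuous_finsetSum Finset.univ fun j _ => term_cont j)
  exact hΦ.fst.fst.add (continuous_toTorus.comp displacement_cont)

theorem continuous_partnerStart (hΦ : Continuous Φ) (ε : ℝ) (j : Fin n) :
    Continuous fun x => partnerStart ε ⟨n, Φ x⟩ j :=
  have ht := continuous_collTime hΦ j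
  (continuous_pos hΦ ht).add <| continuous_toTorus.comp <|
    ((continuous_collDir hΦ j).const_smul ε).sub (ht.smul (continuous_collVel hΦ j))

theorem continuous_partnerPos (hΦ : Continuous Φ) {s : X → ℝ} (hs : Continuous s) (ε : ℝ)
    (j : Fin n) : Continuous fun x => partnerPos ε ⟨n, Φ x⟩ j (s x) :=
  (continuous_partnerStart hΦ ε j).add <|
    continuous_toTorus.comp <| hs.smul (continuous_collVel hΦ j)

theorem continuous_torusDist_partnerPos (hΦ : Continuous Φ) {s : X → ℝ} (hs : Continuous s)
    (ε : ℝ) (j : Fin n) :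
    Continuous fun x => torusDist (pos ⟨n, Φ x⟩ (s x)) (partnerPos ε ⟨n, Φ x⟩ j (s x)) :=
  continuous_torusDist (continuous_pos hΦ hs) (continuous_partnerPos hΦ hs ε j)

end Continuity

theorem velBefore_collTime {Φ : CollisionTree} (h : StrictMono (collTime Φ))
    (j : Fin (numColl Φ)) : velBefore Φ (collTime Φ j) = velAfter Φ j := by
  simp only [velBefore, h.lt_iff_lt, Finset.filter_gt_eq_Iio, Fin.card_Iio]

theorem vel_collTime {Φ : CollisionTree} (h : StrictMono (collTime Φ))
    (j : Fin (numColl Φ)) : vel Φ (collTime Φ j) = velAfter Φ (j + 1) := by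
  simp only [vel, h.le_iff_le, Finset.filter_ge_eq_Iic, Fin.card_Iic]

theorem torusDist_add_toTorus_smul_le {ε : ℝ} (hε : 0 ≤ ε) (x : Torus) (ν : Direction) :
    torusDist x (x + toTorus (ε • (ν : Vel))) ≤ ε := by
  have separation : x - (x + toTorus (ε • (ν : Vel))) = toTorus (-(ε • (ν : Vel))) := by
    rw [toTorus_neg]
    abel
  refine (torusDist_le_norm separation).trans_eq ?_
  rw [norm_neg, norm_smul_of_nonneg hε, norm_eq_of_mem_sphere, mul_one]

theorem partnerPos_collTime (ε : ℝ) (Φ : CollisionTree) (j : Fin (numColl Φ)) :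
    partnerPos ε Φ j (collTime Φ j) = pos Φ (collTime Φ j) + toTorus (ε • collDir Φ j) := by
  rw [partnerPos, partnerStart, toTorus_sub]
  abel

theorem torusDist_partnerPos_le {ε : ℝ} (hε : 0 ≤ ε) (Φ : CollisionTree) (j : Fin (numColl Φ)) :
    torusDist (pos Φ (collTime Φ j)) (partnerPos ε Φ j (collTime Φ j)) ≤ ε := by
  rw [partnerPos_collTime]
  exact torusDist_add_toTorus_smul_le hε _ (Φ.2.2 j).2.1

/-- `Φ` is the history of collisions, and `p` lists the particles with which they take place. -/
structure IsHistoryVia {N : ℕ} (ε t : ℝ) (z : Config N) (Φ : CollisionTree)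
    (p : Fin (numColl Φ) → Fin N) : Prop where
  root : Φ.2.1 = z.1
  isTree : IsTree t Φ
  noOverlap : ∀ i, ε < torusDist z.1.1 (z.2 i).1
  vel_eq : ∀ j, (z.2 (p j)).2 = collVel Φ j
  pos_eq : ∀ j, bgPos z (p j) (collTime Φ j) = pos Φ (collTime Φ j) + toTorus (ε • collDir Φ j)
  contact : ∀ s ∈ Icc 0 t, ∀ i, torusDist (pos Φ s) (bgPos z i s) ≤ ε →
    ∃ j, p j = i ∧ collTime Φ j = s

theorem isHistory_iff {N : ℕ} {ε t : ℝ} {z : Config N} {Φ : CollisionTree} :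
    IsHistory ε t z Φ ↔ ∃ p, IsHistoryVia ε t z Φ p :=
  ⟨fun ⟨root, tree, overlap, p, collision, contact⟩ =>
    ⟨p, root, tree, overlap, fun j => (collision j).1, fun j => (collision j).2, contact⟩,
  fun ⟨p, h⟩ =>
    ⟨h.root, h.isTree, h.noOverlap, p, fun j => ⟨h.vel_eq j, h.pos_eq j⟩, h.contact⟩⟩

theorem direction_eq_of_toTorus_smul_eq {ε : ℝ} (hε : 0 < ε) (hε2 : ε < 1 / 2) {ν ν' : Direction}
    (h : toTorus (ε • (ν : Vel)) = toTorus (ε • (ν' : Vel))) : ν = ν' := by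
  have mem_ball (ν : Direction) : ε • (ν : Vel) ∈ Metric.closedBall 0 ε := by
    simp [norm_smul, abs_of_pos hε]
  exact Subtype.ext (smul_right_injective _ hε.ne'
    (toTorus_injOn_closedBall hε2 (mem_ball ν) (mem_ball ν') h))

theorem AgreeUpTo.succ {k : ℕ} {Φ Ψ : CollisionTree} (h : AgreeUpTo k Φ Ψ) (hΦ : k < numColl Φ)
    (hΨ : k < numColl Ψ) (hk : Φ.2.2 ⟨k, hΦ⟩ = Ψ.2.2 ⟨k, hΨ⟩) : AgreeUpTo (k + 1) Φ Ψ := by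
  refine ⟨h.root, hΦ, hΨ, fun i hi hi' hik => ?_⟩
  rcases Nat.lt_succ_iff_lt_or_eq.1 hik with hlt | rfl
  · exact h.marker i hi hi' hlt
  · exact hk

theorem AgreeUpTo.eq {Φ Ψ : CollisionTree} (h : AgreeUpTo (numColl Φ) Φ Ψ)
    (h' : AgreeUpTo (numColl Ψ) Ψ Φ) : Φ = Ψ := by
  obtain ⟨n, r, c⟩ := Φ
  obtain ⟨m, r', c'⟩ := Ψ
  obtain rfl : n = m := le_antisymm h.le_right h'.le_right
  obtain rfl : r = r' := h.root
  rw [show c = c' from funext fun i => h.marker i i.2 i.2 i.2]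

namespace IsHistoryVia

variable {N : ℕ} {ε t : ℝ} {z : Config N} {Φ Ψ : CollisionTree}
  {p : Fin (numColl Φ) → Fin N} {q : Fin (numColl Ψ) → Fin N}

theorem collTime_mem_Icc (h : IsHistoryVia ε t z Φ p) (j : Fin (numColl Φ)) :
    collTime Φ j ∈ Icc 0 t :=
  ⟨(h.isTree.1 j).1.le, (h.isTree.1 j).2⟩

theorem torusDist_bgPos_le (hε : 0 ≤ ε) (h : IsHistoryVia ε t z Φ p) (j : Fin (numColl Φ)) :
    torusDist (pos Φ (collTime Φ j)) (bgPos z (p j) (collTime Φ j)) ≤ ε := by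
  rw [h.pos_eq j]
  exact torusDist_add_toTorus_smul_le hε _ (Φ.2.2 j).2.1

theorem labels_unique (hε : 0 ≤ ε) {p' : Fin (numColl Φ) → Fin N} (h : IsHistoryVia ε t z Φ p)
    (h' : IsHistoryVia ε t z Φ p') : p = p' := by
  funext j
  obtain ⟨j', label_eq, time_eq⟩ :=
    h'.contact (collTime Φ j) (h.collTime_mem_Icc j) (p j) (h.torusDist_bgPos_le hε j)
  rw [← label_eq, h.isTree.2.injective time_eq]

theorem exists_simultaneous_collision (hε : 0 ≤ ε) (h : IsHistoryVia ε t z Φ p)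
    (h' : IsHistoryVia ε t z Ψ q) {k : ℕ} (ha : AgreeUpTo k Φ Ψ) (hk : k < numColl Φ)
    (hpos : pos Φ (collTime Φ ⟨k, hk⟩) = pos Ψ (collTime Φ ⟨k, hk⟩)) :
    ∃ j : Fin (numColl Ψ), k ≤ j ∧ q j = p ⟨k, hk⟩ ∧ collTime Ψ j = collTime Φ ⟨k, hk⟩ := by
  obtain ⟨j, label_eq, time_eq⟩ := h'.contact _ (h.collTime_mem_Icc ⟨k, hk⟩) (p ⟨k, hk⟩)
    (hpos ▸ h.torusDist_bgPos_le hε ⟨k, hk⟩)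
  refine ⟨j, not_lt.1 fun hjk => ?_, label_eq, time_eq⟩
  have time_agree : collTime Φ ⟨j, hjk.trans hk⟩ = collTime Ψ j :=
    congrArg Prod.fst (ha.marker j (hjk.trans hk) j.2 hjk)
  have time_lt : collTime Φ ⟨j, hjk.trans hk⟩ < collTime Φ ⟨k, hk⟩ :=
    h.isTree.2 (Fin.mk_lt_mk.2 hjk)
  exact time_lt.ne (time_agree.trans time_eq)

theorem marker_eq (hε : 0 < ε) (hε2 : ε < 1 / 2) (h : IsHistoryVia ε t z Φ p)
    (h' : IsHistoryVia ε t z Ψ q) {i : Fin (numColl Φ)} {j : Fin (numColl Ψ)}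
    (label_eq : q j = p i) (time_eq : collTime Ψ j = collTime Φ i)
    (hpos : pos Φ (collTime Φ i) = pos Ψ (collTime Φ i)) : Φ.2.2 i = Ψ.2.2 j := by
  have dir_eq : toTorus (ε • collDir Φ i) = toTorus (ε • collDir Ψ j) := by
    have contact_point := h'.pos_eq j
    rw [label_eq, time_eq, ← hpos, h.pos_eq i] at contact_point
    exact add_left_cancel contact_point
  have vel_eq : collVel Φ i = collVel Ψ j := by rw [← h.vel_eq i, ← h'.vel_eq j, label_eq]
  exact Prod.ext time_eq.symm
    (Prod.ext (direction_eq_of_toTorus_smul_eq hε hε2 dir_eq) vel_eq)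

theorem agree_succ (hε : 0 < ε) (hε2 : ε < 1 / 2) (h : IsHistoryVia ε t z Φ p)
    (h' : IsHistoryVia ε t z Ψ q) {k : ℕ} (ha : AgreeUpTo k Φ Ψ) (hk : k < numColl Φ)
    (hle : ∀ hk' : k < numColl Ψ, collTime Φ ⟨k, hk⟩ ≤ collTime Ψ ⟨k, hk'⟩) :
    AgreeUpTo (k + 1) Φ Ψ := by
  have hpos : pos Φ (collTime Φ ⟨k, hk⟩) = pos Ψ (collTime Φ ⟨k, hk⟩) :=
    ha.pos_eq (fun j hj => h.isTree.2.monotone (Fin.mk_le_of_le_val hj)) fun j hj =>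
      (hle (hj.trans_lt j.2)).trans (h'.isTree.2.monotone (Fin.mk_le_of_le_val hj))
  obtain ⟨j, hkj, label_eq, time_eq⟩ := exists_simultaneous_collision hε.le h h' ha hk hpos
  have hk' : k < numColl Ψ := hkj.trans_lt j.2
  obtain rfl : j = ⟨k, hk'⟩ := h'.isTree.2.injective <| le_antisymm (time_eq.trans_le (hle hk'))
    (h'.isTree.2.monotone (Fin.mk_le_of_le_val hkj))
  exact ha.succ hk hk' (marker_eq hε hε2 h h' label_eq time_eq hpos)

theorem agree (hε : 0 < ε) (hε2 : ε < 1 / 2) (h : IsHistoryVia ε t z Φ p)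
    (h' : IsHistoryVia ε t z Ψ q) (k : ℕ) (hk : k ≤ numColl Φ) : AgreeUpTo k Φ Ψ := by
  induction k with
  | zero => exact ⟨h.root.trans h'.root.symm, Nat.zero_le _, Nat.zero_le _, fun i _ _ hi => by lia⟩
  | succ k ih =>
    have ha := ih (Nat.le_of_succ_le hk)
    by_cases hle : ∀ hk' : k < numColl Ψ, collTime Φ ⟨k, hk⟩ ≤ collTime Ψ ⟨k, hk'⟩
    · exact agree_succ hε hε2 h h' ha hk hle
    · push Not at hle
      obtain ⟨hk', hlt⟩ := hle
      exact (agree_succ hε hε2 h' h ha.symm hk' fun _ => hlt.le).symm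

theorem tree_unique (hε : 0 < ε) (hε2 : ε < 1 / 2) (h : IsHistoryVia ε t z Φ p)
    (h' : IsHistoryVia ε t z Ψ q) : Φ = Ψ :=
  (agree hε hε2 h h' _ le_rfl).eq (agree hε hε2 h' h _ le_rfl)

end IsHistoryVia

theorem isClosed_exists_mem_Icc {X : Type*} [TopologicalSpace X] {a b : ℝ} {D : Set (X × ℝ)}
    (hD : IsClosed D) : IsClosed {x | ∃ s ∈ Icc a b, (x, s) ∈ D} := by
  have preimage_closed : IsClosed ((fun p : X × Icc a b => (p.1, (p.2 : ℝ))) ⁻¹' D) :=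
    hD.preimage (by fun_prop)
  convert isClosedMap_fst_of_compactSpace (X := X) (Y := Icc a b) _ preimage_closed using 1
  ext x
  constructor
  · rintro ⟨s, hs, h⟩
    exact ⟨(x, ⟨s, hs⟩), h, rfl⟩
  · rintro ⟨⟨x', s⟩, h, rfl⟩
    exact ⟨s, s.2, h⟩

section TimeConditions

variable {X : Type*} [TopologicalSpace X] [MeasurableSpace X] [OpensMeasurableSpace X]
  {D : X × ℝ → ℝ}

theorem measurableSet_forall_pos_imp_lt (hD : Continuous D) {G : X × ℝ → ℝ} (hG : Continuous G)
    (a b ε : ℝ) : MeasurableSet {x | ∀ s ∈ Icc a b, 0 < G (x, s) → ε < D (x, s)} := by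
  have eq_iInter : {x | ∀ s ∈ Icc a b, 0 < G (x, s) → ε < D (x, s)} = ⋂ m : ℕ,
      {x | ∃ s ∈ Icc a b, (x, s) ∈ {p : X × ℝ | 1 / (m + 1 : ℝ) ≤ G p ∧ D p ≤ ε}}ᶜ := by
    ext x
    simp only [mem_ofPred_eq, mem_iInter, mem_compl_iff, not_exists, not_and, not_le]
    refine ⟨fun h m s hs hle => h s hs (lt_of_lt_of_le (by positivity) hle), fun h s hs hpos => ?_⟩
    obtain ⟨m, hm⟩ := exists_nat_one_div_lt hpos
    exact h m s hs hm.le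
  rw [eq_iInter]
  exact MeasurableSet.iInter fun m => (isClosed_exists_mem_Icc
    ((isClosed_le continuous_const hG).inter (isClosed_le hD continuous_const))).measurableSet.compl

theorem measurableSet_forall_le_imp_exists_eq {ι : Type*} [Finite ι] (hD : Continuous D)
    {τ : ι → X → ℝ} (hτ : ∀ j, Continuous (τ j)) (ε a b : ℝ) :
    MeasurableSet {x | ∀ s ∈ Icc a b, D (x, s) ≤ ε → ∃ j, τ j x = s} := by
  have := Fintype.ofFinite ι
  convert measurableSet_forall_pos_imp_lt hD (G := fun p => ∏ j, |τ j p.1 - p.2|)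
    (by fun_prop) a b ε using 3 with x
  refine forall₂_congr fun s _ => ?_
  rw [← not_imp_not, not_le, not_exists, (Finset.prod_nonneg fun _ _ => abs_nonneg _).lt_iff_ne']
  simp [Finset.prod_ne_zero_iff, sub_eq_zero]

end TimeConditions

theorem measurableSet_isTree (n : ℕ) (t : ℝ) :
    MeasurableSet {p : (Torus × Vel) × (Fin n → Marker) | IsTree t ⟨n, p⟩} := by
  have time_meas := fun j => (continuous_collTime (n := n) continuous_id j).measurable
  have eq_inter : {p : (Torus × Vel) × (Fin n → Marker) | IsTree t ⟨n, p⟩} =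
      (⋂ j : Fin n, {p | 0 < collTime ⟨n, p⟩ j} ∩ {p | collTime ⟨n, p⟩ j ≤ t}) ∩
      ⋂ (i : Fin n) (j : Fin n) (_ : i < j), {p | collTime ⟨n, p⟩ i < collTime ⟨n, p⟩ j} := by
    ext p
    simp [IsTree, StrictMono]
  rw [eq_inter]
  exact (MeasurableSet.iInter fun j => (measurableSet_lt measurable_const (time_meas j)).inter
    (measurableSet_le (time_meas j) measurable_const)).inter <| .iInter fun i => .iInter fun j =>
      .iInter fun _ => measurableSet_lt (time_meas i) (time_meas j)

/-- The speed at which the tagged particle approaches the background particle of the `j`-th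
collision along the line of centres. -/
noncomputable def normalSpeed (Φ : CollisionTree) (j : Fin (numColl Φ)) : ℝ :=
  inner ℝ (collDir Φ j) (velAfter Φ j - collVel Φ j)

/-- Each collision is non-grazing, and the first contact with its background particle. -/
structure FirstContacts (ε t : ℝ) (Φ : CollisionTree) : Prop where
  isTree : IsTree t Φ
  lt_torusDist : ∀ j, ∀ s ∈ Icc 0 t, s < collTime Φ j →
    ε < torusDist (pos Φ s) (partnerPos ε Φ j s)
  normalSpeed_pos : ∀ j, 0 < normalSpeed Φ j

/-- The initial data of the background particles of a tree. -/
noncomputable def startMap (ε : ℝ) (Φ : CollisionTree) : Fin (numColl Φ) → Torus × Vel :=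
  fun j => (partnerStart ε Φ j, collVel Φ j)

/-- The Jacobian of `startMap` with respect to the markers. -/
noncomputable def startJac (ε : ℝ) (Φ : CollisionTree) : ENNReal :=
  ∏ j, ENNReal.ofReal (ε ^ 2 * max (normalSpeed Φ j) 0)

theorem continuous_normalSpeed (n : ℕ) (j : Fin n) :
    Continuous fun x : (Torus × Vel) × (Fin n → Marker) => normalSpeed ⟨n, x⟩ j :=
  (continuous_collDir continuous_id j).inner
    ((continuous_velAfter continuous_id j).sub (continuous_collVel continuous_id j))

theorem measurableSet_normalSpeed_pos (n : ℕ) :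
    MeasurableSet {x : (Torus × Vel) × (Fin n → Marker) |
      ∀ j : Fin n, 0 < normalSpeed ⟨n, x⟩ j} := by
  rw [ofPred_forall]
  exact .iInter fun j => measurableSet_lt measurable_const (continuous_normalSpeed n j).measurable

theorem measurableSet_firstContacts (ε t : ℝ) (n : ℕ) :
    MeasurableSet {x : (Torus × Vel) × (Fin n → Marker) | FirstContacts ε t ⟨n, x⟩} := by
  have contact_meas (j : Fin n) := measurableSet_forall_pos_imp_lt
    (continuous_torusDist_partnerPos continuous_fst continuous_snd ε j)
    ((continuous_collTime continuous_fst j).sub continuous_snd) 0 t ε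
  have eq_inter : {x : (Torus × Vel) × (Fin n → Marker) | FirstContacts ε t ⟨n, x⟩} =
      {x | IsTree t ⟨n, x⟩} ∩ ((⋂ j : Fin n, {x | ∀ s ∈ Icc 0 t, 0 < collTime ⟨n, x⟩ j - s →
        ε < torusDist (pos ⟨n, x⟩ s) (partnerPos ε ⟨n, x⟩ j s)}) ∩
      {x | ∀ j, 0 < normalSpeed ⟨n, x⟩ j}) := by
    ext x
    simp only [mem_inter_iff, mem_iInter, mem_ofPred_eq, sub_pos]
    exact ⟨fun h => ⟨h.1, h.2, h.3⟩, fun h => ⟨h.1, h.2.1, h.2.2⟩⟩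
  rw [eq_inter]
  exact (measurableSet_isTree n t).inter
    ((MeasurableSet.iInter contact_meas).inter (measurableSet_normalSpeed_pos n))

theorem measurable_startMap (ε : ℝ) (n : ℕ) :
    Measurable (β := Fin n → Torus × Vel)
      fun x : (Torus × Vel) × (Fin n → Marker) => startMap ε ⟨n, x⟩ :=
  measurable_pi_iff.2 fun j => (continuous_partnerStart continuous_id ε j).measurable.prodMk
    (continuous_collVel continuous_id j).measurable

theorem measurable_startJac (ε : ℝ) (n : ℕ) :
    Measurable fun x : (Torus × Vel) × (Fin n → Marker) => startJac ε ⟨n, x⟩ :=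
  Finset.measurable_prod Finset.univ fun (j : Fin n) _ =>
    (((continuous_normalSpeed n j).measurable.max measurable_const).const_mul
      (ε ^ 2)).ennreal_ofReal

section Snoc

variable {α : Type*} [MeasurableSpace α] {n : ℕ}

@[fun_prop]
theorem measurable_snoc {X : Type*} [MeasurableSpace X] {f : X → Fin n → α} {g : X → α}
    (hf : Measurable f) (hg : Measurable g) :
    Measurable fun x => (Fin.snoc (f x) (g x) : Fin (n + 1) → α) := by
  refine measurable_pi_iff.2 fun i => ?_
  induction i using Fin.lastCases with
  | last => simpa only [Fin.snoc_last] using hg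
  | cast i => simpa only [Fin.snoc_castSucc] using hf.eval

theorem lintegral_pi_snoc (μ : Measure α) [SigmaFinite μ]
    {f : (Fin (n + 1) → α) → ENNReal} (hf : Measurable f) :
    ∫⁻ c, f c ∂(Measure.pi fun _ => μ)
      = ∫⁻ c, ∫⁻ m, f (Fin.snoc c m) ∂μ ∂(Measure.pi fun _ => μ) := by
  have split_last := (measurePreserving_piFinSuccAbove (fun _ => μ) (Fin.last n)).symm
  rw [← split_last.lintegral_comp hf]
  refine (lintegral_prod_symm _ (hf.comp split_last.measurable).aemeasurable).trans ?_
  exact lintegral_congr fun c => lintegral_congr fun m => congrArg f (Fin.insertNth_last' m c)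

end Snoc

/-- Lebesgue measure on markers. -/
noncomputable abbrev markerMeasure : Measure Marker :=
  (volume : Measure ℝ).prod (sphereMeasure.prod (volume : Measure Vel))

theorem lintegral_marker {f : Marker → ENNReal} (hf : Measurable f) :
    ∫⁻ m, f m ∂markerMeasure = ∫⁻ v : Vel, ∫⁻ p : ℝ × Direction, f (p.1, p.2, v)
      ∂((volume : Measure ℝ).prod sphereMeasure) := by
  have assoc :=
    measurePreserving_prodAssoc (volume : Measure ℝ) sphereMeasure (volume : Measure Vel)
  rw [← assoc.lintegral_comp hf]
  exact lintegral_prod_symm _ (hf.comp assoc.measurable).aemeasurable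

/-- The tree `Φ` with the further last collision `m`. -/
abbrev addMarker (Φ : CollisionTree) (m : Marker) : CollisionTree :=
  treeOf Φ.2.1 (Fin.snoc Φ.2.2 m : Fin (numColl Φ + 1) → Marker)

section AddMarker

variable {Φ : CollisionTree} {m : Marker}

theorem marker_addMarker_castSucc (j : Fin (numColl Φ)) :
    (addMarker Φ m).2.2 j.castSucc = Φ.2.2 j :=
  Fin.snoc_castSucc (α := fun _ => Marker) _ _ _

theorem marker_addMarker_last : (addMarker Φ m).2.2 (Fin.last _) = m :=
  Fin.snoc_last (α := fun _ => Marker) _ _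

theorem collTime_addMarker_castSucc (j : Fin (numColl Φ)) :
    collTime (addMarker Φ m) j.castSucc = collTime Φ j := by
  rw [collTime, marker_addMarker_castSucc, collTime]

theorem collTime_addMarker_last : collTime (addMarker Φ m) (Fin.last _) = m.1 := by
  rw [collTime, marker_addMarker_last]

theorem collDir_addMarker_castSucc (j : Fin (numColl Φ)) :
    collDir (addMarker Φ m) j.castSucc = collDir Φ j := by
  rw [collDir, marker_addMarker_castSucc, collDir]

theorem collDir_addMarker_last : collDir (addMarker Φ m) (Fin.last _) = m.2.1 := by
  rw [collDir, marker_addMarker_last]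

theorem collVel_addMarker_castSucc (j : Fin (numColl Φ)) :
    collVel (addMarker Φ m) j.castSucc = collVel Φ j := by
  rw [collVel, marker_addMarker_castSucc, collVel]

theorem collVel_addMarker_last : collVel (addMarker Φ m) (Fin.last _) = m.2.2 := by
  rw [collVel, marker_addMarker_last]

theorem velAfter_addMarker {k : ℕ} (hk : k ≤ numColl Φ) :
    velAfter (addMarker Φ m) k = velAfter Φ k := by
  rw [(agreeUpTo_init _ _).velAfter_eq k hk, Fin.init_snoc]

theorem pos_addMarker {s : ℝ} (hs : s ≤ m.1) : pos (addMarker Φ m) s = pos Φ s := by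
  rw [pos_init _ _ (by rwa [Fin.snoc_last]), Fin.init_snoc]

theorem normalSpeed_addMarker_castSucc (j : Fin (numColl Φ)) :
    normalSpeed (addMarker Φ m) j.castSucc = normalSpeed Φ j := by
  rw [normalSpeed, collDir_addMarker_castSucc, collVel_addMarker_castSucc, Fin.val_castSucc,
    velAfter_addMarker j.2.le, normalSpeed]

theorem normalSpeed_addMarker_last : normalSpeed (addMarker Φ m) (Fin.last _) =
    inner ℝ (m.2.1 : Vel) (velAfter Φ (numColl Φ) - m.2.2) := by
  rw [normalSpeed, collDir_addMarker_last, collVel_addMarker_last, Fin.val_last,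
    velAfter_addMarker le_rfl]

variable {ε t : ℝ}

theorem partnerStart_addMarker_castSucc {j : Fin (numColl Φ)} (hj : collTime Φ j ≤ m.1) :
    partnerStart ε (addMarker Φ m) j.castSucc = partnerStart ε Φ j := by
  rw [partnerStart, collTime_addMarker_castSucc, collDir_addMarker_castSucc,
    collVel_addMarker_castSucc, pos_addMarker hj, partnerStart]

theorem partnerStart_addMarker_last (h : ∀ j, collTime Φ j ≤ m.1) :
    partnerStart ε (addMarker Φ m) (Fin.last _) = flightBase Φ +
      toTorus (m.1 • (velAfter Φ (numColl Φ) - m.2.2) + ε • (m.2.1 : Vel)) := by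
  rw [partnerStart, collTime_addMarker_last, collDir_addMarker_last, collVel_addMarker_last,
    pos_addMarker le_rfl, pos_eq_flightBase h, add_assoc, ← toTorus_add]
  congr 2
  module

theorem startMap_addMarker (h : ∀ j, collTime Φ j ≤ m.1) : startMap ε (addMarker Φ m) =
    Fin.snoc (startMap ε Φ) (flightBase Φ +
      toTorus (m.1 • (velAfter Φ (numColl Φ) - m.2.2) + ε • (m.2.1 : Vel)), m.2.2) := by
  funext j
  induction j using Fin.lastCases with
  | last =>
    rw [Fin.snoc_last]
    exact Prod.ext (partnerStart_addMarker_last h) collVel_addMarker_last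
  | cast j =>
    rw [Fin.snoc_castSucc]
    exact Prod.ext (partnerStart_addMarker_castSucc (h j)) (collVel_addMarker_castSucc j)

theorem startJac_addMarker : startJac ε (addMarker Φ m) = startJac ε Φ *
    ENNReal.ofReal (ε ^ 2 * max (inner ℝ (m.2.1 : Vel) (velAfter Φ (numColl Φ) - m.2.2)) 0) := by
  simp_rw [startJac, Fin.prod_univ_castSucc, normalSpeed_addMarker_castSucc,
    normalSpeed_addMarker_last]

theorem IsTree.time_mem_of_addMarker (h : IsTree t (addMarker Φ m)) : m.1 ∈ Ioc 0 t := by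
  simpa only [collTime_addMarker_last, mem_Ioc] using h.1 (Fin.last _)

theorem IsTree.collTime_lt_of_addMarker (h : IsTree t (addMarker Φ m)) (j : Fin (numColl Φ)) :
    collTime Φ j < m.1 := by
  simpa only [collTime_addMarker_castSucc, collTime_addMarker_last]
    using h.2 (Fin.castSucc_lt_last j)

theorem IsTree.of_addMarker (h : IsTree t (addMarker Φ m)) : IsTree t Φ := by
  refine ⟨fun j => ?_, fun i j hij => ?_⟩
  · simpa only [collTime_addMarker_castSucc] using h.1 j.castSucc
  · simpa only [collTime_addMarker_castSucc] using h.2 (Fin.castSucc_lt_castSucc_iff.2 hij)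

namespace FirstContacts

theorem of_addMarker (h : FirstContacts ε t (addMarker Φ m)) : FirstContacts ε t Φ where
  isTree := h.isTree.of_addMarker
  normalSpeed_pos j := by
    simpa only [normalSpeed_addMarker_castSucc] using h.normalSpeed_pos j.castSucc
  lt_torusDist j s hs hsj := by
    have hjm := h.isTree.collTime_lt_of_addMarker j
    have h_lt := h.lt_torusDist j.castSucc s hs (by rwa [collTime_addMarker_castSucc])
    rwa [partnerPos, partnerStart_addMarker_castSucc hjm.le, collVel_addMarker_castSucc,
      pos_addMarker (hsj.trans hjm).le] at h_lt

theorem time_le {m' : Marker} (hε : 0 ≤ ε) (h : FirstContacts ε t (addMarker Φ m))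
    (h' : FirstContacts ε t (addMarker Φ m')) (hvel : m.2.2 = m'.2.2)
    (hstart : partnerStart ε (addMarker Φ m) (Fin.last _) =
      partnerStart ε (addMarker Φ m') (Fin.last _)) : m'.1 ≤ m.1 := by
  by_contra! hlt
  have contact := torusDist_partnerPos_le hε (addMarker Φ m) (Fin.last _)
  have separated := h'.lt_torusDist (Fin.last _) m.1
    (Ioc_subset_Icc_self h.isTree.time_mem_of_addMarker) (by rwa [collTime_addMarker_last])
  rw [partnerPos, ← hstart, collVel_addMarker_last, ← hvel, pos_addMarker hlt.le] at separated
  rw [collTime_addMarker_last, partnerPos, collVel_addMarker_last, pos_addMarker le_rfl] at contact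
  exact contact.not_gt separated

theorem injOn_partnerStart (hε : 0 < ε) (hε2 : ε < 1 / 2) (Φ : CollisionTree) (v : Vel) :
    InjOn (fun p : ℝ × Direction => flightBase Φ +
        toTorus (p.1 • (velAfter Φ (numColl Φ) - v) + ε • (p.2 : Vel)))
      {p | FirstContacts ε t (addMarker Φ (p.1, p.2, v))} := by
  intro p hp p' hp' heq
  have start_eq (q : ℝ × Direction) (hq : FirstContacts ε t (addMarker Φ (q.1, q.2, v))) :=
    partnerStart_addMarker_last (ε := ε) fun j => (hq.isTree.collTime_lt_of_addMarker j).le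
  have hstart := (start_eq p hp).trans (heq.trans (start_eq p' hp').symm)
  have htime : p.1 = p'.1 :=
    le_antisymm (time_le hε.le hp' hp rfl hstart.symm) (time_le hε.le hp hp' rfl hstart)
  refine Prod.ext htime (direction_eq_of_toTorus_smul_eq hε hε2 ?_)
  have h := add_left_cancel heq
  rw [toTorus_add, toTorus_add, htime] at h
  exact add_left_cancel h

end FirstContacts

end AddMarker

theorem setLIntegral_startMap_addMarker_le {ε : ℝ} (hε : 0 < ε) (hε2 : ε < 1 / 2) (t : ℝ)
    (Φ : CollisionTree) {v : Vel} {q : (Fin (numColl Φ + 1) → Torus × Vel) → ENNReal}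
    (hq : Measurable q) :
    ∫⁻ p in {p : ℝ × Direction | FirstContacts ε t (addMarker Φ (p.1, p.2, v))},
        startJac ε (addMarker Φ (p.1, p.2, v)) * q (startMap ε (addMarker Φ (p.1, p.2, v)))
        ∂((volume : Measure ℝ).prod sphereMeasure)
      ≤ startJac ε Φ * ∫⁻ x : Torus, q (Fin.snoc (startMap ε Φ) (x, v)) := by
  set R := {p : ℝ × Direction | FirstContacts ε t (addMarker Φ (p.1, p.2, v))}
  have hR : MeasurableSet R := (measurableSet_firstContacts ε t _).preimage (by fun_prop)
  have normalSpeed_pos (p) (hp : p ∈ R) : 0 < inner ℝ (p.2 : Vel) (velAfter Φ (numColl Φ) - v) := by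
    simpa only [normalSpeed_addMarker_last] using hp.normalSpeed_pos (Fin.last _)
  have hqx : Measurable fun x : Torus => q (Fin.snoc (startMap ε Φ) (x, v)) :=
    hq.comp (by fun_prop)
  calc _ = ∫⁻ p in R, startJac ε Φ *
          (ENNReal.ofReal (ε ^ 2 * max (inner ℝ (p.2 : Vel) (velAfter Φ (numColl Φ) - v)) 0) *
          q (Fin.snoc (startMap ε Φ) (flightBase Φ + toTorus
            (p.1 • (velAfter Φ (numColl Φ) - v) + ε • (p.2 : Vel)), v)))
          ∂((volume : Measure ℝ).prod sphereMeasure) := by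
        refine setLIntegral_congr_fun hR fun p hp => ?_
        have collTime_le j := (hp.isTree.collTime_lt_of_addMarker j).le
        rw [startJac_addMarker, startMap_addMarker collTime_le, mul_assoc]
    _ = startJac ε Φ * ∫⁻ p in R, _ ∂((volume : Measure ℝ).prod sphereMeasure) :=
        lintegral_const_mul _ (.mul (by fun_prop) (hqx.comp (by fun_prop)))
    _ ≤ _ := mul_le_mul_right (lintegral_collision_le hε _ hR
        (FirstContacts.injOn_partnerStart hε hε2 Φ v) normalSpeed_pos hqx) _

theorem lintegral_startMap_addMarker_le {ε : ℝ} (hε : 0 < ε) (hε2 : ε < 1 / 2) (t : ℝ)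
    (Φ : CollisionTree) {q : (Fin (numColl Φ + 1) → Torus × Vel) → ENNReal} (hq : Measurable q) :
    ∫⁻ m in {m | FirstContacts ε t (addMarker Φ m)},
        startJac ε (addMarker Φ m) * q (startMap ε (addMarker Φ m)) ∂markerMeasure
      ≤ startJac ε Φ * ∫⁻ x, q (Fin.snoc (startMap ε Φ) x) := by
  have integrand_meas : Measurable fun m =>
      startJac ε (addMarker Φ m) * q (startMap ε (addMarker Φ m)) :=
    ((measurable_startJac ε _).comp (by fun_prop)).mul
      (hq.comp ((measurable_startMap ε _).comp (by fun_prop)))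
  have hS : MeasurableSet {m | FirstContacts ε t (addMarker Φ m)} :=
    (measurableSet_firstContacts ε t _).preimage (by fun_prop)
  have hqx : Measurable fun x => q (Fin.snoc (startMap ε Φ) x) := hq.comp (by fun_prop)
  rw [← lintegral_indicator hS, lintegral_marker (integrand_meas.indicator hS),
    Measure.volume_eq_prod, lintegral_prod_symm _ hqx.aemeasurable,
    ← lintegral_const_mul _ hqx.lintegral_prod_left']
  refine lintegral_mono fun v => ?_
  have hRv : MeasurableSet {p : ℝ × Direction | FirstContacts ε t (addMarker Φ (p.1, p.2, v))} :=
    hS.preimage (f := fun p : ℝ × Direction => (p.1, p.2, v)) (by fun_prop)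
  exact (lintegral_indicator hRv _).trans_le (setLIntegral_startMap_addMarker_le hε hε2 t Φ hq)

theorem setLIntegral_startMap_le {ε : ℝ} (hε : 0 < ε) (hε2 : ε < 1 / 2) (t : ℝ) (r : Torus × Vel)
    {n : ℕ} {q : (Fin n → Torus × Vel) → ENNReal} (hq : Measurable q) :
    ∫⁻ c in {c | FirstContacts ε t (treeOf r c)},
        startJac ε (treeOf r c) * q (startMap ε (treeOf r c)) ∂(Measure.pi fun _ => markerMeasure)
      ≤ ∫⁻ y, q y ∂(Measure.pi fun _ => volume) := by
  induction n with
  | zero =>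
    refine (setLIntegral_le_lintegral _ _).trans_eq ?_
    rw [Measure.pi_of_empty (fun _ : Fin 0 => markerMeasure) Fin.elim0,
      Measure.pi_of_empty (fun _ : Fin 0 => (volume : Measure (Torus × Vel))) Fin.elim0,
      lintegral_dirac' _ hq, lintegral_dirac, startJac, Finset.univ_eq_empty, Finset.prod_empty,
      one_mul, Subsingleton.elim (startMap ε _) Fin.elim0]
  | succ n ih =>
    have integrand_meas : Measurable fun c : Fin (n + 1) → Marker =>
        startJac ε (treeOf r c) * q (startMap ε (treeOf r c)) :=
      ((measurable_startJac ε _).comp measurable_prodMk_left).mul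
        (hq.comp ((measurable_startMap ε _).comp measurable_prodMk_left))
    have hS (k : ℕ) : MeasurableSet {c : Fin k → Marker | FirstContacts ε t (treeOf r c)} :=
      (measurableSet_firstContacts ε t k).preimage measurable_prodMk_left
    rw [← lintegral_indicator (hS _), lintegral_pi_snoc _ (integrand_meas.indicator (hS _)),
      lintegral_pi_snoc _ hq]
    have hK : Measurable fun y : Fin n → Torus × Vel => ∫⁻ x, q (Fin.snoc y x) :=
      .lintegral_prod_right' (hq.comp (measurable_snoc measurable_fst measurable_snd))
    refine le_trans ?_ (ih hK)
    rw [← lintegral_indicator (hS n)]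
    refine lintegral_mono fun c => ?_
    by_cases hc : FirstContacts ε t (treeOf r c)
    · rw [indicator_of_mem (show c ∈ {c | FirstContacts ε t (treeOf r c)} from hc)]
      have hSc := (hS (n + 1)).preimage (measurable_snoc (measurable_const (a := c)) measurable_id)
      exact (lintegral_indicator hSc _).trans_le
        (lintegral_startMap_addMarker_le hε hε2 t (treeOf r c) hq)
    · have integrand_zero m := indicator_of_notMem (fun h => hc (FirstContacts.of_addMarker h))
        (s := {c | FirstContacts ε t (treeOf r c)}) (a := Fin.snoc c m)
        fun c => startJac ε (treeOf r c) * q (startMap ε (treeOf r c))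
      simp only [integrand_zero, lintegral_zero, zero_le]

instance : BorelSpace (Torus × Vel) := inferInstance

instance (n : ℕ) : BorelSpace (Fin n → Torus × Vel) :=
  @Pi.borelSpace (Fin n) (fun _ => Torus × Vel) _ _ _ (fun _ => inferInstance)
    fun _ => inferInstance

instance (n : ℕ) : SecondCountableTopology (Fin n → Torus × Vel) :=
  @TopologicalSpace.instSecondCountableTopologyForallOfCountable _ _ _ _ fun _ => inferInstance

instance (n : ℕ) : StandardBorelSpace (Fin n → Torus × Vel) :=
  @StandardBorelSpace.pi_countable _ _ _ _ fun _ => inferInstance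

instance (n : ℕ) : StandardBorelSpace (Fin n → Marker) :=
  @StandardBorelSpace.pi_countable _ _ _ _ fun _ => inferInstance

theorem measurableSet_image_fst {α β : Type*} [MeasurableSpace α] [MeasurableSpace β]
    [StandardBorelSpace α] [StandardBorelSpace β] {s : Set (α × β)} (hs : MeasurableSet s)
    (hinj : InjOn Prod.fst s) : MeasurableSet (Prod.fst '' s) :=
  hs.image_of_measurable_injOn measurable_fst hinj

section HistoryGraph

variable {X : Type*} [TopologicalSpace X] {N n : ℕ} {z : X → Config N}
  {Φ : X → (Torus × Vel) × (Fin n → Marker)} {τ : X → ℝ}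

theorem continuous_bgPos (hz : Continuous z) (hτ : Continuous τ) (i : Fin N) :
    Continuous fun x => bgPos (z x) i (τ x) :=
  .add (by fun_prop) (continuous_toTorus.comp (by fun_prop))

theorem isClosed_bgPos_eq (hz : Continuous z) (hΦ : Continuous Φ) (ε : ℝ) (i : Fin N)
    (j : Fin n) : IsClosed {x | bgPos (z x) i (collTime ⟨n, Φ x⟩ j) =
      pos ⟨n, Φ x⟩ (collTime ⟨n, Φ x⟩ j) + toTorus (ε • collDir ⟨n, Φ x⟩ j)} :=
  have time_cont := continuous_collTime hΦ j
  isClosed_eq (continuous_bgPos hz time_cont i) <| (continuous_pos hΦ time_cont).add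
    (continuous_toTorus.comp ((continuous_collDir hΦ j).const_smul ε))

theorem measurableSet_contact_imp_collTime [MeasurableSpace X] [OpensMeasurableSpace X]
    (hz : Continuous z) (hΦ : Continuous Φ) (ε t : ℝ) (p : Fin n → Fin N) (i : Fin N) :
    MeasurableSet {x | ∀ s ∈ Icc 0 t, torusDist (pos ⟨n, Φ x⟩ s) (bgPos (z x) i s) ≤ ε →
      ∃ j : {j // p j = i}, collTime ⟨n, Φ x⟩ j.1 = s} :=
  measurableSet_forall_le_imp_exists_eq (ι := {j // p j = i})
    (D := fun y => torusDist (pos ⟨n, Φ y.1⟩ y.2) (bgPos (z y.1) i y.2))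
    (continuous_torusDist (continuous_pos (hΦ.comp continuous_fst) continuous_snd)
      (continuous_bgPos (hz.comp continuous_fst) continuous_snd i))
    (fun j => continuous_collTime hΦ j.1) ε 0 t

theorem measurableSet_isHistoryVia (ε t : ℝ) (p : Fin n → Fin N) :
    MeasurableSet {x : Config N × ((Torus × Vel) × (Fin n → Marker)) |
      IsHistoryVia ε t x.1 ⟨n, x.2⟩ p} := by
  have eq_inter : {x : Config N × ((Torus × Vel) × (Fin n → Marker)) |
      IsHistoryVia ε t x.1 ⟨n, x.2⟩ p} = {x | x.2.1 = x.1.1} ∩ {x | IsTree t ⟨n, x.2⟩} ∩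
      (⋂ i, {x | ε < torusDist x.1.1.1 (x.1.2 i).1}) ∩
      (⋂ j : Fin n, {x | (x.1.2 (p j)).2 = collVel ⟨n, x.2⟩ j}) ∩
      (⋂ j : Fin n, {x | bgPos x.1 (p j) (collTime ⟨n, x.2⟩ j) =
        pos ⟨n, x.2⟩ (collTime ⟨n, x.2⟩ j) + toTorus (ε • collDir ⟨n, x.2⟩ j)}) ∩
      ⋂ i, {x | ∀ s ∈ Icc 0 t, torusDist (pos ⟨n, x.2⟩ s) (bgPos x.1 i s) ≤ ε →
        ∃ j : {j // p j = i}, collTime ⟨n, x.2⟩ j.1 = s} := by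
    ext x
    simp only [mem_inter_iff, mem_ofPred_eq, mem_iInter, and_assoc, Subtype.exists, exists_prop]
    exact ⟨fun h => ⟨h.1, h.2, h.3, h.4, h.5, fun i s hs => h.contact s hs i⟩,
      fun h => ⟨h.1, h.2.1, h.2.2.1, h.2.2.2.1, h.2.2.2.2.1, fun s hs i => h.2.2.2.2.2 i s hs⟩⟩
  rw [eq_inter]
  refine (((((isClosed_eq (by fun_prop) (by fun_prop)).measurableSet.inter
    ((measurableSet_isTree n t).preimage measurable_snd)).inter
    (.iInter fun i => measurableSet_lt measurable_const (Continuous.measurable ?_))).inter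
    (.iInter fun j => (isClosed_eq (by fun_prop)
      (continuous_collVel continuous_snd j)).measurableSet)).inter
    (.iInter fun j => (isClosed_bgPos_eq continuous_fst continuous_snd ε
      (p j) j).measurableSet)).inter
    (.iInter (measurableSet_contact_imp_collTime continuous_fst continuous_snd ε t p))
  exact continuous_torusDist (by fun_prop) (by fun_prop)

end HistoryGraph

/-- The initial data with a history in `B` whose collisions are with the particles `p`. -/
def historyEvent {N n : ℕ} (ε t : ℝ) (p : Fin n → Fin N)
    (B : Set ((Torus × Vel) × (Fin n → Marker))) : Set (Config N) :=
  {z | ∃ x ∈ B, IsHistoryVia ε t z ⟨n, x⟩ p}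

section HistoryEvent

variable {N n : ℕ} {ε t : ℝ}

theorem measurableSet_historyEvent (hε : 0 < ε) (hε2 : ε < 1 / 2)
    (p : Fin n → Fin N) {B : Set ((Torus × Vel) × (Fin n → Marker))} (hB : MeasurableSet B) :
    MeasurableSet (historyEvent ε t p B) := by
  have eq_image : historyEvent ε t p B =
      Prod.fst '' ({x | IsHistoryVia ε t x.1 ⟨n, x.2⟩ p} ∩ Prod.snd ⁻¹' B) := by
    ext z
    constructor
    · rintro ⟨x, hx, h⟩
      exact ⟨(z, x), ⟨h, hx⟩, rfl⟩
    · rintro ⟨⟨_, x⟩, ⟨h, hx⟩, rfl⟩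
      exact ⟨x, hx, h⟩
  rw [eq_image]
  refine measurableSet_image_fst
    ((measurableSet_isHistoryVia ε t p).inter (hB.preimage measurable_snd)) ?_
  rintro ⟨z, x⟩ ⟨hx, -⟩ ⟨z', x'⟩ ⟨hx', -⟩ (rfl : z = z')
  have tree_eq : (⟨n, x⟩ : CollisionTree) = ⟨n, x'⟩ := hx.tree_unique hε hε2 hx'
  rw [sigma_mk_injective tree_eq]

theorem disjoint_historyEvent (hε : 0 < ε) (hε2 : ε < 1 / 2)
    {p q : Fin n → Fin N} (hpq : p ≠ q) (B C : Set ((Torus × Vel) × (Fin n → Marker))) :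
    Disjoint (historyEvent ε t p B) (historyEvent ε t q C) := by
  refine Set.disjoint_left.2 ?_
  rintro z ⟨x, -, hx⟩ ⟨x', -, hx'⟩
  obtain rfl := sigma_mk_injective (hx.tree_unique hε hε2 hx')
  exact hpq (hx.labels_unique hε.le hx')

theorem history_eq (hε : 0 < ε) (hε2 : ε < 1 / 2) {z : Config N} {Φ : CollisionTree}
    (h : IsHistory ε t z Φ) : history ε t z = Φ := by
  have exists_history : ∃ Φ, IsHistory ε t z Φ := ⟨Φ, h⟩
  rw [history, dif_pos exists_history]
  obtain ⟨p, hp⟩ := isHistory_iff.1 h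
  obtain ⟨q, hq⟩ := isHistory_iff.1 exists_history.choose_spec
  exact hq.tree_unique hε hε2 hp

theorem preimage_history_inter (hε : 0 < ε) (hε2 : ε < 1 / 2) (A : Set CollisionTree) :
    history ε t ⁻¹' A ∩ {z : Config N | ∃ Φ, IsHistory ε t z Φ}
      = ⋃ n, ⋃ p : Fin n → Fin N, historyEvent ε t p {x | ⟨n, x⟩ ∈ A} := by
  ext z
  simp only [mem_inter_iff, mem_preimage, mem_ofPred_eq, mem_iUnion]
  constructor
  · rintro ⟨hA, ⟨n, x⟩, h⟩
    obtain ⟨p, hp⟩ := isHistory_iff.1 h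
    rw [history_eq hε hε2 h] at hA
    exact ⟨n, p, x, hA, hp⟩
  · rintro ⟨n, p, x, hx, hp⟩
    have h : IsHistory ε t z ⟨n, x⟩ := isHistory_iff.2 ⟨p, hp⟩
    exact ⟨(history_eq hε hε2 h).symm ▸ hx, _, h⟩

theorem measurableSet_sigma_iff {A : Set CollisionTree} :
    MeasurableSet A ↔ ∀ n : ℕ,
      MeasurableSet {x : (Torus × Vel) × (Fin n → Marker) | ⟨n, x⟩ ∈ A} :=
  MeasurableSpace.measurableSet_iInf

theorem measurable_sigmaMk (n : ℕ) :
    Measurable fun x : (Torus × Vel) × (Fin n → Marker) => (⟨n, x⟩ : CollisionTree) :=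
  fun _ hA => measurableSet_sigma_iff.1 hA n

theorem measurableSet_preimage_history (hε : 0 < ε) (hε2 : ε < 1 / 2) {A : Set CollisionTree}
    (hA : MeasurableSet A) :
    MeasurableSet (history ε t ⁻¹' A ∩ {z : Config N | ∃ Φ, IsHistory ε t z Φ}) := by
  rw [preimage_history_inter hε hε2]
  exact .iUnion fun n => .iUnion fun p =>
    measurableSet_historyEvent hε hε2 p (measurableSet_sigma_iff.1 hA n)
theorem empiricalLaw_apply (hε : 0 < ε) (hε2 : ε < 1 / 2) (f₀ : Torus × Vel → ℝ) (g₀ : Vel → ℝ)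
    {A : Set CollisionTree} (hA : MeasurableSet A) :
    empiricalLaw f₀ g₀ N ε t A = configLaw f₀ g₀ N
      (history ε t ⁻¹' A ∩ {z : Config N | ∃ Φ, IsHistory ε t z Φ}) := by
  have domain_meas : MeasurableSet {z : Config N | ∃ Φ, IsHistory ε t z Φ} := by
    simpa only [preimage_univ, univ_inter] using
      measurableSet_preimage_history (N := N) (t := t) hε hε2 .univ
  have history_meas : AEMeasurable (history ε t)
      ((configLaw f₀ g₀ N).restrict {z | ∃ Φ, IsHistory ε t z Φ}) := by
    refine aemeasurable_restrict_of_measurable_subtype domain_meas fun A hA => ?_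
    convert (measurableSet_preimage_history hε hε2 hA).preimage measurable_subtype_coe using 1
    exact (Subtype.preimage_coe_inter_self {z | ∃ Φ, IsHistory ε t z Φ} (history ε t ⁻¹' A)).symm
  rw [empiricalLaw, Measure.map_apply_of_aemeasurable history_meas hA,
    Measure.restrict_apply' domain_meas]

theorem sum_historyEvent_le_empiricalLaw (hε : 0 < ε) (hε2 : ε < 1 / 2) (f₀ : Torus × Vel → ℝ)
    (g₀ : Vel → ℝ) {A : Set CollisionTree} (hA : MeasurableSet A) (s : Finset (Fin n → Fin N)) :
    ∑ p ∈ s, configLaw f₀ g₀ N (historyEvent ε t p {x | ⟨n, x⟩ ∈ A})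
      ≤ empiricalLaw f₀ g₀ N ε t A := by
  rw [empiricalLaw_apply hε hε2 f₀ g₀ hA, preimage_history_inter hε hε2,
    ← measure_biUnion_finset (fun p _ q _ hpq => disjoint_historyEvent hε hε2 hpq _ _)
      fun p _ => measurableSet_historyEvent hε hε2 p (measurableSet_sigma_iff.1 hA n)]
  exact measure_mono (iUnion₂_subset fun p _ => subset_iUnion_of_subset n
    (subset_iUnion (fun p : Fin n → Fin N => historyEvent ε t p {x | ⟨n, x⟩ ∈ A}) p))

end HistoryEvent

/-- The law of the initial data of a background particle. -/
noncomputable def bgMeasure (g₀ : Vel → ℝ) : Measure (Torus × Vel) :=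
  volume.withDensity fun p => ENNReal.ofReal (g₀ p.2)

instance (g₀ : Vel → ℝ) : SigmaFinite (bgMeasure g₀) :=
  inferInstanceAs (SigmaFinite (volume.withDensity fun p : Torus × Vel => ENNReal.ofReal (g₀ p.2)))

theorem sigmaFinite_pi_const {X : Type*} [MeasurableSpace X] (μ : Measure X) [SigmaFinite μ]
    (n : ℕ) : SigmaFinite (Measure.pi fun _ : Fin n => μ) := inferInstance

instance (n : ℕ) : SigmaFinite (Measure.pi fun _ : Fin n => markerMeasure) :=
  sigmaFinite_pi_const markerMeasure n

instance (g₀ : Vel → ℝ) (n : ℕ) : SigmaFinite (Measure.pi fun _ : Fin n => bgMeasure g₀) :=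
  sigmaFinite_pi_const (bgMeasure g₀) n

theorem configLaw_eq_prod_bgMeasure (f₀ : Torus × Vel → ℝ) (g₀ : Vel → ℝ) (N : ℕ) :
    configLaw f₀ g₀ N = (volume.withDensity fun p => ENNReal.ofReal (f₀ p)).prod
      (Measure.pi fun _ => bgMeasure g₀) := rfl

/-- The initial data of background particles that stay away from the tagged particle of the tree
during `[0, t]`. -/
def survivalSet (ε t : ℝ) (Φ : CollisionTree) : Set (Torus × Vel) :=
  {y | ∀ s ∈ Icc 0 t, ε < torusDist (pos Φ s) (y.1 + toTorus (s • y.2))}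

theorem measurableSet_survivalGraph (ε t : ℝ) (n : ℕ) :
    MeasurableSet {q : ((Torus × Vel) × (Fin n → Marker)) × (Torus × Vel) |
      q.2 ∈ survivalSet ε t ⟨n, q.1⟩} := by
  have dist_cont : Continuous fun q : (((Torus × Vel) × (Fin n → Marker)) × (Torus × Vel)) × ℝ =>
      torusDist (pos ⟨n, q.1.1⟩ q.2) (q.1.2.1 + toTorus (q.2 • q.1.2.2)) :=
    continuous_torusDist (continuous_pos (by fun_prop) continuous_snd)
      (.add (by fun_prop) (continuous_toTorus.comp (by fun_prop)))
  convert (isClosed_exists_mem_Icc (a := 0) (b := t)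
    (isClosed_le dist_cont (continuous_const (y := ε)))).measurableSet.compl using 1
  ext q
  simp only [survivalSet, mem_compl_iff, mem_ofPred_eq, not_exists, not_and, not_le]

theorem measurableSet_survivalSet (ε t : ℝ) (Φ : CollisionTree) :
    MeasurableSet (survivalSet ε t Φ) :=
  measurable_prodMk_left (x := Φ.2) (measurableSet_survivalGraph ε t Φ.1)

/-- The probability that a background particle stays away from the tagged particle of the tree. -/
noncomputable def survivalProb (g₀ : Vel → ℝ) (ε t : ℝ) (Φ : CollisionTree) : ENNReal :=
  bgMeasure g₀ (survivalSet ε t Φ)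

theorem measurable_survivalProb (g₀ : Vel → ℝ) (ε t : ℝ) (n : ℕ) :
    Measurable fun x : (Torus × Vel) × (Fin n → Marker) => survivalProb g₀ ε t ⟨n, x⟩ :=
  measurable_measure_prodMk_left (measurableSet_survivalGraph ε t n)

/-- All collisions are non-grazing, and the background particles of the tree meet the tagged
particle at these collisions only. -/
structure IsClean (ε t : ℝ) (Φ : CollisionTree) : Prop where
  isTree : IsTree t Φ
  normalSpeed_pos : ∀ j, 0 < normalSpeed Φ j
  eq_of_contact : ∀ j, ∀ s ∈ Icc 0 t,
    torusDist (pos Φ s) (partnerPos ε Φ j s) ≤ ε → collTime Φ j = s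

theorem IsClean.firstContacts {ε t : ℝ} {Φ : CollisionTree} (h : IsClean ε t Φ) :
    FirstContacts ε t Φ where
  isTree := h.isTree
  normalSpeed_pos := h.normalSpeed_pos
  lt_torusDist j s hs hsj := lt_of_not_ge fun hd => hsj.ne' (h.eq_of_contact j s hs hd)

theorem measurableSet_isClean (ε t : ℝ) (n : ℕ) :
    MeasurableSet {x : (Torus × Vel) × (Fin n → Marker) | IsClean ε t ⟨n, x⟩} := by
  have contact_meas (j : Fin n) := measurableSet_forall_le_imp_exists_eq (ι := Unit)
    (continuous_torusDist_partnerPos (n := n) continuous_fst continuous_snd ε j)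
    (fun _ => continuous_collTime continuous_id j) ε 0 t
  convert ((measurableSet_isTree n t).inter (measurableSet_normalSpeed_pos n)).inter
    (.iInter contact_meas) using 1
  ext x
  simp only [mem_inter_iff, mem_iInter, mem_ofPred_eq, exists_const]
  exact ⟨fun h => ⟨⟨h.1, h.2⟩, h.3⟩, fun h => ⟨h.1.1, h.1.2, h.2⟩⟩

theorem IsClean.isHistoryVia {N : ℕ} {ε t : ℝ} (ht : 0 ≤ t) {Φ : CollisionTree}
    (h : IsClean ε t Φ) {p : Fin (numColl Φ) → Fin N} {z : Config N} (hroot : Φ.2.1 = z.1)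
    (hp : ∀ j, z.2 (p j) = startMap ε Φ j) (ho : ∀ i ∉ range p, z.2 i ∈ survivalSet ε t Φ) :
    IsHistoryVia ε t z Φ p := by
  have bgPos_label (j s) : bgPos z (p j) s = partnerPos ε Φ j s := by rw [bgPos, hp j]; rfl
  have contact : ∀ s ∈ Icc 0 t, ∀ i, torusDist (pos Φ s) (bgPos z i s) ≤ ε →
      ∃ j, p j = i ∧ collTime Φ j = s := by
    intro s hs i hd
    by_cases hi : i ∈ range p
    · obtain ⟨j, rfl⟩ := hi
      exact ⟨j, rfl, h.eq_of_contact j s hs (bgPos_label j s ▸ hd)⟩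
    · exact absurd hd (not_le.2 (ho i hi s hs))
  refine ⟨hroot, h.isTree, fun i => ?_, fun j => congrArg Prod.snd (hp j), fun j => ?_, contact⟩
  · by_contra! overlap
    have pos_start : pos Φ 0 = z.1.1 := by
      rw [pos_zero Φ fun j => (h.isTree.1 j).1, ← hroot, rootPos]
    have bgPos_start : bgPos z i 0 = (z.2 i).1 := by
      rw [bgPos, zero_smul, toTorus_zero, add_zero]
    obtain ⟨j, -, hj⟩ := contact 0 ⟨le_rfl, ht⟩ i (by rwa [pos_start, bgPos_start])
    exact (h.isTree.1 j).1.ne' hj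
  · rw [bgPos_label, partnerPos_collTime]

theorem exists_pi_split {X : Type*} [MeasurableSpace X] (μ : Measure X) [SigmaFinite μ] {n N : ℕ}
    {p : Fin n → Fin N} (hp : Function.Injective p) :
    ∃ Ψ : (Fin n → X) × (↥(range p)ᶜ → X) → (Fin N → X),
      MeasurePreserving Ψ ((Measure.pi fun _ => μ).prod (Measure.pi fun _ => μ))
        (Measure.pi fun _ => μ) ∧
      (∀ y w j, Ψ (y, w) (p j) = y j) ∧ ∀ y w (i : ↥(range p)ᶜ), Ψ (y, w) i = w i := by
  classical
  let e : Fin n ⊕ ↥(range p)ᶜ ≃ Fin N :=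
    (Equiv.sumCongr (Equiv.ofInjective p hp) (Equiv.refl _)).trans (Equiv.Set.sumCompl (range p))
  have reindex_apply (x i) : MeasurableEquiv.piCongrLeft (fun _ : Fin N => X) e x (e i) = x i :=
    MeasurableEquiv.piCongrLeft_apply_apply (β := fun _ => X) e x i
  exact ⟨_, (measurePreserving_piCongrLeft (fun _ => μ) e).comp
      (measurePreserving_sumPiEquivProdPi_symm fun _ => μ),
    fun y w j => reindex_apply _ (Sum.inl j), fun y w i => reindex_apply _ (Sum.inr i)⟩

/-- The function `q` is the conditional probability of `E` given the coordinates `p`. -/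
theorem exists_condProb_coordinates {X : Type*} [MeasurableSpace X] (μ : Measure X) [SigmaFinite μ]
    {n N : ℕ} {p : Fin n → Fin N} (hp : Function.Injective p) {E : Set (Fin N → X)}
    (hE : MeasurableSet E) :
    ∃ q : (Fin n → X) → ENNReal, Measurable q ∧
      ∫⁻ y, q y ∂(Measure.pi fun _ => μ) = (Measure.pi fun _ => μ) E ∧
      ∀ y S, (∀ z, (∀ j, z (p j) = y j) → (∀ i ∉ range p, z i ∈ S) → z ∈ E) →
        μ S ^ (N - n) ≤ q y := by
  obtain ⟨Ψ, hΨ, hΨp, hΨo⟩ := exists_pi_split μ hp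
  refine ⟨fun y => (Measure.pi fun _ => μ) {w | Ψ (y, w) ∈ E},
    measurable_measure_prodMk_left (hΨ.measurable hE), ?_, fun y S hS => ?_⟩
  · rw [← hΨ.measure_preimage hE.nullMeasurableSet, Measure.prod_apply (hΨ.measurable hE)]
    rfl
  · have card_compl : Fintype.card ↥(range p)ᶜ = N - n := by
      rw [Fintype.card_compl_set, Fintype.card_fin, card_range_of_injective hp, Fintype.card_fin]
    calc μ S ^ (N - n) = (Measure.pi fun _ : ↥(range p)ᶜ => μ) (univ.pi fun _ => S) := by
          rw [Measure.pi_pi, Finset.prod_const, Finset.card_univ, card_compl]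
      _ ≤ _ := measure_mono fun w hw => hS _ (hΨp y w) fun i hi => by
          rw [hΨo y w ⟨i, hi⟩]
          exact hw ⟨i, hi⟩ (mem_univ _)

theorem lintegral_pi_withDensity {X : Type*} [MeasurableSpace X] (μ : Measure X) [SigmaFinite μ]
    {g : X → ENNReal} (hg : Measurable g) [SigmaFinite (μ.withDensity g)] {n : ℕ}
    {q : (Fin n → X) → ENNReal} (hq : Measurable q) :
    ∫⁻ y, q y ∂(Measure.pi fun _ => μ.withDensity g)
      = ∫⁻ y, (∏ j, g (y j)) * q y ∂(Measure.pi fun _ => μ) := by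
  induction n with
  | zero =>
    rw [Measure.pi_of_empty (fun _ : Fin 0 => μ.withDensity g) Fin.elim0,
      Measure.pi_of_empty (fun _ : Fin 0 => μ) Fin.elim0]
    simp only [Finset.univ_eq_empty, Finset.prod_empty, one_mul]
  | succ n ih =>
    have inner_meas : Measurable fun y : Fin n → X => ∫⁻ x, q (Fin.snoc y x) ∂(μ.withDensity g) :=
      .lintegral_prod_right' (f := fun a : (Fin n → X) × X => q (Fin.snoc a.1 a.2))
        (hq.comp (by fun_prop))
    have weighted_meas : Measurable fun y : Fin (n + 1) → X => (∏ j, g (y j)) * q y := by fun_prop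
    rw [lintegral_pi_snoc _ hq, lintegral_pi_snoc _ weighted_meas, ih inner_meas]
    refine lintegral_congr fun y => ?_
    have snoc_meas : Measurable fun x => q (Fin.snoc y x) := hq.comp (by fun_prop)
    rw [lintegral_withDensity_eq_lintegral_mul _ hg snoc_meas,
      ← lintegral_const_mul _ (hg.mul snoc_meas)]
    refine lintegral_congr fun x => ?_
    simp only [Pi.mul_apply, Fin.prod_univ_castSucc, Fin.snoc_castSucc, Fin.snoc_last, mul_assoc]

/-- A lower bound for the density of the law of the history of collisions, for each labelling of
the collisions by particles. -/
noncomputable def labelledDensity (f₀ : Torus × Vel → ℝ) (g₀ : Vel → ℝ) (N : ℕ) (ε t : ℝ)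
    (Φ : CollisionTree) : ENNReal :=
  ENNReal.ofReal (f₀ Φ.2.1) * (startJac ε Φ * (∏ j, ENNReal.ofReal (g₀ (collVel Φ j))) *
    survivalProb g₀ ε t Φ ^ (N - numColl Φ))

/-- Lebesgue measure on the trees with `n` collisions. -/
noncomputable abbrev treeMeasureN (n : ℕ) : Measure ((Torus × Vel) × (Fin n → Marker)) :=
  (volume : Measure (Torus × Vel)).prod (Measure.pi fun _ : Fin n => markerMeasure)

section LabelledDensity

variable {f₀ : Torus × Vel → ℝ} {g₀ : Vel → ℝ} {N n : ℕ} {ε t : ℝ}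

theorem measurable_labelledDensity (hf : Measurable f₀) (hg : Measurable g₀) (N : ℕ) (ε t : ℝ)
    (n : ℕ) : Measurable fun x : (Torus × Vel) × (Fin n → Marker) =>
      labelledDensity f₀ g₀ N ε t ⟨n, x⟩ := by
  have collVel_meas (j : Fin n) := (continuous_collVel continuous_id j).measurable
  exact (hf.comp measurable_fst).ennreal_ofReal.mul (((measurable_startJac ε n).mul
    (Finset.measurable_prod Finset.univ fun j _ => (hg.comp (collVel_meas j)).ennreal_ofReal)).mul
      ((measurable_survivalProb g₀ ε t n).pow_const (N - n)))

variable {p : Fin n → Fin N} {B : Set ((Torus × Vel) × (Fin n → Marker))}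

theorem setLIntegral_labelledDensity_le_of_root (hg : Measurable g₀) (ht : 0 ≤ t)
    (hε : 0 < ε) (hε2 : ε < 1 / 2) (hp : Function.Injective p) (hB : MeasurableSet B)
    (hBc : ∀ x ∈ B, IsClean ε t ⟨n, x⟩) (r : Torus × Vel) :
    ∫⁻ c in Prod.mk r ⁻¹' B, labelledDensity f₀ g₀ N ε t (treeOf r c)
        ∂(Measure.pi fun _ => markerMeasure)
      ≤ ENNReal.ofReal (f₀ r) *
        (Measure.pi fun _ => bgMeasure g₀) (Prod.mk r ⁻¹' historyEvent ε t p B) := by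
  obtain ⟨q, q_meas, lintegral_q, le_q⟩ := exists_condProb_coordinates (bgMeasure g₀) hp
    (measurable_prodMk_left (x := r) (measurableSet_historyEvent (t := t) hε hε2 p hB))
  have g_meas : Measurable fun y : Torus × Vel => ENNReal.ofReal (g₀ y.2) := by fun_prop
  set Q : (Fin n → Torus × Vel) → ENNReal := fun y => (∏ j, ENNReal.ofReal (g₀ (y j).2)) * q y
  have Q_meas : Measurable Q := by fun_prop
  have startJac_Q_meas : Measurable fun c : Fin n → Marker =>
      startJac ε (treeOf r c) * Q (startMap ε (treeOf r c)) :=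
    ((measurable_startJac ε n).mul (Q_meas.comp (measurable_startMap ε n))).comp
      measurable_prodMk_left
  have density_le (c) (hc : c ∈ Prod.mk r ⁻¹' B) : labelledDensity f₀ g₀ N ε t (treeOf r c) ≤
      ENNReal.ofReal (f₀ r) * (startJac ε (treeOf r c) * Q (startMap ε (treeOf r c))) := by
    have survivalProb_le : survivalProb g₀ ε t (treeOf r c) ^ (N - n) ≤
        q (startMap ε (treeOf r c)) :=
      le_q _ _ fun z hz ho => ⟨(r, c), hc, (hBc _ hc).isHistoryVia ht rfl hz ho⟩
    rw [labelledDensity, mul_assoc]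
    exact mul_le_mul_right (mul_le_mul_right (mul_le_mul_right survivalProb_le _) _) _
  calc _ ≤ ∫⁻ c in Prod.mk r ⁻¹' B, ENNReal.ofReal (f₀ r) *
          (startJac ε (treeOf r c) * Q (startMap ε (treeOf r c)))
          ∂(Measure.pi fun _ => markerMeasure) :=
        setLIntegral_mono (startJac_Q_meas.const_mul _) density_le
    _ = ENNReal.ofReal (f₀ r) * ∫⁻ c in Prod.mk r ⁻¹' B, _ ∂(Measure.pi fun _ => markerMeasure) :=
        lintegral_const_mul _ startJac_Q_meas
    _ ≤ ENNReal.ofReal (f₀ r) * ∫⁻ y, Q y ∂(Measure.pi fun _ => volume) :=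
        mul_le_mul_right ((lintegral_mono_set fun c hc => (hBc (r, c) hc).firstContacts).trans
          (setLIntegral_startMap_le hε hε2 t r Q_meas)) _
    _ = _ := by
        rw [← lintegral_q]
        exact congrArg _ (lintegral_pi_withDensity volume g_meas q_meas).symm

theorem setLIntegral_labelledDensity_le (hf : Measurable f₀) (hg : Measurable g₀) (ht : 0 ≤ t)
    (hε : 0 < ε) (hε2 : ε < 1 / 2) (hp : Function.Injective p) (hB : MeasurableSet B)
    (hBc : ∀ x ∈ B, IsClean ε t ⟨n, x⟩) :
    ∫⁻ x in B, labelledDensity f₀ g₀ N ε t ⟨n, x⟩ ∂(treeMeasureN n)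
      ≤ configLaw f₀ g₀ N (historyEvent ε t p B) := by
  have hE := measurableSet_historyEvent (t := t) hε hε2 p hB
  rw [configLaw_eq_prod_bgMeasure, Measure.prod_apply hE,
    lintegral_withDensity_eq_lintegral_mul _ hf.ennreal_ofReal (measurable_measure_prodMk_left hE),
    ← lintegral_indicator hB,
    lintegral_prod _ ((measurable_labelledDensity hf hg N ε t n).indicator hB).aemeasurable]
  exact lintegral_mono fun r => (lintegral_indicator (measurable_prodMk_left hB) _).trans_le
    (setLIntegral_labelledDensity_le_of_root hg ht hε hε2 hp hB hBc r)

end LabelledDensity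

theorem le_rnDeriv_of_withDensity_le {α : Type*} [MeasurableSpace α] {μ ν : Measure α}
    [SigmaFinite ν] [μ.HaveLebesgueDecomposition ν] {h : α → ENNReal} (hm : Measurable h)
    (hle : ν.withDensity h ≤ μ) : ∀ᵐ x ∂ν, h x ≤ μ.rnDeriv ν x := by
  refine ae_le_of_forall_setLIntegral_le_of_sigmaFinite hm fun s hs _ => ?_
  obtain ⟨S, hS, singularPart_null, compl_null⟩ := Measure.mutuallySingular_singularPart μ ν
  have inter_ae_eq : (s ∩ S : Set α) =ᵐ[ν] s :=
    inter_ae_eq_left_of_ae_eq_univ (ae_eq_univ.2 compl_null)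
  calc ∫⁻ x in s, h x ∂ν = ν.withDensity h (s ∩ S) := by
        rw [withDensity_apply _ (hs.inter hS), setLIntegral_congr inter_ae_eq]
    _ ≤ μ (s ∩ S) := hle _
    _ = ν.withDensity (μ.rnDeriv ν) (s ∩ S) := by
        conv_lhs => rw [μ.haveLebesgueDecomposition_add ν]
        rw [Measure.add_apply, measure_mono_null inter_subset_right singularPart_null, zero_add]
    _ ≤ ∫⁻ x in s, μ.rnDeriv ν x ∂ν :=
        (withDensity_apply _ (hs.inter hS)).trans_le (lintegral_mono_set inter_subset_left)

theorem treeMeasure_eq_sum : treeMeasure = Measure.sum fun n : ℕ =>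
    Measure.map (Sigma.mk n) (treeMeasureN n) := rfl

theorem lintegral_treeMeasure {F : CollisionTree → ENNReal} (hF : Measurable F) :
    ∫⁻ Φ, F Φ ∂treeMeasure = ∑' n : ℕ, ∫⁻ x, F ⟨n, x⟩ ∂(treeMeasureN n) := by
  rw [treeMeasure_eq_sum, lintegral_sum_measure]
  exact tsum_congr fun n => lintegral_map hF (measurable_sigmaMk n)

theorem treeMeasure_apply {A : Set CollisionTree} (hA : MeasurableSet A) :
    treeMeasure A = ∑' n : ℕ, treeMeasureN n {x | ⟨n, x⟩ ∈ A} := by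
  rw [treeMeasure_eq_sum, Measure.sum_apply _ hA]
  exact tsum_congr fun n => Measure.map_apply (measurable_sigmaMk n) hA

instance : SigmaFinite treeMeasure := by
  set S : ℕ → Set CollisionTree := fun k =>
    {Φ | Φ.1 ≤ k ∧ Φ.2 ∈ spanningSets (treeMeasureN Φ.1) k}
  have S_meas (k) : MeasurableSet (S k) := measurableSet_sigma_iff.2 fun n =>
    (MeasurableSet.const (n ≤ k)).inter (measurableSet_spanningSets (treeMeasureN n) k)
  refine ⟨⟨⟨S, fun _ => trivial, fun k => ?_, ?_⟩⟩⟩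
  · rw [treeMeasure_apply (S_meas k), tsum_eq_sum (s := Finset.range (k + 1))]
    · exact ENNReal.sum_lt_top.2 fun n _ => (measure_mono fun x hx => hx.2).trans_lt
        (measure_spanningSets_lt_top (treeMeasureN n) k)
    · intro n hn
      refine measure_mono_null (fun x hx => ?_) measure_empty
      exact hn (Finset.mem_range_succ_iff.2 hx.1)
  · refine eq_univ_of_forall fun Φ => ?_
    obtain ⟨k, hk⟩ := mem_iUnion.1 (iUnion_spanningSets (treeMeasureN Φ.1) ▸ mem_univ Φ.2)
    exact mem_iUnion.2 ⟨max k Φ.1, le_max_right _ _,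
      monotone_spanningSets _ (le_max_left _ _) hk⟩

theorem card_filter_injective (n N : ℕ) :
    (Finset.univ.filter fun p : Fin n → Fin N => Function.Injective p).card
      = N.descFactorial n := by
  rw [← Fintype.card_subtype,
    Fintype.card_congr (Equiv.subtypeInjectiveEquivEmbedding (Fin n) (Fin N)),
    Fintype.card_embedding_eq, Fintype.card_fin, Fintype.card_fin]

section RnDeriv

variable {f₀ : Torus × Vel → ℝ} {g₀ : Vel → ℝ} {N : ℕ} {ε t : ℝ}

theorem setLIntegral_descFactorial_mul_labelledDensity_le (hf : Measurable f₀)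
    (hg : Measurable g₀) (ht : 0 ≤ t) (hε : 0 < ε) (hε2 : ε < 1 / 2) {A : Set CollisionTree}
    (hA : MeasurableSet A) (hAc : ∀ Φ ∈ A, IsClean ε t Φ) (n : ℕ) :
    ∫⁻ x in {x | ⟨n, x⟩ ∈ A}, N.descFactorial n * labelledDensity f₀ g₀ N ε t ⟨n, x⟩
        ∂(treeMeasureN n)
      ≤ empiricalLaw f₀ g₀ N ε t A := by
  rw [lintegral_const_mul _ (measurable_labelledDensity hf hg N ε t n), ← card_filter_injective,
    ← nsmul_eq_mul]
  refine (Finset.card_nsmul_le_sum _ _ _ fun p hp => ?_).trans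
    (sum_historyEvent_le_empiricalLaw hε hε2 f₀ g₀ hA _)
  exact setLIntegral_labelledDensity_le hf hg ht hε hε2 (Finset.mem_filter.1 hp).2
    (measurableSet_sigma_iff.1 hA n) fun x hx => hAc _ hx

theorem measurableSet_setOf_isClean (ε t : ℝ) : MeasurableSet {Φ | IsClean ε t Φ} :=
  measurableSet_sigma_iff.2 (measurableSet_isClean ε t)

theorem measurable_descFactorial_mul_labelledDensity (hf : Measurable f₀) (hg : Measurable g₀)
    (N : ℕ) (ε t : ℝ) : Measurable fun Φ : CollisionTree =>
      (N.descFactorial (numColl Φ) : ENNReal) * labelledDensity f₀ g₀ N ε t Φ :=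
  fun _ hs => measurableSet_sigma_iff.2 fun n =>
    (measurable_labelledDensity hf hg N ε t n).const_mul (N.descFactorial n : ENNReal) hs

theorem withDensity_labelledDensity_le (hf : Measurable f₀) (hg : Measurable g₀) (ht : 0 ≤ t)
    (hε : 0 < ε) (hε2 : ε < 1 / 2) :
    treeMeasure.withDensity ({Φ | IsClean ε t Φ}.indicator fun Φ =>
        N.descFactorial (numColl Φ) * labelledDensity f₀ g₀ N ε t Φ)
      ≤ empiricalLaw f₀ g₀ N ε t := by
  refine Measure.le_iff.2 fun A hA => ?_
  have hC := measurableSet_setOf_isClean ε t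
  set F : ℕ → Set CollisionTree := fun n => {Φ | IsClean ε t Φ} ∩ A ∩ {Φ | numColl Φ = n}
  have F_meas (n) : MeasurableSet (F n) :=
    (hC.inter hA).inter (measurableSet_sigma_iff.2 fun m => .const (m = n))
  have F_disjoint : Pairwise (Function.onFun Disjoint F) := fun n m hnm =>
    Set.disjoint_left.2 fun Φ hn hm => hnm (hn.2.symm.trans hm.2)
  rw [withDensity_apply _ hA, setLIntegral_indicator hC, ← lintegral_indicator (hC.inter hA),
    lintegral_treeMeasure
      ((measurable_descFactorial_mul_labelledDensity hf hg N ε t).indicator (hC.inter hA))]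
  calc _ ≤ ∑' n, empiricalLaw f₀ g₀ N ε t (F n) := ENNReal.tsum_le_tsum fun n => ?_
    _ ≤ empiricalLaw f₀ g₀ N ε t (⋃ n, F n) :=
        tsum_meas_le_meas_iUnion_of_disjoint _ F_meas F_disjoint
    _ ≤ _ := measure_mono (iUnion_subset fun n Φ hΦ => hΦ.1.2)
  refine (lintegral_indicator (measurableSet_sigma_iff.1 (hC.inter hA) n) _).trans_le ?_
  have preimage_subset : {x | (⟨n, x⟩ : CollisionTree) ∈ {Φ | IsClean ε t Φ} ∩ A}
      ⊆ {x | ⟨n, x⟩ ∈ F n} := fun x hx => ⟨hx, rfl⟩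
  exact (lintegral_mono_set preimage_subset).trans
    (setLIntegral_descFactorial_mul_labelledDensity_le hf hg ht hε hε2 (F_meas n)
      (fun Φ hΦ => hΦ.1.1) n)

theorem ae_labelledDensity_le_rnDeriv (hf : Measurable f₀) (hg : Measurable g₀) (ht : 0 ≤ t)
    (hε : 0 < ε) (hε2 : ε < 1 / 2) :
    ∀ᵐ Φ ∂treeMeasure, IsClean ε t Φ →
      N.descFactorial (numColl Φ) * labelledDensity f₀ g₀ N ε t Φ
        ≤ (empiricalLaw f₀ g₀ N ε t).rnDeriv treeMeasure Φ := by
  have : SFinite (empiricalLaw f₀ g₀ N ε t) := by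
    rw [empiricalLaw, configLaw_eq_prod_bgMeasure]
    infer_instance
  filter_upwards [le_rnDeriv_of_withDensity_le
    ((measurable_descFactorial_mul_labelledDensity hf hg N ε t).indicator
      (measurableSet_setOf_isClean ε t))
    (withDensity_labelledDensity_le hf hg ht hε hε2)] with Φ hle hΦ
  rwa [indicator_of_mem (show Φ ∈ {Φ | IsClean ε t Φ} from hΦ)] at hle

end RnDeriv

theorem volume_torusDist_preimage_le {S : Set ℝ} (hS : MeasurableSet S) (x : Torus) :
    volume (torusDist x ⁻¹' S) ≤ volume {z : Vel | ‖z‖ ∈ S} := by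
  have dist_cont : Continuous (torusDist 0) := continuous_torusDist continuous_const continuous_id
  have translate : torusDist x ⁻¹' S = (fun y => y + -x) ⁻¹' (torusDist 0 ⁻¹' S) := by
    ext y
    simp only [mem_preimage, torusDist_congr (show x - y = 0 - (y + -x) by abel)]
  rw [translate, measure_preimage_add_right]
  refine volume_torus_le (dist_cont.measurable hS) fun y hy => ?_
  obtain ⟨z, norm_z, hz⟩ := exists_norm_eq_torusDist y 0
  exact ⟨z, by rwa [mem_ofPred_eq, norm_z, torusDist_comm], by rw [← hz, sub_zero]⟩

theorem volume_torus_closedBall_le {ε : ℝ} (hε : 0 ≤ ε) (x : Torus) :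
    volume {y | torusDist x y ≤ ε} ≤ ENNReal.ofReal (4 / 3 * Real.pi * ε ^ 3) := by
  have volume_ball : volume {z : Vel | ‖z‖ ≤ ε} = ENNReal.ofReal (4 / 3 * Real.pi * ε ^ 3) := by
    have ball_eq : {z : Vel | ‖z‖ ≤ ε} = Metric.closedBall 0 ε := by
      ext z
      exact mem_closedBall_zero_iff.symm
    rw [ball_eq, EuclideanSpace.volume_closedBall_fin_three, ← ENNReal.ofReal_pow hε,
      ← ENNReal.ofReal_mul (by positivity)]
    ring_nf
  exact (volume_torusDist_preimage_le measurableSet_Iic x).trans_eq volume_ball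

theorem volume_torus_swept_le {ε : ℝ} (hε : 0 < ε) (w : Vel) (δ : ℝ) :
    volume {x : Torus | (∃ s ∈ Icc 0 δ, torusDist (toTorus (s • w)) x ≤ ε) ∧ ε < torusDist 0 x}
      ≤ ENNReal.ofReal (ε ^ 2) * (ENNReal.ofReal δ * flux volume w) := by
  have contact_closed : IsClosed {x : Torus | ∃ s ∈ Icc 0 δ, torusDist (toTorus (s • w)) x ≤ ε} :=
    isClosed_exists_mem_Icc (isClosed_le (continuous_torusDist
      (continuous_toTorus.comp (continuous_snd.smul continuous_const)) continuous_fst)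
      continuous_const)
  have outside_open : IsOpen {x : Torus | ε < torusDist 0 x} :=
    isOpen_lt continuous_const (continuous_torusDist continuous_const continuous_id)
  rw [← finrank_vel_sub_one]
  refine (volume_torus_le (contact_closed.measurableSet.inter outside_open.measurableSet) ?_).trans
    (volume_swept_le volume w hε)
  rintro x ⟨⟨s, hs, contact⟩, outside⟩
  obtain ⟨z, norm_z, hz⟩ := exists_norm_eq_torusDist x (toTorus (s • w))
  have toTorus_lift : toTorus (z + s • w) = x := by rw [toTorus_add, ← hz, sub_add_cancel]
  refine ⟨z + s • w, ⟨s, hs, ?_, ?_⟩, toTorus_lift⟩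
  · rwa [add_sub_cancel_right, norm_z, torusDist_comm]
  · exact lt_of_lt_of_le outside
      ((torusDist_comm 0 x).trans_le (torusDist_le_norm (by rw [sub_zero, toTorus_lift])))

theorem volume_newContact_le {ε : ℝ} (hε : 0 < ε) (a : Torus) (v u : Vel) (t₁ t₂ : ℝ) :
    volume {x : Torus |
        (∃ s ∈ Icc t₁ t₂, torusDist (a + toTorus (s • v)) (x + toTorus (s • u)) ≤ ε) ∧
        ε < torusDist (a + toTorus (t₁ • v)) (x + toTorus (t₁ • u))}
      ≤ ENNReal.ofReal (ε ^ 2) * (ENNReal.ofReal (t₂ - t₁) * flux volume (v - u)) := by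
  set b : Torus := a + toTorus (t₁ • v) - toTorus (t₁ • u)
  have dist_eq (s : ℝ) (x : Torus) : torusDist (a + toTorus (s • v)) (x + toTorus (s • u))
      = torusDist (toTorus ((s - t₁) • (v - u))) (x + -b) := by
    refine torusDist_congr ?_
    simp only [b, sub_smul, smul_sub, toTorus_sub]
    abel
  refine le_trans ?_ ((measure_preimage_add_right volume (-b) _).trans_le
    (volume_torus_swept_le hε (v - u) (t₂ - t₁)))
  refine measure_mono fun x ⟨⟨s, hs, contact⟩, outside⟩ =>
    ⟨⟨s - t₁, ⟨sub_nonneg.2 hs.1, sub_le_sub_right hs.2 t₁⟩,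
      (dist_eq s x).symm.trans_le contact⟩, ?_⟩
  rwa [dist_eq, sub_self, zero_smul, toTorus_zero] at outside

theorem finite_range_vel (Φ : CollisionTree) : (range (vel Φ)).Finite := by
  refine ((finite_Iic (numColl Φ)).image (velAfter Φ)).subset ?_
  rintro _ ⟨s, rfl⟩
  exact ⟨_, (Finset.card_le_univ _).trans_eq (Fintype.card_fin _), rfl⟩

theorem measurable_vel (Φ : CollisionTree) : Measurable (vel Φ) := by
  have card_meas : Measurable fun s => (Finset.univ.filter fun j => collTime Φ j ≤ s).card := by
    simp only [Finset.card_filter]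
    exact Finset.measurable_fun_sum _ fun j _ =>
      .ite measurableSet_Ici measurable_const measurable_const
  exact measurable_from_top.comp card_meas

/-- The occupation measure of the velocity of the tagged particle: the time in `[0, t]` that it
spends with a velocity in a given set. -/
noncomputable def occupation (Φ : CollisionTree) (t : ℝ) : Measure Vel :=
  (volume.restrict (Ico 0 t)).map (vel Φ)

instance (Φ : CollisionTree) (t : ℝ) : IsFiniteMeasure (occupation Φ t) :=
  Measure.isFiniteMeasure_map _ _

theorem occupation_univ (Φ : CollisionTree) (t : ℝ) :
    occupation Φ t univ = ENNReal.ofReal t := by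
  rw [occupation, Measure.map_apply (measurable_vel Φ) .univ, preimage_univ,
    Measure.restrict_apply_univ, Real.volume_Ico, sub_zero]

theorem integrable_occupation {F : Vel → ℝ} (hF : Measurable F) (Φ : CollisionTree) (t : ℝ) :
    Integrable F (occupation Φ t) := by
  obtain ⟨C, hC⟩ := ((finite_range_vel Φ).image fun v => ‖F v‖).bddAbove
  refine .of_bound hF.aestronglyMeasurable C ((ae_map_iff (measurable_vel Φ).aemeasurable
    (measurableSet_le hF.norm measurable_const)).2 (.of_forall fun s => ?_))
  exact hC ⟨_, ⟨s, rfl⟩, rfl⟩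

theorem occupation_of_numColl_eq_zero {Φ : CollisionTree} (h : numColl Φ = 0) (t : ℝ) :
    occupation Φ t = ENNReal.ofReal t • Measure.dirac (rootVel Φ) := by
  have vel_eq : vel Φ = fun _ => rootVel Φ := by
    have : IsEmpty (Fin (numColl Φ)) := h ▸ Fin.isEmpty
    funext s
    rw [vel, Finset.univ_eq_empty, Finset.filter_empty, Finset.card_empty, velAfter]
  rw [occupation, vel_eq, Measure.map_const, Measure.restrict_apply_univ, Real.volume_Ico, sub_zero]

section AddMarker

variable {Φ : CollisionTree} {m : Marker} {t : ℝ}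

theorem IsTree.init_of_addMarker (h : IsTree t (addMarker Φ m)) : IsTree m.1 Φ :=
  ⟨fun j => ⟨(h.of_addMarker.1 j).1, (h.collTime_lt_of_addMarker j).le⟩, h.of_addMarker.2⟩

theorem vel_addMarker_of_lt {s : ℝ} (hs : s < m.1) : vel (addMarker Φ m) s = vel Φ s := by
  have card_eq : (Finset.univ.filter fun j => collTime (addMarker Φ m) j ≤ s).card
      = (Finset.univ.filter fun j => collTime Φ j ≤ s).card := by
    simp only [Finset.card_filter, Fin.sum_univ_castSucc, collTime_addMarker_castSucc,
      collTime_addMarker_last, hs.not_ge, if_false, add_zero]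
  rw [vel, card_eq, velAfter_addMarker ((Finset.card_le_univ _).trans_eq (Fintype.card_fin _)), vel]

theorem vel_of_forall_collTime_le {s : ℝ} (h : ∀ j, collTime Φ j ≤ s) :
    vel Φ s = velAfter Φ (numColl Φ) := by
  simp [vel, h]

theorem collTime_addMarker_le (h : IsTree t (addMarker Φ m)) (j : Fin (numColl Φ + 1)) :
    collTime (addMarker Φ m) j ≤ m.1 :=
  (h.2.monotone (Fin.le_last j)).trans_eq collTime_addMarker_last

theorem occupation_addMarker (h : IsTree t (addMarker Φ m)) : occupation (addMarker Φ m) t =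
    occupation Φ m.1 +
      ENNReal.ofReal (t - m.1) • Measure.dirac (velAfter (addMarker Φ m) (numColl Φ + 1)) := by
  obtain ⟨time_pos, time_le⟩ := h.time_mem_of_addMarker
  have before : (volume.restrict (Ico 0 m.1)).map (vel (addMarker Φ m)) = occupation Φ m.1 :=
    Measure.map_congr ((ae_restrict_mem measurableSet_Ico).mono fun s hs =>
      vel_addMarker_of_lt hs.2)
  have after : vel (addMarker Φ m) =ᵐ[volume.restrict (Ico m.1 t)]
      fun _ => velAfter (addMarker Φ m) (numColl Φ + 1) :=
    (ae_restrict_mem measurableSet_Ico).mono fun s hs =>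
      vel_of_forall_collTime_le fun j => (collTime_addMarker_le h j).trans hs.1
  rw [occupation, ← Ico_union_Ico_eq_Ico time_pos.le time_le,
    Measure.restrict_union Ico_disjoint_Ico_same measurableSet_Ico,
    Measure.map_add _ _ (measurable_vel _), before, Measure.map_congr after, Measure.map_const,
    Measure.restrict_apply_univ, Real.volume_Ico]

end AddMarker

@[elab_as_elim]
theorem addMarker_induction {P : CollisionTree → Prop} (root : ∀ r c, P ⟨0, (r, c)⟩)
    (snoc : ∀ Φ m, P Φ → P (addMarker Φ m)) : ∀ Φ, P Φ
  | ⟨0, (r, c)⟩ => root r c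
  | ⟨n + 1, (r, c)⟩ => by
    have h := snoc (treeOf r (Fin.init c)) (c (Fin.last n)) (addMarker_induction root snoc _)
    rwa [addMarker, Fin.snoc_init_self] at h

theorem measurable_flux : Measurable (flux (volume : Measure Vel)) := by
  have integrand_meas : Measurable fun q : Vel × Direction =>
      ENNReal.ofReal (max (inner ℝ (q.2 : Vel) q.1) 0) := by fun_prop
  exact integrand_meas.lintegral_prod_right'

theorem volume_contact_le {ε : ℝ} (hε : 0 < ε) (u : Vel) {t : ℝ} {Φ : CollisionTree}
    (h : IsTree t Φ) :
    volume {x : Torus | ∃ s ∈ Icc 0 t, torusDist (pos Φ s) (x + toTorus (s • u)) ≤ ε}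
      ≤ ENNReal.ofReal (4 / 3 * Real.pi * ε ^ 3) +
        ENNReal.ofReal (ε ^ 2) * ∫⁻ v, flux volume (v - u) ∂occupation Φ t := by
  induction Φ using addMarker_induction generalizing t with
  | root r c =>
    have pos_eq (s : ℝ) : pos ⟨0, (r, c)⟩ s = r.1 + toTorus (s • r.2) := by
      simp [pos, rootPos, rootVel]
    have met_later := volume_newContact_le hε r.1 r.2 u 0 t
    rw [occupation_of_numColl_eq_zero rfl, lintegral_smul_measure, lintegral_dirac]
    rw [sub_zero] at met_later
    refine (measure_mono ?_).trans ((measure_union_le _ _).trans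
      (add_le_add (volume_torus_closedBall_le hε.le r.1) met_later))
    rintro x ⟨s, hs, contact⟩
    refine or_iff_not_imp_left.2 fun outside => ⟨⟨s, hs, by rwa [← pos_eq]⟩, ?_⟩
    simpa [toTorus_zero] using outside
  | snoc Φ m ih =>
    have time_pos : 0 < m.1 := h.time_mem_of_addMarker.1
    have pos_eq {s : ℝ} (hs : m.1 ≤ s) : pos (addMarker Φ m) s = flightBase (addMarker Φ m) +
        toTorus (s • velAfter (addMarker Φ m) (numColl Φ + 1)) :=
      pos_eq_flightBase fun j => (collTime_addMarker_le h j).trans hs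
    have met_later := volume_newContact_le hε (flightBase (addMarker Φ m))
      (velAfter (addMarker Φ m) (numColl Φ + 1)) u m.1 t
    rw [occupation_addMarker h, lintegral_add_measure, lintegral_smul_measure, lintegral_dirac,
      mul_add, ← add_assoc]
    refine (measure_mono ?_).trans ((measure_union_le _ _).trans
      (add_le_add (ih h.init_of_addMarker) met_later))
    rintro x ⟨s, hs, contact⟩
    refine or_iff_not_imp_left.2 fun not_met => ?_
    simp only [mem_ofPred_eq, not_exists, not_and, not_le] at not_met
    have time_lt : m.1 < s := lt_of_not_ge fun hsm =>
      (not_met s ⟨hs.1, hsm⟩).not_ge (by rwa [← pos_addMarker hsm])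
    refine ⟨⟨s, ⟨time_lt.le, hs.2⟩, by rwa [← pos_eq time_lt.le]⟩, ?_⟩
    rw [← pos_eq le_rfl, pos_addMarker le_rfl]
    exact not_met m.1 ⟨time_pos.le, le_rfl⟩

theorem bgMeasure_apply {g₀ : Vel → ℝ} (hg : Measurable g₀) {A : Set (Torus × Vel)}
    (hA : MeasurableSet A) :
    bgMeasure g₀ A = ∫⁻ u, ENNReal.ofReal (g₀ u) * volume {x | (x, u) ∈ A} := by
  have density_meas : Measurable fun p : Torus × Vel => ENNReal.ofReal (g₀ p.2) :=
    (hg.comp measurable_snd).ennreal_ofReal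
  rw [bgMeasure, withDensity_apply _ hA, ← lintegral_indicator hA]
  refine (lintegral_prod_symm _ (density_meas.indicator hA).aemeasurable).trans
    (lintegral_congr fun u => ?_)
  exact lintegral_indicator_const (measurable_prodMk_right (y := u) hA) (ENNReal.ofReal (g₀ u))

/-- The collision rate `rate g₀ v` with values in `[0, ∞]`, with the integral over the directions
inside. -/
noncomputable def lrate (g₀ : Vel → ℝ) (v : Vel) : ENNReal :=
  ∫⁻ u, ENNReal.ofReal (g₀ u) * flux volume (v - u)

theorem measurable_lrate_integrand {g₀ : Vel → ℝ} (hg : Measurable g₀) :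
    Measurable fun q : Vel × Vel => ENNReal.ofReal (g₀ q.2) * flux volume (q.1 - q.2) :=
  (hg.comp measurable_snd).ennreal_ofReal.mul (measurable_flux.comp measurable_sub)

theorem measurable_lrate {g₀ : Vel → ℝ} (hg : Measurable g₀) : Measurable (lrate g₀) :=
  (measurable_lrate_integrand hg).lintegral_prod_right'

theorem bgMeasure_compl_survivalSet_le {g₀ : Vel → ℝ} (hg : Measurable g₀)
    (hg1 : ∫⁻ u, ENNReal.ofReal (g₀ u) = 1) {ε : ℝ} (hε : 0 < ε) {t : ℝ} {Φ : CollisionTree}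
    (h : IsTree t Φ) :
    bgMeasure g₀ (survivalSet ε t Φ)ᶜ ≤ ENNReal.ofReal (4 / 3 * Real.pi * ε ^ 3) +
      ENNReal.ofReal (ε ^ 2) * ∫⁻ v, lrate g₀ v ∂occupation Φ t := by
  have density_meas : Measurable fun u => ENNReal.ofReal (g₀ u) := hg.ennreal_ofReal
  have integrand_meas := measurable_lrate_integrand hg
  have swept_meas : Measurable fun u => ∫⁻ v, flux volume (v - u) ∂occupation Φ t :=
    (measurable_flux.comp (measurable_snd.sub measurable_fst)).lintegral_prod_right'
  have product_meas : Measurable fun u =>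
      ENNReal.ofReal (g₀ u) * ∫⁻ v, flux volume (v - u) ∂occupation Φ t :=
    density_meas.mul swept_meas
  have fiber_le (u : Vel) : volume {x | (x, u) ∈ (survivalSet ε t Φ)ᶜ} ≤
      ENNReal.ofReal (4 / 3 * Real.pi * ε ^ 3) +
        ENNReal.ofReal (ε ^ 2) * ∫⁻ v, flux volume (v - u) ∂occupation Φ t := by
    refine le_of_eq_of_le (congrArg volume ?_) (volume_contact_le hε u h)
    ext x
    simp [survivalSet, and_assoc]
  calc bgMeasure g₀ (survivalSet ε t Φ)ᶜ
      = ∫⁻ u, ENNReal.ofReal (g₀ u) * volume {x | (x, u) ∈ (survivalSet ε t Φ)ᶜ} :=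
        bgMeasure_apply hg (measurableSet_survivalSet ε t Φ).compl
    _ ≤ ∫⁻ u, (ENNReal.ofReal (4 / 3 * Real.pi * ε ^ 3) * ENNReal.ofReal (g₀ u) +
          ENNReal.ofReal (ε ^ 2) *
            (ENNReal.ofReal (g₀ u) * ∫⁻ v, flux volume (v - u) ∂occupation Φ t)) :=
        lintegral_mono fun u => (mul_le_mul_right (fiber_le u) _).trans_eq (by ring)
    _ = ENNReal.ofReal (4 / 3 * Real.pi * ε ^ 3) + ENNReal.ofReal (ε ^ 2) *
          ∫⁻ u, ENNReal.ofReal (g₀ u) * ∫⁻ v, flux volume (v - u) ∂occupation Φ t := by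
        rw [lintegral_add_left (density_meas.const_mul _), lintegral_const_mul _ density_meas,
          lintegral_const_mul _ product_meas, hg1, mul_one]
    _ = ENNReal.ofReal (4 / 3 * Real.pi * ε ^ 3) +
          ENNReal.ofReal (ε ^ 2) * ∫⁻ v, lrate g₀ v ∂occupation Φ t := by
        congr 2
        unfold lrate
        rw [lintegral_lintegral_swap integrand_meas.aemeasurable]
        exact lintegral_congr fun u =>
          (lintegral_const_mul _ (measurable_flux.comp (measurable_id.sub_const u))).symm

/-- Probability densities on velocity space with a finite first moment. -/
structure IsVelocityDensity (g₀ : Vel → ℝ) : Prop where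
  measurable : Measurable g₀
  nonneg : ∀ v, 0 ≤ g₀ v
  integral_eq_one : ∫ v, g₀ v = 1
  integrable_mul_norm : Integrable fun v => g₀ v * ‖v‖

theorem max_inner_le (v u : Vel) (ν : Direction) :
    max (inner ℝ (v - u) (ν : Vel)) 0 ≤ ‖v‖ + ‖u‖ := by
  refine max_le ((real_inner_le_norm _ _).trans ?_) (by positivity)
  rw [norm_eq_of_mem_sphere, mul_one]
  exact norm_sub_le _ _

namespace IsVelocityDensity

variable {g₀ : Vel → ℝ}

theorem integrable (h : IsVelocityDensity g₀) : Integrable g₀ :=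
  .of_integral_ne_zero (by rw [h.integral_eq_one]; exact one_ne_zero)

theorem lintegral_eq_one (h : IsVelocityDensity g₀) : ∫⁻ u, ENNReal.ofReal (g₀ u) = 1 := by
  rw [← ofReal_integral_eq_lintegral_ofReal h.integrable (.of_forall h.nonneg), h.integral_eq_one,
    ENNReal.ofReal_one]

theorem integrable_mul_add_norm (h : IsVelocityDensity g₀) (a : ℝ) :
    Integrable fun u => g₀ u * (a + ‖u‖) := by
  simp only [mul_add]
  exact (h.integrable.mul_const a).add h.integrable_mul_norm

theorem integrable_mul_max_inner (h : IsVelocityDensity g₀) (v : Vel) :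
    Integrable (fun p : Direction × Vel => g₀ p.2 * max (inner ℝ (v - p.2) (p.1 : Vel)) 0)
      (sphereMeasure.prod volume) := by
  have dominating := (integrable_const (μ := sphereMeasure) (1 : ℝ)).mul_prod
    (h.integrable_mul_add_norm ‖v‖)
  have integrand_meas : Measurable fun p : Direction × Vel =>
      g₀ p.2 * max (inner ℝ (v - p.2) (p.1 : Vel)) 0 :=
    (h.measurable.comp measurable_snd).mul (by fun_prop)
  refine dominating.mono' integrand_meas.aestronglyMeasurable (.of_forall fun p => ?_)
  have := h.nonneg p.2
  rw [Real.norm_of_nonneg (by positivity), one_mul]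
  gcongr
  exact max_inner_le _ _ _

theorem ofReal_rate (h : IsVelocityDensity g₀) (v : Vel) :
    ENNReal.ofReal (rate g₀ v) = lrate g₀ v := by
  have integrable := h.integrable_mul_max_inner v
  have integrand_nonneg (p : Direction × Vel) :
      0 ≤ g₀ p.2 * max (inner ℝ (v - p.2) (p.1 : Vel)) 0 :=
    mul_nonneg (h.nonneg p.2) (le_max_right _ _)
  have rate_eq : rate g₀ v = ∫ p : Direction × Vel, g₀ p.2 *
      max (inner ℝ (v - p.2) (p.1 : Vel)) 0 ∂(sphereMeasure.prod volume) :=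
    (integral_prod _ integrable).symm
  rw [rate_eq, ofReal_integral_eq_lintegral_ofReal integrable (.of_forall integrand_nonneg)]
  refine (lintegral_prod_symm _ integrable.aemeasurable.ennreal_ofReal).trans
    (lintegral_congr fun u => ?_)
  rw [flux, ← sphereMeasure, ← lintegral_const_mul _ (by fun_prop)]
  refine lintegral_congr fun ν => ?_
  rw [ENNReal.ofReal_mul (h.nonneg u), real_inner_comm]

theorem rate_nonneg (h : IsVelocityDensity g₀) (v : Vel) : 0 ≤ rate g₀ v :=
  integral_nonneg fun _ => integral_nonneg fun u => mul_nonneg (h.nonneg u) (le_max_right _ _)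

theorem measurable_rate (h : IsVelocityDensity g₀) : Measurable (rate g₀) := by
  have rate_eq : rate g₀ = fun v => (lrate g₀ v).toReal := by
    funext v
    rw [← h.ofReal_rate, ENNReal.toReal_ofReal (h.rate_nonneg v)]
  exact rate_eq ▸ (measurable_lrate h.measurable).ennreal_toReal

theorem exists_rate_le (h : IsVelocityDensity g₀) :
    ∃ K : ℝ, 0 ≤ K ∧ ∀ v, rate g₀ v ≤ K * (1 + ‖v‖) := by
  set m := ∫ u, g₀ u * (1 + ‖u‖) with hm
  have m_nonneg : 0 ≤ m := integral_nonneg fun u => mul_nonneg (h.nonneg u) (by positivity)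
  refine ⟨m * sphereMeasure.real univ, by positivity, fun v => ?_⟩
  have inner_integral_le (ν : Direction) :
      ‖∫ u : Vel, g₀ u * max (inner ℝ (v - u) (ν : Vel)) 0‖ ≤ m * (1 + ‖v‖) := by
    have integrand_nonneg (u : Vel) : 0 ≤ g₀ u * max (inner ℝ (v - u) (ν : Vel)) 0 :=
      mul_nonneg (h.nonneg u) (le_max_right _ _)
    rw [Real.norm_of_nonneg (integral_nonneg integrand_nonneg), hm, ← integral_mul_const]
    refine integral_mono_of_nonneg (.of_forall integrand_nonneg)
      ((h.integrable_mul_add_norm 1).mul_const _) (.of_forall fun u => ?_)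
    refine (mul_le_mul_of_nonneg_left ((max_inner_le v u ν).trans ?_) (h.nonneg u)).trans_eq
      (mul_assoc _ _ _).symm
    nlinarith [norm_nonneg u, norm_nonneg v]
  calc rate g₀ v ≤ ‖rate g₀ v‖ := le_abs_self _
    _ ≤ m * (1 + ‖v‖) * sphereMeasure.real univ :=
      norm_integral_le_of_norm_le_const (.of_forall inner_integral_le)
    _ = m * sphereMeasure.real univ * (1 + ‖v‖) := by ring

end IsVelocityDensity

theorem bddAbove_range_comp_vel (F : Vel → ℝ) (Φ : CollisionTree) {ι : Type*} (s : ι → ℝ) :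
    BddAbove (range fun i => F (vel Φ (s i))) := by
  refine ((finite_range_vel Φ).image F).bddAbove.mono ?_
  rintro _ ⟨i, rfl⟩
  exact ⟨_, ⟨s i, rfl⟩, rfl⟩

theorem two_mul_rate_vel_le_maxRate (g₀ : Vel → ℝ) {T s : ℝ} (hs : s ∈ Icc 0 T)
    (Φ : CollisionTree) : 2 * rate g₀ (vel Φ s) ≤ maxRate g₀ T Φ :=
  mul_le_mul_of_nonneg_left
    (le_ciSup (bddAbove_range_comp_vel (rate g₀) Φ fun s : Icc (0 : ℝ) T => (s : ℝ)) ⟨s, hs⟩)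
    zero_le_two

theorem maxRate_nonneg {g₀ : Vel → ℝ} (h : IsVelocityDensity g₀) (T : ℝ) (Φ : CollisionTree) :
    0 ≤ maxRate g₀ T Φ :=
  mul_nonneg zero_le_two (Real.iSup_nonneg fun _ => h.rate_nonneg _)

/-- The integral of the collision rate along the trajectory up to time `t`. -/
noncomputable def exposure (g₀ : Vel → ℝ) (t : ℝ) (Φ : CollisionTree) : ℝ :=
  ∫ v, rate g₀ v ∂occupation Φ t

section Exposure

variable {g₀ : Vel → ℝ} {t : ℝ} {Φ : CollisionTree}

theorem exposure_nonneg (h : IsVelocityDensity g₀) (t : ℝ) (Φ : CollisionTree) :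
    0 ≤ exposure g₀ t Φ :=
  integral_nonneg h.rate_nonneg

theorem lintegral_lrate_occupation (h : IsVelocityDensity g₀) (t : ℝ) (Φ : CollisionTree) :
    ∫⁻ v, lrate g₀ v ∂occupation Φ t = ENNReal.ofReal (exposure g₀ t Φ) := by
  rw [exposure, ofReal_integral_eq_lintegral_ofReal (integrable_occupation h.measurable_rate Φ t)
    (.of_forall h.rate_nonneg)]
  exact lintegral_congr fun v => (h.ofReal_rate v).symm

theorem exposure_of_numColl_eq_zero (g₀ : Vel → ℝ) (ht : 0 ≤ t) (h : numColl Φ = 0) :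
    exposure g₀ t Φ = t * rate g₀ (rootVel Φ) := by
  rw [exposure, occupation_of_numColl_eq_zero h, integral_smul_measure, integral_dirac,
    ENNReal.toReal_ofReal ht, smul_eq_mul]

theorem exposure_addMarker (hg : IsVelocityDensity g₀) {m : Marker}
    (h : IsTree t (addMarker Φ m)) : exposure g₀ t (addMarker Φ m) =
      exposure g₀ m.1 Φ + (t - m.1) * rate g₀ (velAfter (addMarker Φ m) (numColl Φ + 1)) := by
  have hF := hg.measurable_rate
  rw [exposure, occupation_addMarker h, integral_add_measure (integrable_occupation hF _ _)
    ((integrable_dirac (by finiteness)).smul_measure ENNReal.ofReal_ne_top),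
    integral_smul_measure, integral_dirac,
    ENNReal.toReal_ofReal (sub_nonneg.2 h.time_mem_of_addMarker.2), smul_eq_mul, exposure]

theorem exposure_le (hg : IsVelocityDensity g₀) (ht : 0 ≤ t) {R : ℝ}
    (hR : ∀ s ∈ Ico 0 t, rate g₀ (vel Φ s) ≤ R) : exposure g₀ t Φ ≤ t * R := by
  have rate_le : ∀ᵐ v ∂occupation Φ t, rate g₀ v ≤ R :=
    (ae_map_iff (measurable_vel Φ).aemeasurable
      (measurableSet_le hg.measurable_rate measurable_const)).2
        ((ae_restrict_mem measurableSet_Ico).mono hR)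
  calc exposure g₀ t Φ ≤ ∫ _, R ∂occupation Φ t :=
        integral_mono_ae (integrable_occupation hg.measurable_rate Φ t) (integrable_const R) rate_le
    _ = t * R := by
        rw [integral_const, measureReal_def, occupation_univ, ENNReal.toReal_ofReal ht, smul_eq_mul]

end Exposure

/-- The product of the densities of the collisions of a tree, without the factors for the free
flights in between. -/
noncomputable def collisionWeight (g₀ : Vel → ℝ) (Φ : CollisionTree) : ℝ :=
  ∏ j, g₀ (collVel Φ j) * max (normalSpeed Φ j) 0

theorem collisionWeight_nonneg {g₀ : Vel → ℝ} (hg : ∀ v, 0 ≤ g₀ v) (Φ : CollisionTree) :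
    0 ≤ collisionWeight g₀ Φ :=
  Finset.prod_nonneg fun _ _ => mul_nonneg (hg _) (le_max_right _ _)

theorem collisionWeight_addMarker (g₀ : Vel → ℝ) (Φ : CollisionTree) (m : Marker) :
    collisionWeight g₀ (addMarker Φ m) = collisionWeight g₀ Φ *
      (g₀ m.2.2 * max (normalSpeed (addMarker Φ m) (Fin.last _)) 0) := by
  simp only [collisionWeight, Fin.prod_univ_castSucc, collVel_addMarker_castSucc,
    normalSpeed_addMarker_castSucc, collVel_addMarker_last]

section IdealDensity

variable {f₀ : Torus × Vel → ℝ} {g₀ : Vel → ℝ} {t : ℝ} {Φ : CollisionTree}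

theorem idealDensity_addMarker {m : Marker} (h : IsTree t (addMarker Φ m)) :
    idealDensity f₀ g₀ t (addMarker Φ m) =
      Real.exp (-((t - m.1) * rate g₀ (velAfter (addMarker Φ m) (numColl Φ + 1)))) *
        idealDensity f₀ g₀ m.1 Φ *
        (g₀ m.2.2 * max (normalSpeed (addMarker Φ m) (Fin.last _)) 0) := by
  have time_eq := collTime_addMarker_last (Φ := Φ) (m := m)
  have vel_eq := vel_collTime h.2 (Fin.last _)
  have velBefore_eq := velBefore_collTime h.2 (Fin.last _)
  rw [time_eq, Fin.val_last] at vel_eq velBefore_eq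
  rw [velAfter_addMarker le_rfl] at velBefore_eq
  simp only [idealDensity, idealAux, addMarker, treeOf, Fin.snoc_last, Fin.init_snoc] at *
  rw [if_pos h.time_mem_of_addMarker.2, vel_eq, velBefore_eq, normalSpeed_addMarker_last,
    real_inner_comm, mul_assoc]

theorem idealDensity_eq (hg : IsVelocityDensity g₀) (ht : 0 ≤ t) (h : IsTree t Φ) :
    idealDensity f₀ g₀ t Φ =
      Real.exp (-exposure g₀ t Φ) * f₀ Φ.2.1 * collisionWeight g₀ Φ := by
  induction Φ using addMarker_induction generalizing t with
  | root r c =>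
    rw [exposure_of_numColl_eq_zero g₀ ht rfl]
    simp [idealDensity, idealAux, rootVel, collisionWeight]
  | snoc Φ m ih =>
    rw [idealDensity_addMarker h, ih h.time_mem_of_addMarker.1.le h.init_of_addMarker,
      exposure_addMarker hg h, collisionWeight_addMarker, neg_add, Real.exp_add]
    ring

theorem idealDensity_eq_zero {T : ℝ} (hΦ : IsTree T Φ) (h : ¬ IsTree t Φ) :
    idealDensity f₀ g₀ t Φ = 0 := by
  obtain ⟨_ | n, r, c⟩ := Φ
  · exact absurd ⟨fun j => j.elim0, hΦ.2⟩ h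
  · refine if_neg fun last_le => h ⟨fun j => ⟨(hΦ.1 j).1, ?_⟩, hΦ.2⟩
    exact (hΦ.2.monotone (Fin.le_last j)).trans last_le

end IdealDensity

theorem isProbabilityMeasure_bgMeasure {g₀ : Vel → ℝ} (hg : IsVelocityDensity g₀) :
    IsProbabilityMeasure (bgMeasure g₀) := by
  have volume_univ : volume (univ : Set Torus) = 1 := by
    rw [volume_pi, Measure.pi_univ]
    simp
  refine ⟨?_⟩
  simp [bgMeasure_apply hg.measurable .univ, volume_univ, hg.lintegral_eq_one]

theorem isFiniteMeasure_empiricalLaw {f₀ : Torus × Vel → ℝ} {g₀ : Vel → ℝ} (hf : Integrable f₀)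
    (hg : IsVelocityDensity g₀) (N : ℕ) (ε t : ℝ) :
    IsFiniteMeasure (empiricalLaw f₀ g₀ N ε t) := by
  have := isProbabilityMeasure_bgMeasure hg
  have := isFiniteMeasure_withDensity_ofReal hf.2
  rw [empiricalLaw, configLaw_eq_prod_bgMeasure]
  infer_instance

section HitProb

variable {g₀ : Vel → ℝ} {ε t : ℝ} {Φ : CollisionTree}

theorem continuous_torusDist_pos (Φ : CollisionTree) :
    Continuous fun q : (Torus × Vel) × ℝ =>
      torusDist (pos Φ q.2) (q.1.1 + toTorus (q.2 • q.1.2)) :=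
  continuous_torusDist (continuous_pos (continuous_const (y := Φ.2)) continuous_snd)
    (.add (by fun_prop) (continuous_toTorus.comp (by fun_prop)))

theorem measurableSet_avoidSet (ε t : ℝ) (Φ : CollisionTree) : MeasurableSet (avoidSet ε t Φ) := by
  convert measurableSet_forall_pos_imp_lt (continuous_torusDist_pos Φ)
    (G := fun q => min q.2 (t - q.2)) (by fun_prop) 0 t ε using 1
  ext p
  simp only [avoidSet, mem_ofPred_eq, lt_min_iff, sub_pos]
  exact ⟨fun h s _ hs => h s hs, fun h s hs => h s (Ioo_subset_Icc_self hs) hs⟩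

theorem volume_torus_sphere (hε : 0 < ε) (x : Torus) : volume {y | torusDist x y = ε} = 0 := by
  refine nonpos_iff_eq_zero.1
    ((volume_torusDist_preimage_le (measurableSet_singleton ε) x).trans_eq ?_)
  have sphere_eq : {z : Vel | ‖z‖ ∈ ({ε} : Set ℝ)} = Metric.sphere 0 ε := by
    ext z
    simp
  rw [sphere_eq, Measure.addHaar_sphere_of_ne_zero volume 0 hε.ne']

theorem bgMeasure_torusDist_pos_eq (hg : Measurable g₀) (hε : 0 < ε) (Φ : CollisionTree) (s : ℝ) :
    bgMeasure g₀ {p | torusDist (pos Φ s) (p.1 + toTorus (s • p.2)) = ε} = 0 := by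
  have contact_meas :
      MeasurableSet {p : Torus × Vel | torusDist (pos Φ s) (p.1 + toTorus (s • p.2)) = ε} :=
    (isClosed_eq ((continuous_torusDist_pos Φ).comp (continuous_id.prodMk continuous_const))
      continuous_const).measurableSet
  rw [bgMeasure_apply hg contact_meas]
  refine (lintegral_congr fun u => ?_).trans lintegral_zero
  have translate (x : Torus) : torusDist (pos Φ s) (x + toTorus (s • u)) =
      torusDist (pos Φ s - toTorus (s • u)) x := torusDist_congr (by abel)
  simp only [mem_ofPred_eq, translate, volume_torus_sphere hε, mul_zero]

theorem torusDist_eq_of_mem_avoidSet (ht : 0 < t) {p : Torus × Vel} (avoids : p ∈ avoidSet ε t Φ)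
    (hits : p ∉ survivalSet ε t Φ) :
    torusDist (pos Φ 0) (p.1 + toTorus ((0 : ℝ) • p.2)) = ε ∨
      torusDist (pos Φ t) (p.1 + toTorus (t • p.2)) = ε := by
  have dist_cont : Continuous fun s : ℝ => torusDist (pos Φ s) (p.1 + toTorus (s • p.2)) :=
    continuous_torusDist (continuous_pos (continuous_const (y := Φ.2)) continuous_id)
      (.add continuous_const (continuous_toTorus.comp (by fun_prop)))
  have le_dist : Icc 0 t ⊆ {s | ε ≤ torusDist (pos Φ s) (p.1 + toTorus (s • p.2))} := by
    rw [← closure_Ioo ht.ne]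
    exact closure_minimal (fun s hs => (avoids s hs).le) (isClosed_le continuous_const dist_cont)
  simp only [survivalSet, mem_ofPred_eq, not_forall, not_lt] at hits
  obtain ⟨s, hs, dist_le⟩ := hits
  have dist_eq := dist_le.antisymm (le_dist hs)
  rcases hs.1.eq_or_lt with rfl | s_pos
  · exact .inl dist_eq
  rcases hs.2.eq_or_lt with rfl | s_lt
  · exact .inr dist_eq
  · exact absurd (avoids s ⟨s_pos, s_lt⟩) dist_le.not_gt

theorem bgMeasure_compl_survivalSet_le_avoidSet (hg : Measurable g₀) (hε : 0 < ε) (ht : 0 < t)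
    (Φ : CollisionTree) :
    bgMeasure g₀ (survivalSet ε t Φ)ᶜ ≤ bgMeasure g₀ (avoidSet ε t Φ)ᶜ := by
  refine measure_mono_ae ?_
  filter_upwards [measure_eq_zero_iff_ae_notMem.1 (bgMeasure_torusDist_pos_eq hg hε Φ 0),
    measure_eq_zero_iff_ae_notMem.1 (bgMeasure_torusDist_pos_eq hg hε Φ t)]
    with p no_contact_zero no_contact_t hits avoids
  exact (torusDist_eq_of_mem_avoidSet ht avoids hits).elim no_contact_zero no_contact_t

/-- The probability that a background particle meets the tagged particle of the tree. -/
noncomputable def hitProb (g₀ : Vel → ℝ) (ε t : ℝ) (Φ : CollisionTree) : ℝ :=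
  (bgMeasure g₀).real (survivalSet ε t Φ)ᶜ

theorem hitProb_nonneg (g₀ : Vel → ℝ) (ε t : ℝ) (Φ : CollisionTree) : 0 ≤ hitProb g₀ ε t Φ :=
  measureReal_nonneg

theorem hitProb_le_one (hg : IsVelocityDensity g₀) (ε t : ℝ) (Φ : CollisionTree) :
    hitProb g₀ ε t Φ ≤ 1 :=
  have := isProbabilityMeasure_bgMeasure hg
  measureReal_le_one

theorem etaErr_eq (hg : IsVelocityDensity g₀) (ε t : ℝ) (Φ : CollisionTree) :
    etaErr g₀ ε t Φ = (bgMeasure g₀).real (avoidSet ε t Φ)ᶜ := by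
  have avoid_meas := measurableSet_avoidSet ε t Φ
  have integrand_eq (p : Torus × Vel) :
      g₀ p.2 * (1 - (avoidSet ε t Φ).indicator (fun _ => (1 : ℝ)) p) =
        (avoidSet ε t Φ)ᶜ.indicator (fun p => g₀ p.2) p := by
    by_cases hp : p ∈ avoidSet ε t Φ <;> simp [hp]
  have g_meas : Measurable fun p : Torus × Vel => g₀ p.2 := hg.measurable.comp measurable_snd
  have g_nonneg : 0 ≤ᵐ[volume.restrict (avoidSet ε t Φ)ᶜ] fun p => g₀ p.2 :=
    .of_forall fun p => hg.nonneg p.2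
  simp only [etaErr, integrand_eq]
  rw [integral_indicator avoid_meas.compl, integral_eq_lintegral_of_nonneg_ae g_nonneg
    g_meas.aestronglyMeasurable, measureReal_def, bgMeasure, withDensity_apply _ avoid_meas.compl]

theorem etaErr_nonneg (hg : IsVelocityDensity g₀) (ε t : ℝ) (Φ : CollisionTree) :
    0 ≤ etaErr g₀ ε t Φ :=
  etaErr_eq hg ε t Φ ▸ measureReal_nonneg

theorem hitProb_le_etaErr (hg : IsVelocityDensity g₀) (hε : 0 < ε) (ht : 0 < t)
    (Φ : CollisionTree) : hitProb g₀ ε t Φ ≤ etaErr g₀ ε t Φ := by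
  have := isProbabilityMeasure_bgMeasure hg
  rw [etaErr_eq hg]
  exact ENNReal.toReal_mono (measure_ne_top _ _)
    (bgMeasure_compl_survivalSet_le_avoidSet hg.measurable hε ht Φ)

theorem hitProb_le (hg : IsVelocityDensity g₀) (hε : 0 < ε) (h : IsTree t Φ) :
    hitProb g₀ ε t Φ ≤ 4 / 3 * Real.pi * ε ^ 3 + ε ^ 2 * exposure g₀ t Φ := by
  have exposure_nonneg := exposure_nonneg hg t Φ
  refine ENNReal.toReal_le_of_le_ofReal (by positivity) ?_
  rw [ENNReal.ofReal_add (by positivity) (by positivity), ENNReal.ofReal_mul (sq_nonneg ε),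
    ← lintegral_lrate_occupation hg]
  exact bgMeasure_compl_survivalSet_le hg.measurable hg.lintegral_eq_one hε h

theorem survivalProb_eq (hg : IsVelocityDensity g₀) (ε t : ℝ) (Φ : CollisionTree) :
    survivalProb g₀ ε t Φ = ENNReal.ofReal (1 - hitProb g₀ ε t Φ) := by
  have := isProbabilityMeasure_bgMeasure hg
  rw [hitProb, probReal_compl_eq_one_sub (measurableSet_survivalSet ε t Φ), sub_sub_cancel,
    ofReal_measureReal, survivalProb]

end HitProb

theorem pow_le_descFactorial_mul {N : ℕ} {ε : ℝ} (hε : 0 ≤ ε) (hε1 : ε ≤ 1)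
    (hN : (N : ℝ) * ε ^ 2 = 1) {n : ℕ} (hn : (n : ℝ) * ε ≤ 1) :
    (1 - ε) ^ n ≤ N.descFactorial n * (ε ^ 2) ^ n := by
  induction n with
  | zero => simp
  | succ n ih =>
    push_cast at hn
    have le_sub_add : (N : ℝ) ≤ (N - n : ℕ) + n := by
      exact_mod_cast le_tsub_add (a := n) (b := N)
    have factor_le : 1 - ε ≤ (N - n : ℕ) * ε ^ 2 := by
      nlinarith [mul_le_mul_of_nonneg_right le_sub_add (sq_nonneg ε)]
    rw [Nat.descFactorial_succ, Nat.cast_mul, pow_succ, pow_succ]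
    calc (1 - ε) ^ n * (1 - ε)
        ≤ (N.descFactorial n * (ε ^ 2) ^ n) * ((N - n : ℕ) * ε ^ 2) :=
          mul_le_mul (ih (by linarith)) factor_le (sub_nonneg.2 hε1) (by positivity)
      _ = ((N - n : ℕ) * N.descFactorial n) * ((ε ^ 2) ^ n * ε ^ 2) := by ring

theorem one_sub_mul_exp_le {a b c : ℝ} (ha : 0 ≤ a) (hb : 0 ≤ b) (hb2 : b ≤ 1 / 2)
    (h : b ≤ c + a) : (1 - c) * Real.exp (-(a * (1 + 2 * b))) ≤ 1 - b := by
  rw [Real.exp_neg, ← div_eq_mul_inv, div_le_iff₀ (Real.exp_pos _)]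
  calc 1 - c ≤ (1 - b) * (a * (1 + 2 * b) + 1) := by
        nlinarith [mul_nonneg (mul_nonneg ha hb) (sub_nonneg.2 hb2)]
    _ ≤ (1 - b) * Real.exp (a * (1 + 2 * b)) :=
        mul_le_mul_of_nonneg_left (Real.add_one_le_exp _) (by linarith)

theorem pow_mul_exp_mul_le {N : ℕ} {a b c L : ℝ} (ha : 0 ≤ a) (hb : 0 ≤ b) (hb2 : b ≤ 1 / 2)
    (hc : c ≤ 1) (h : b ≤ c + a) (hL : N * a = L) :
    (1 - c) ^ N * (Real.exp (-L) * (1 - 2 * b * L)) ≤ (1 - b) ^ N := by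
  have := sub_nonneg.2 hc
  calc (1 - c) ^ N * (Real.exp (-L) * (1 - 2 * b * L))
      ≤ (1 - c) ^ N * (Real.exp (-L) * Real.exp (-(2 * b * L))) := by
        gcongr
        exact Real.one_sub_le_exp_neg _
    _ = ((1 - c) * Real.exp (-(a * (1 + 2 * b)))) ^ N := by
        rw [mul_pow, ← Real.exp_add, ← Real.exp_nat_mul, ← hL]
        ring_nf
    _ ≤ (1 - b) ^ N := pow_le_pow_left₀ (by positivity) (one_sub_mul_exp_le ha hb hb2 h) N

theorem four_thirds_pi_mul_cube_le {ε : ℝ} (hε : 0 ≤ ε) (hε3 : ε ≤ 1 / 3) :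
    4 / 3 * Real.pi * ε ^ 3 ≤ 1 / 4 :=
  calc 4 / 3 * Real.pi * ε ^ 3 ≤ 4 / 3 * 4 * (1 / 3) ^ 3 := by
        gcongr
        exact Real.pi_le_four
    _ ≤ 1 / 4 := by norm_num

theorem isClean_of_mem_goodTrees {T : ℝ} {V M : ℝ → ℝ} {ε t : ℝ} {Φ : CollisionTree} (hε : 0 ≤ ε)
    (good : Φ ∈ goodTrees T V M ε) (no_later : NoLaterContact ε t Φ) (h : IsTree t Φ) :
    IsClean ε t Φ := by
  obtain ⟨-, -, -, -, no_earlier, -, non_grazing⟩ := good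
  refine ⟨h, fun j => ?_, fun j s hs contact => ?_⟩
  · have := non_grazing j
    rwa [velBefore_collTime h.2] at this
  · rcases lt_trichotomy s (collTime Φ j) with s_lt | s_eq | s_gt
    · exact absurd (no_earlier ε hε le_rfl j s hs.1 s_lt) contact.not_gt
    · exact s_eq.symm
    · exact absurd (no_later j s s_gt hs.2) contact.not_gt

section Comparison

variable {f₀ : Torus × Vel → ℝ} {g₀ : Vel → ℝ} {N : ℕ} {T ε t : ℝ} {Φ : CollisionTree}

theorem one_sub_rho_le (hg : IsVelocityDensity g₀) (T : ℝ) (ht : 0 ≤ t) (hε1 : ε ≤ 1)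
    (Φ : CollisionTree) (k : ℕ) : 1 - rho g₀ T ε t Φ k ≤
      (1 - ε) ^ k * (1 - etaErr g₀ ε t Φ * maxRate g₀ T Φ * t) := by
  induction k with
  | zero => simp [rho]
  | succ k ih =>
    have loss_nonneg : 0 ≤ etaErr g₀ ε t Φ * maxRate g₀ T Φ * t :=
      mul_nonneg (mul_nonneg (etaErr_nonneg hg ε t Φ) (maxRate_nonneg hg T Φ)) ht
    calc 1 - rho g₀ T ε t Φ (k + 1)
        ≤ (1 - ε) * (1 - rho g₀ T ε t Φ k) := by
          rw [rho]
          linarith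
      _ ≤ (1 - ε) * ((1 - ε) ^ k * (1 - etaErr g₀ ε t Φ * maxRate g₀ T Φ * t)) :=
          mul_le_mul_of_nonneg_left ih (sub_nonneg.2 hε1)
      _ = (1 - ε) ^ (k + 1) * (1 - etaErr g₀ ε t Φ * maxRate g₀ T Φ * t) := by ring

theorem two_mul_exposure_le (hg : IsVelocityDensity g₀) (ht : t ∈ Icc 0 T) (Φ : CollisionTree) :
    2 * exposure g₀ t Φ ≤ maxRate g₀ T Φ * t := by
  have rate_le (s : ℝ) (hs : s ∈ Ico 0 t) : rate g₀ (vel Φ s) ≤ maxRate g₀ T Φ / 2 := by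
    linarith [two_mul_rate_vel_le_maxRate g₀ ⟨hs.1, hs.2.le.trans ht.2⟩ Φ]
  linarith [exposure_le hg ht.1 rate_le]

theorem two_mul_hitProb_mul_exposure_le (hg : IsVelocityDensity g₀) (hε : 0 < ε)
    (ht : t ∈ Icc 0 T) (Φ : CollisionTree) :
    2 * hitProb g₀ ε t Φ * exposure g₀ t Φ ≤ etaErr g₀ ε t Φ * maxRate g₀ T Φ * t := by
  have exposure_le := two_mul_exposure_le hg ht Φ
  rcases ht.1.eq_or_lt with rfl | t_pos
  · have exposure_eq : exposure g₀ 0 Φ = 0 := by linarith [exposure_nonneg hg 0 Φ]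
    simp [exposure_eq]
  · calc 2 * hitProb g₀ ε t Φ * exposure g₀ t Φ
        = hitProb g₀ ε t Φ * (2 * exposure g₀ t Φ) := by ring
      _ ≤ etaErr g₀ ε t Φ * (maxRate g₀ T Φ * t) :=
        mul_le_mul (hitProb_le_etaErr hg hε t_pos Φ) exposure_le
          (mul_nonneg zero_le_two (exposure_nonneg hg t Φ)) (etaErr_nonneg hg ε t Φ)
      _ = etaErr g₀ ε t Φ * maxRate g₀ T Φ * t := by ring

theorem zeta_mul_exp_mul_le (hg : IsVelocityDensity g₀) (hε : 0 < ε) (hε3 : ε ≤ 1 / 3)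
    (hN : (N : ℝ) * ε ^ 2 = 1) (h : IsTree t Φ) (small : ε ^ 2 * exposure g₀ t Φ ≤ 1 / 8) :
    zeta N ε * (Real.exp (-exposure g₀ t Φ) * (1 - 2 * hitProb g₀ ε t Φ * exposure g₀ t Φ)) ≤
      (1 - hitProb g₀ ε t Φ) ^ N := by
  have exposure_nonneg := exposure_nonneg hg t Φ
  have volume_le := four_thirds_pi_mul_cube_le hε.le hε3
  have hit_le := hitProb_le hg hε h
  refine pow_mul_exp_mul_le (a := ε ^ 2 * exposure g₀ t Φ) (by positivity)
    (hitProb_nonneg g₀ ε t Φ) (by linarith) (by linarith) hit_le ?_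
  rw [← mul_assoc, hN, one_mul]

theorem startJac_mul_prod_eq (hg : ∀ v, 0 ≤ g₀ v) (ε : ℝ) (Φ : CollisionTree) :
    startJac ε Φ * ∏ j, ENNReal.ofReal (g₀ (collVel Φ j)) =
      ENNReal.ofReal ((ε ^ 2) ^ numColl Φ * collisionWeight g₀ Φ) := by
  have factor_eq (j : Fin (numColl Φ)) :
      ENNReal.ofReal (ε ^ 2 * max (normalSpeed Φ j) 0) * ENNReal.ofReal (g₀ (collVel Φ j)) =
        ENNReal.ofReal (ε ^ 2 * (g₀ (collVel Φ j) * max (normalSpeed Φ j) 0)) := by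
    rw [← ENNReal.ofReal_mul (by positivity)]
    ring_nf
  rw [startJac, ← Finset.prod_mul_distrib, Finset.prod_congr rfl fun j _ => factor_eq j,
    ← ENNReal.ofReal_prod_of_nonneg fun j _ =>
      mul_nonneg (sq_nonneg ε) (mul_nonneg (hg _) (le_max_right _ _)),
    Finset.prod_mul_distrib, Finset.prod_const, Finset.card_univ, Fintype.card_fin, collisionWeight]

theorem labelledDensity_eq (hf : ∀ r, 0 ≤ f₀ r) (hg : IsVelocityDensity g₀) (N : ℕ) (ε t : ℝ)
    (Φ : CollisionTree) : labelledDensity f₀ g₀ N ε t Φ =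
      ENNReal.ofReal (f₀ Φ.2.1 * ((ε ^ 2) ^ numColl Φ * collisionWeight g₀ Φ *
        (1 - hitProb g₀ ε t Φ) ^ (N - numColl Φ))) := by
  have weight_nonneg := collisionWeight_nonneg hg.nonneg Φ
  have survival_nonneg := sub_nonneg.2 (hitProb_le_one hg ε t Φ)
  rw [labelledDensity, startJac_mul_prod_eq hg.nonneg, survivalProb_eq hg,
    ← ENNReal.ofReal_pow survival_nonneg, ← ENNReal.ofReal_mul (by positivity),
    ← ENNReal.ofReal_mul (hf _)]

theorem one_sub_rhoHat_mul_le_labelledDensity (hf : ∀ r, 0 ≤ f₀ r) (hg : IsVelocityDensity g₀)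
    (hε : 0 < ε) (hε3 : ε ≤ 1 / 3) (hN : (N : ℝ) * ε ^ 2 = 1) (hn : (numColl Φ : ℝ) * ε ≤ 1)
    (ht : t ∈ Icc 0 T) (h : IsTree t Φ) (small : ε ^ 2 * exposure g₀ t Φ ≤ 1 / 8) :
    ENNReal.ofReal ((1 - rhoHat g₀ T ε t Φ) * (zeta N ε * idealDensity f₀ g₀ t Φ)) ≤
      N.descFactorial (numColl Φ) * labelledDensity f₀ g₀ N ε t Φ := by
  set b := hitProb g₀ ε t Φ
  set L := exposure g₀ t Φ
  set w := f₀ Φ.2.1 * collisionWeight g₀ Φ with hw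
  have w_nonneg : 0 ≤ w := mul_nonneg (hf _) (collisionWeight_nonneg hg.nonneg Φ)
  have b_nonneg : 0 ≤ b := hitProb_nonneg g₀ ε t Φ
  have survival_nonneg : 0 ≤ 1 - b := sub_nonneg.2 (hitProb_le_one hg ε t Φ)
  have ε_le_one : ε ≤ 1 := by linarith
  have zeta_nonneg : 0 ≤ zeta N ε :=
    pow_nonneg (by linarith [four_thirds_pi_mul_cube_le hε.le hε3]) N
  have one_sub_rhoHat_le : 1 - rhoHat g₀ T ε t Φ ≤ (1 - ε) ^ numColl Φ * (1 - 2 * b * L) :=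
    (one_sub_rho_le hg T ht.1 ε_le_one Φ _).trans <|
      mul_le_mul_of_nonneg_left (sub_le_sub_left (two_mul_hitProb_mul_exposure_le hg hε ht Φ) 1)
        (pow_nonneg (sub_nonneg.2 ε_le_one) _)
  have survival_ge : zeta N ε * (Real.exp (-L) * (1 - 2 * b * L)) ≤ (1 - b) ^ (N - numColl Φ) :=
    (zeta_mul_exp_mul_le hg hε hε3 hN h small).trans
      (pow_le_pow_of_le_one survival_nonneg (sub_le_self 1 b_nonneg) (Nat.sub_le _ _))
  rw [labelledDensity_eq hf hg, ← ENNReal.ofReal_natCast, ← ENNReal.ofReal_mul (Nat.cast_nonneg _),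
    idealDensity_eq hg ht.1 h]
  refine ENNReal.ofReal_le_ofReal ?_
  calc (1 - rhoHat g₀ T ε t Φ) *
        (zeta N ε * (Real.exp (-L) * f₀ Φ.2.1 * collisionWeight g₀ Φ))
      = (1 - rhoHat g₀ T ε t Φ) * (zeta N ε * (Real.exp (-L) * w)) := by rw [hw]; ring
    _ ≤ ((1 - ε) ^ numColl Φ * (1 - 2 * b * L)) * (zeta N ε * (Real.exp (-L) * w)) := by gcongr
    _ = (1 - ε) ^ numColl Φ * (w * (zeta N ε * (Real.exp (-L) * (1 - 2 * b * L)))) := by ring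
    _ ≤ (1 - ε) ^ numColl Φ * (w * (1 - b) ^ (N - numColl Φ)) := by
        have := sub_nonneg.2 ε_le_one
        gcongr
    _ ≤ (N.descFactorial (numColl Φ) * (ε ^ 2) ^ numColl Φ) *
        (w * (1 - b) ^ (N - numColl Φ)) := by
        gcongr
        exact pow_le_descFactorial_mul hε.le ε_le_one hN hn
    _ = N.descFactorial (numColl Φ) * (f₀ Φ.2.1 * ((ε ^ 2) ^ numColl Φ * collisionWeight g₀ Φ *
        (1 - b) ^ (N - numColl Φ))) := by rw [hw]; ring

end Comparison

theorem sq_mul_exposure_le_of_mem_goodTrees {g₀ : Vel → ℝ} {V M : ℝ → ℝ} {K T ε t : ℝ}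
    {Φ : CollisionTree} (hg : IsVelocityDensity g₀) (hK : 0 ≤ K)
    (rate_le : ∀ v, rate g₀ v ≤ K * (1 + ‖v‖)) (ht : t ∈ Icc 0 T) (good : Φ ∈ goodTrees T V M ε) :
    ε ^ 2 * exposure g₀ t Φ ≤ T * K * (ε ^ 2 + ε ^ 2 * V ε) := by
  obtain ⟨-, -, -, vel_le, -⟩ := good
  have V_nonneg : 0 ≤ V ε := (norm_nonneg _).trans (vel_le 0 ⟨le_rfl, ht.1.trans ht.2⟩)
  have exposure_le : exposure g₀ t Φ ≤ t * (K * (1 + V ε)) :=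
    exposure_le hg ht.1 fun s hs => (rate_le _).trans <| by
      gcongr
      exact vel_le s ⟨hs.1, hs.2.le.trans ht.2⟩
  calc ε ^ 2 * exposure g₀ t Φ ≤ ε ^ 2 * (t * (K * (1 + V ε))) := by gcongr
    _ ≤ ε ^ 2 * (T * (K * (1 + V ε))) := by
        gcongr
        exact ht.2
    _ = T * K * (ε ^ 2 + ε ^ 2 * V ε) := by ring

theorem exists_forall_cutoff_le {V M : ℝ → ℝ} (hV : Tendsto (fun ε => ε ^ 2 * V ε) (𝓝[>] 0) (𝓝 0))
    (hM : ∀ᶠ ε in 𝓝[>] 0, ε * M ε ≤ 1) (a : ℝ) : ∃ ε₀ : ℝ, 0 < ε₀ ∧ ∀ ε, 0 < ε → ε < ε₀ →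
      ε ≤ 1 / 3 ∧ ε * M ε ≤ 1 ∧ a * (ε ^ 2 + ε ^ 2 * V ε) ≤ 1 / 8 := by
  have sq_tendsto : Tendsto (fun ε : ℝ => ε ^ 2) (𝓝[>] 0) (𝓝 0) :=
    ((continuous_pow 2).tendsto' 0 0 (by norm_num)).mono_left nhdsWithin_le_nhds
  have speed_tendsto : Tendsto (fun ε => a * (ε ^ 2 + ε ^ 2 * V ε)) (𝓝[>] 0) (𝓝 0) := by
    simpa using (sq_tendsto.add hV).const_mul a
  have le_third : ∀ᶠ ε : ℝ in 𝓝[>] 0, ε ≤ 1 / 3 :=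
    (eventually_le_nhds (by norm_num)).filter_mono nhdsWithin_le_nhds
  have speed_le : ∀ᶠ ε in 𝓝[>] 0, a * (ε ^ 2 + ε ^ 2 * V ε) ≤ 1 / 8 :=
    speed_tendsto.eventually_le_const (by norm_num)
  obtain ⟨ε₀, ε₀_pos, h⟩ := mem_nhdsGT_iff_exists_Ioo_subset.1 (le_third.and (hM.and speed_le))
  exact ⟨ε₀, ε₀_pos, fun ε hε hε0 => h ⟨hε, hε0⟩⟩

theorem Admissible.integrable_f {f₀ : Torus × Vel → ℝ} {g₀ : Vel → ℝ} (h : Admissible f₀ g₀) :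
    Integrable f₀ :=
  .of_integral_ne_zero (by rw [h.f_integral]; exact one_ne_zero)

theorem Admissible.isVelocityDensity {f₀ : Torus × Vel → ℝ} {g₀ : Vel → ℝ}
    (h : Admissible f₀ g₀) : IsVelocityDensity g₀ where
  measurable := h.g_meas
  nonneg := h.g_nonneg
  integral_eq_one := h.g_integral
  integrable_mul_norm := by
    refine h.g_moment.mono' (h.g_meas.mul measurable_norm).aestronglyMeasurable
      (.of_forall fun u => ?_)
    rw [Real.norm_of_nonneg (mul_nonneg (h.g_nonneg u) (norm_nonneg u))]
    exact mul_le_mul_of_nonneg_left (by nlinarith [sq_nonneg (‖u‖ - 1)]) (h.g_nonneg u)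

theorem IsCutoff.tendsto_sq_mul_V {V M : ℝ → ℝ} (h : IsCutoff V M) :
    Tendsto (fun ε => ε ^ 2 * V ε) (𝓝[>] 0) (𝓝 0) := by
  have bound_tendsto : Tendsto (fun ε : ℝ => ε ^ 2 + ε / 8) (𝓝[>] 0) (𝓝 0) :=
    (Continuous.tendsto' (by fun_prop) 0 0 (by norm_num)).mono_left nhdsWithin_le_nhds
  refine squeeze_zero' ?_ ?_ bound_tendsto
  · filter_upwards [self_mem_nhdsWithin] with ε hε
    exact mul_nonneg (sq_nonneg ε) (h.V_nonneg ε hε)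
  · filter_upwards [Ioo_mem_nhdsGT one_pos] with ε hε
    have V_nonneg := h.V_nonneg ε hε.1
    have V_le : V ε ≤ 1 + V ε ^ 3 := by
      nlinarith [mul_nonneg (sq_nonneg (V ε - 1)) (add_nonneg V_nonneg zero_le_one)]
    nlinarith [mul_le_mul_of_nonneg_left (h.V_le ε hε.1 hε.2) hε.1.le,
      mul_le_mul_of_nonneg_left V_le (sq_nonneg ε)]

theorem IsCutoff.eventually_mul_M_le_one {V M : ℝ → ℝ} (h : IsCutoff V M) :
    ∀ᶠ ε in 𝓝[>] 0, ε * M ε ≤ 1 := by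
  filter_upwards [Ioo_mem_nhdsGT one_pos] with ε ⟨ε_pos, ε_lt⟩
  calc ε * M ε ≤ ε * (1 / √ε) := mul_le_mul_of_nonneg_left (h.M_le ε ε_pos ε_lt) ε_pos.le
    _ = √ε := by rw [mul_one_div, Real.div_sqrt]
    _ ≤ 1 := Real.sqrt_le_one.2 ε_lt.le

theorem ae_one_sub_rhoHat_mul_idealDensity_le {f₀ : Torus × Vel → ℝ} {g₀ : Vel → ℝ}
    {V M : ℝ → ℝ} {N : ℕ} {T ε t : ℝ} (hf : Measurable f₀) (hf0 : ∀ r, 0 ≤ f₀ r)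
    (hfi : Integrable f₀) (hg : IsVelocityDensity g₀) (hε : 0 < ε) (hε3 : ε ≤ 1 / 3)
    (hN : (N : ℝ) * ε ^ 2 = 1) (hM : ε * M ε ≤ 1) (ht : t ∈ Icc 0 T) :
    ∀ᵐ Φ ∂treeMeasure, Φ ∈ goodTrees T V M ε → NoLaterContact ε t Φ →
      ε ^ 2 * exposure g₀ t Φ ≤ 1 / 8 →
        (1 - rhoHat g₀ T ε t Φ) * (zeta N ε * idealDensity f₀ g₀ t Φ) ≤
          empiricalDensity f₀ g₀ N ε t Φ := by
  have := isFiniteMeasure_empiricalLaw hfi hg N ε t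
  filter_upwards [ae_labelledDensity_le_rnDeriv (N := N) hf hg.measurable ht.1 hε (by linarith),
    (empiricalLaw f₀ g₀ N ε t).rnDeriv_lt_top treeMeasure]
    with Φ labelled_le rnDeriv_lt_top good no_later small
  by_cases h : IsTree t Φ
  · have few_collisions : (numColl Φ : ℝ) * ε ≤ 1 := by
      rw [mul_comm]
      exact (mul_le_mul_of_nonneg_left good.2.1 hε.le).trans hM
    exact (ENNReal.ofReal_le_iff_le_toReal rnDeriv_lt_top.ne).1 <|
      (one_sub_rhoHat_mul_le_labelledDensity hf0 hg hε hε3 hN few_collisions ht h small).trans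
        (labelled_le (isClean_of_mem_goodTrees hε.le good no_later h))
  · rw [idealDensity_eq_zero good.1 h, mul_zero, mul_zero]
    exact ENNReal.toReal_nonneg

end RayleighGas

open RayleighGas in
theorem proposition5p1_general (T : ℝ) (f₀ : Torus × Vel → ℝ) (g₀ : Vel → ℝ) (hf : Measurable f₀)
    (hf0 : ∀ r, 0 ≤ f₀ r) (hfi : Integrable f₀) (hg : IsVelocityDensity g₀)
    (V M : ℝ → ℝ) (hV : Tendsto (fun ε => ε ^ 2 * V ε) (𝓝[>] 0) (𝓝 0))
    (hM : ∀ᶠ ε in 𝓝[>] 0, ε * M ε ≤ 1) :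
    ∃ ε₀ : ℝ, 0 < ε₀ ∧ ∀ (N : ℕ) (ε : ℝ), 0 < ε → ε < ε₀ → (N : ℝ) * ε ^ 2 = 1 →
      ∀ t ∈ Icc 0 T, ∀ᵐ Φ ∂treeMeasure, Φ ∈ goodTrees T V M ε → NoLaterContact ε t Φ →
        empiricalDensity f₀ g₀ N ε t Φ - zeta N ε * idealDensity f₀ g₀ t Φ ≥
          -(rhoHat g₀ T ε t Φ * (zeta N ε * idealDensity f₀ g₀ t Φ)) := by
  obtain ⟨K, K_nonneg, rate_le⟩ := hg.exists_rate_le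
  obtain ⟨ε₀, ε₀_pos, cutoff_le⟩ := exists_forall_cutoff_le hV hM (T * K)
  refine ⟨ε₀, ε₀_pos, fun N ε hε hε0 hN t ht => ?_⟩
  obtain ⟨hε3, M_le, speed_le⟩ := cutoff_le ε hε hε0
  filter_upwards [ae_one_sub_rhoHat_mul_idealDensity_le hf hf0 hfi hg hε hε3 hN M_le ht]
    with Φ lower_bound good no_later
  have small := (sq_mul_exposure_le_of_mem_goodTrees hg K_nonneg rate_le ht good).trans speed_le
  linarith [lower_bound good no_later small]

theorem proposition5p1 (T : ℝ) (hT : 0 < T)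
    (f₀ : RayleighGas.Torus × RayleighGas.Vel → ℝ) (g₀ : RayleighGas.Vel → ℝ)
    (hfg : RayleighGas.Admissible f₀ g₀)
    (V M : ℝ → ℝ) (hVM : RayleighGas.IsCutoff V M) :
    ∃ ε₀ : ℝ, 0 < ε₀ ∧
      ∀ (N : ℕ) (ε : ℝ), 0 < ε → ε < ε₀ → (N : ℝ) * ε ^ 2 = 1 →
        ∀ t ∈ Set.Icc 0 T, ∀ᵐ Φ ∂(RayleighGas.treeMeasure),
          Φ ∈ RayleighGas.goodTrees T V M ε → RayleighGas.NoLaterContact ε t Φ →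
            RayleighGas.empiricalDensity f₀ g₀ N ε t Φ
                - RayleighGas.zeta N ε * RayleighGas.idealDensity f₀ g₀ t Φ
              ≥ -(RayleighGas.rhoHat g₀ T ε t Φ *
                  (RayleighGas.zeta N ε * RayleighGas.idealDensity f₀ g₀ t Φ)) :=
  proposition5p1_general T f₀ g₀ hfg.f_meas hfg.f_nonneg hfg.integrable_f
    hfg.isVelocityDensity V M hVM.tendsto_sq_mul_V hVM.eventually_mul_M_le_one
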